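/- Let $d \ge 2$ be an integer, let $S^d$ be the unit sphere in $\mathbb{R}^{d+1}$, with geodesic distance $|xy|$ normalized so that $|xy| \le 2\pi$ (thus $\cos(|xy|/2)$ is the Euclidean inner product of $x, y \in S^d$), and let $G$ be a locally compact group. A kernel $K : X \times X \to \mathbb{C}$ on a set $X$ is positive definite if $\sum_{i,j=1}^n c_i \overline{c_j} K(x_i,x_j)$ is a nonnegative real number for all $n \ge 1$, all distinct $x_1,\dots,x_n \in X$ and all $c \in \mathbb{C}^n$; it is strictly positive definite if this sum is moreover positive whenever $c \neq 0$. A continuous function $f : G \times [-1,1] \to \mathbb{C}$ is called the isotropic part of the kernel $$\big((u,x),(v,y)\big) \mapsto f\big(u^{-1}v, \cos(|xy|/2)\big)$$ on $G \times S^d$. For such an $f$, for $k \in \{0,1,2,\dots\}$ and $u \in G$, put $$a_k^d(f;u) = c(k,d) \int_{-1}^1 f(u,s)\, C_k^{(d-1)/2}(s)\, (1-s^2)^{(d-2)/2}\, ds, \qquad c(k,d) = \Big( \int_{-1}^1 C_k^{(d-1)/2}(s)^2 (1-s^2)^{(d-2)/2}\, ds \Big)^{-1},$$ where $C_k^{(d-1)/2}$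 is the Gegenbauer polynomial of degree $k$ and index $(d-1)/2$. Let $f$ and $g$ be isotropic parts of positive definite kernels on $G \times S^d$. Then the following assertions are equivalent: (i) the product $fg$ is the isotropic part of a strictly positive definite kernel on $G \times S^d$; (ii) for all $p \ge 1$, all distinct points $u_1,\dots,u_p$ in $G$ and all nonzero $c \in \mathbb{C}^p$, the set $$\Big\{ k+l \;:\; k,l \ge 0,\ c^t \big[ a_k^d(f;u_\mu^{-1}u_\nu)\, a_l^d(g;u_\mu^{-1}u_\nu) \big]_{\mu,\nu=1}^p\, \overline{c} > 0 \Big\}$$ contains infinitely many even and infinitely many odd integers. -/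

import Mathlib

open Polynomial MeasureTheory
open scoped ComplexOrder

noncomputable section

/-- A complex kernel `K` on a set `X` is positive definite: for all distinct points
`x₁, …, xₙ` and all complex scalars `c₁, …, cₙ`, the sum `∑ cᵢ c̄ⱼ K(xᵢ, xⱼ)` is a nonnegative
real number (in the order of `ℂ` used here, `0 ≤ z` means that `z` is real and `z ≥ 0`). -/
def IsPosDefKernel {X : Type*} (K : X → X → ℂ) : Prop :=
  ∀ (n : ℕ) (x : Fin n → X), Function.Injective x → ∀ c : Fin n → ℂ,
    0 ≤ ∑ i, ∑ j, c i * starRingEnd ℂ (c j) * K (x i) (x j)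

/-- A complex kernel is strictly positive definite: the sums above are positive real numbers
as soon as the scalars are not all zero. -/
def IsStrictPosDefKernel {X : Type*} (K : X → X → ℂ) : Prop :=
  ∀ (n : ℕ) (x : Fin n → X), Function.Injective x → ∀ c : Fin n → ℂ, c ≠ 0 →
    0 < ∑ i, ∑ j, c i * starRingEnd ℂ (c j) * K (x i) (x j)

/-- The unit sphere `S^d` of `ℝ^(d+1)`. -/
abbrev UnitSphere (d : ℕ) : Type :=
  Metric.sphere (0 : EuclideanSpace ℝ (Fin (d + 1))) 1

/-- The geodesic distance `|xy|` on `S^d`, normalized so that its maximum is `2π`. -/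
def sphereDist {d : ℕ} (x y : UnitSphere d) : ℝ :=
  2 * InnerProductGeometry.angle (x : EuclideanSpace ℝ (Fin (d + 1))) y

theorem cos_half_sphereDist {d : ℕ} (x y : UnitSphere d) :
    Real.cos (sphereDist x y / 2) =
      inner ℝ (x : EuclideanSpace ℝ (Fin (d + 1))) (y : EuclideanSpace ℝ (Fin (d + 1))) := by
  have hx : ‖(x : EuclideanSpace ℝ (Fin (d + 1)))‖ = 1 := by simp
  have hy : ‖(y : EuclideanSpace ℝ (Fin (d + 1)))‖ = 1 := by simp
  rw [sphereDist, mul_div_cancel_left₀ _ (two_ne_zero), InnerProductGeometry.cos_angle, hx, hy]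
  simp

/-- The kernel `((u,x),(v,y)) ↦ f (u⁻¹ v, cos (|xy| / 2))` on `G × S^d`. Only the values of `f`
on `G × [-1,1]` matter. -/
def isotropicKernel {G : Type*} [Group G] (d : ℕ) (f : G → ℝ → ℂ) :
    G × UnitSphere d → G × UnitSphere d → ℂ :=
  fun z w => f (z.1⁻¹ * w.1) (Real.cos (sphereDist z.2 w.2 / 2))

/-- `f` is the isotropic part of a positive definite kernel on `G × S^d`: it is continuous on
`G × [-1,1]` and its kernel is positive definite. -/
def IsIsotropicPartPD {G : Type*} [Group G] [TopologicalSpace G] (d : ℕ) (f : G → ℝ → ℂ) : Prop :=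
  ContinuousOn (Function.uncurry f) (Set.univ ×ˢ Set.Icc (-1 : ℝ) 1) ∧
    IsPosDefKernel (isotropicKernel d f)

/-- `f` is the isotropic part of a strictly positive definite kernel on `G × S^d`. -/
def IsIsotropicPartSPD {G : Type*} [Group G] [TopologicalSpace G] (d : ℕ) (f : G → ℝ → ℂ) : Prop :=
  ContinuousOn (Function.uncurry f) (Set.univ ×ˢ Set.Icc (-1 : ℝ) 1) ∧
    IsStrictPosDefKernel (isotropicKernel d f)

/-- The Gegenbauer (ultraspherical) polynomials `C_k^r`, with `C_0^r = 1`, `C_1^r = 2 r t` and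
`(k+2) C_(k+2)^r = 2 (k+1+r) t C_(k+1)^r - (k+2r) C_k^r`. -/
def gegenbauer (r : ℝ) : ℕ → ℝ[X]
  | 0 => 1
  | 1 => C (2 * r) * X
  | k + 2 => C (1 / ((k : ℝ) + 2)) *
      (C (2 * ((k : ℝ) + 1 + r)) * X * gegenbauer r (k + 1) -
        C ((k : ℝ) + 2 * r) * gegenbauer r k)

/-- The value at `t` of `C_k^((d-1)/2)`, the Gegenbauer polynomial attached to `S^d`. -/
def gegenbauerSphere (d k : ℕ) (t : ℝ) : ℝ :=
  (gegenbauer (((d : ℝ) - 1) / 2) k).eval t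

/-- The weight `(1 - s²)^((d-2)/2)` on `[-1,1]`. -/
def gegenbauerWeight (d : ℕ) (s : ℝ) : ℝ :=
  (1 - s ^ 2) ^ (((d : ℝ) - 2) / 2)

/-- The normalization constant `c(k,d)`, the inverse of the squared norm of `C_k^((d-1)/2)` in the
weighted `L²` space; it is the one for which the coefficients below are those of the expansion
`f (u,t) = ∑ₖ a_k^d(f;u) C_k^((d-1)/2)(t)`. -/
def gegenbauerNormalization (d k : ℕ) : ℝ :=
  (∫ s in (-1 : ℝ)..1, gegenbauerSphere d k s ^ 2 * gegenbauerWeight d s)⁻¹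

/-- The coefficient
`a_k^d(f;u) = c(k,d) ∫_{-1}^{1} f(u,s) C_k^((d-1)/2)(s) (1-s²)^((d-2)/2) ds`. -/
def gegenbauerCoeff {G : Type*} (d k : ℕ) (f : G → ℝ → ℂ) (u : G) : ℂ :=
  (gegenbauerNormalization d k : ℂ) *
    ∫ s in (-1 : ℝ)..1, f u s * (gegenbauerSphere d k s : ℂ) * (gegenbauerWeight d s : ℂ)

/-- The set of all `k + l` for which
`c^t [a_k^d(f; u_μ⁻¹ u_ν) a_l^d(g; u_μ⁻¹ u_ν)] c̄` is positive. -/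
def positiveSumSet {G : Type*} [Group G] (d : ℕ) (f g : G → ℝ → ℂ) {p : ℕ}
    (u : Fin p → G) (c : Fin p → ℂ) : Set ℕ :=
  {m | ∃ k l : ℕ, m = k + l ∧
    0 < c ⬝ᵥ ((Matrix.of fun μ ν : Fin p =>
      gegenbauerCoeff d k f ((u μ)⁻¹ * u ν) * gegenbauerCoeff d l g ((u μ)⁻¹ * u ν)).mulVec
        (star c))}

end

/-! Write `C_k` for the Gegenbauer polynomials of `S^d`. Schoenberg's theorem in the sphere variable
gives `f(u,t) = ∑ a_k(f;u) C_k(t)` (`IsIsotropicPartPD.hasSum`), and for each `k` the matrices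
`a_k(f; u_μ⁻¹ u_ν)` are positive semidefinite. Multiplying the expansions of `f` and `g`, the
quadratic form of `fg` at points `(u_i, x_i)` becomes a sum over pairs `(k,l)` of the forms of the
Hadamard products of `A_kl = [a_k(f) a_l(g)]` and `Z_kl = [C_k(x_i·x_j) C_l(x_i·x_j)]`
(`hasSum_product_form`). By Schur's product theorem every term is nonnegative, so the form vanishes
only if all terms do.

(i) ⇒ (ii): attach to each `u_μ` the vertices of a regular `2r`-gon on a great circle, with weights
`c_μ (-1)^j`. The `(k,l)` term factors as the form of `A_kl` at `c` times an alternating polygon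
sum, which is zero unless `k+l ≥ r` and `k+l ≡ r` mod 2. Strict positivity thus forces an element of
the set that is at least `r` and has the parity of `r` (`exists_mem_positiveSumSet`); `r` is
arbitrary.

(ii) ⇒ (i): if the form vanishes, replace each `x_i` by a representative of its antipodal pair;
parity of `C_k C_l` moves the signs into the coefficients as `ε_i^(k+l)`. Between distinct
representatives `C_k/C_k(1)` tends to 0, so for large `k+l` the matrix `Z_kl` dominates a positive
multiple of the indicator of one representative, and the form of `A_kl` vanishes at the part of the
vector over that representative (`exists_kernelForm_restrict_eq_zero`). After equal group elements
are merged, this part depends only on the parity of `k+l`, so (ii) makes both its even and its odd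
version zero. They determine every coefficient.

The inputs on `C_k` are: the Gram property, from the reproducing property of zonal harmonics
(`exists_gram_gegenbauerSphere`); the bound by `C_k(1)` and the decay of the ratio, from Laplace's
integral; orthogonality; and Schoenberg's theorem (`hasSum_sphereCoeff`). -/

/-! ### Solid zonal harmonics and the Fischer product -/

section Fischer

open MvPolynomial

variable {σ : Type*} [Fintype σ]

/-- The linear form `x ↦ ∑ yᵢ xᵢ` as a polynomial. -/
noncomputable def linearFormPoly (y : σ → ℝ) : MvPolynomial σ ℝ :=
  ∑ i, MvPolynomial.C (y i) * MvPolynomial.X i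

/-- The polynomial `∑ xᵢ²`. -/
noncomputable def normSqPoly (σ : Type*) [Fintype σ] : MvPolynomial σ ℝ :=
  ∑ i : σ, MvPolynomial.X i * MvPolynomial.X i

/-- The derivative in the direction `y`. -/
noncomputable def dirDeriv (y : σ → ℝ) : Derivation ℝ (MvPolynomial σ ℝ) (MvPolynomial σ ℝ) :=
  ∑ i, y i • MvPolynomial.pderiv i

/-- The Laplacian on polynomials. -/
noncomputable def polyLaplacian : MvPolynomial σ ℝ →ₗ[ℝ] MvPolynomial σ ℝ :=
  ∑ i : σ, (MvPolynomial.pderiv (R := ℝ) i).toLinearMap ∘ₗ (MvPolynomial.pderiv i).toLinearMap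

theorem dirDeriv_apply (y : σ → ℝ) (p : MvPolynomial σ ℝ) :
    dirDeriv y p = ∑ i, MvPolynomial.C (y i) * MvPolynomial.pderiv i p := by
  have := congrFun (map_sum (Derivation.coeFnAddMonoidHom (R := ℝ) (A := MvPolynomial σ ℝ)
    (M := MvPolynomial σ ℝ)) (fun i => y i • MvPolynomial.pderiv i) Finset.univ) p
  simp only [Derivation.coeFnAddMonoidHom_apply] at this
  rw [dirDeriv, this, Finset.sum_apply]
  simp [MvPolynomial.smul_eq_C_mul]

theorem polyLaplacian_apply (p : MvPolynomial σ ℝ) :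
    polyLaplacian p = ∑ i, MvPolynomial.pderiv i (MvPolynomial.pderiv i p) := by
  simp [polyLaplacian]

theorem pderiv_linearFormPoly (y : σ → ℝ) (i : σ) :
    MvPolynomial.pderiv i (linearFormPoly y) = MvPolynomial.C (y i) := by
  classical
  simp only [linearFormPoly, map_sum, Derivation.leibniz, MvPolynomial.pderiv_C, pderiv_X,
    smul_eq_mul, mul_zero, add_zero]
  rw [Finset.sum_eq_single i] <;> simp +contextual [eq_comm]

theorem pderiv_normSqPoly (i : σ) :
    MvPolynomial.pderiv i (normSqPoly σ) = 2 * MvPolynomial.X i := by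
  classical
  simp only [normSqPoly, map_sum, Derivation.leibniz, pderiv_X, smul_eq_mul]
  rw [Finset.sum_eq_single i]
  · simp; ring
  · intro b _ hb
    simp [hb]
  · simp

theorem polyLaplacian_linearFormPoly_mul (y : σ → ℝ) (p : MvPolynomial σ ℝ) :
    polyLaplacian (linearFormPoly y * p) =
      linearFormPoly y * polyLaplacian p + 2 * dirDeriv y p := by
  simp only [polyLaplacian_apply, dirDeriv_apply, Finset.mul_sum, ← Finset.sum_add_distrib]
  refine Finset.sum_congr rfl fun i _ => ?_
  simp only [Derivation.leibniz, map_add, pderiv_linearFormPoly, MvPolynomial.pderiv_C,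
    smul_eq_mul]
  ring

/-- The cross terms add up to `4 ∑ xᵢ ∂ᵢp`, which is `4kp` by Euler's identity. -/
theorem polyLaplacian_normSqPoly_mul {p : MvPolynomial σ ℝ} {k : ℕ} (hp : p.IsHomogeneous k) :
    polyLaplacian (normSqPoly σ * p) = normSqPoly σ * polyLaplacian p +
      MvPolynomial.C (4 * k + 2 * Fintype.card σ : ℝ) * p := by
  have hE := hp.sum_X_mul_pderiv
  have h2 : ∀ i : σ, MvPolynomial.pderiv i (2 : MvPolynomial σ ℝ) = 0 := fun i =>
    (MvPolynomial.pderiv i).map_natCast 2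
  have : ∀ i : σ, MvPolynomial.pderiv i (MvPolynomial.pderiv i (normSqPoly σ * p)) =
      normSqPoly σ * MvPolynomial.pderiv i (MvPolynomial.pderiv i p)
        + 4 * (MvPolynomial.X i * MvPolynomial.pderiv i p) + 2 * p := by
    intro i
    simp only [Derivation.leibniz, map_add, pderiv_normSqPoly, pderiv_X_self, smul_eq_mul, h2]
    ring
  simp only [polyLaplacian_apply, this, Finset.sum_add_distrib, ← Finset.mul_sum, hE]
  simp only [Finset.sum_const, Finset.card_univ, map_add, map_mul, map_natCast, map_ofNat,
    nsmul_eq_mul]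
  ring

theorem dirDeriv_linearFormPoly {y : σ → ℝ} (hy : ∑ i, y i * y i = 1) :
    dirDeriv y (linearFormPoly y) = 1 := by
  rw [dirDeriv_apply]
  simp only [pderiv_linearFormPoly, ← map_mul, ← map_sum, hy, map_one]

theorem dirDeriv_normSqPoly (y : σ → ℝ) :
    dirDeriv y (normSqPoly σ) = 2 * linearFormPoly y := by
  rw [dirDeriv_apply, linearFormPoly, Finset.mul_sum]
  refine Finset.sum_congr rfl fun i _ => ?_
  rw [pderiv_normSqPoly]; ring

/-- The solid zonal polynomial `x ↦ |x|^k C_k^r(x · y / |x|)` with pole a unit vector `y`. -/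
noncomputable def zonalPoly (r : ℝ) (y : σ → ℝ) : ℕ → MvPolynomial σ ℝ
  | 0 => 1
  | 1 => MvPolynomial.C (2 * r) * linearFormPoly y
  | k + 2 => MvPolynomial.C (1 / ((k : ℝ) + 2)) *
      (MvPolynomial.C (2 * ((k : ℝ) + 1 + r)) * (linearFormPoly y * zonalPoly r y (k + 1)) -
        MvPolynomial.C ((k : ℝ) + 2 * r) * (normSqPoly σ * zonalPoly r y k))

theorem zonalPoly_rec (r : ℝ) (y : σ → ℝ) (k : ℕ) :
    MvPolynomial.C ((k : ℝ) + 2) * zonalPoly r y (k + 2) =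
      MvPolynomial.C (2 * ((k : ℝ) + 1 + r)) * (linearFormPoly y * zonalPoly r y (k + 1)) -
        MvPolynomial.C ((k : ℝ) + 2 * r) * (normSqPoly σ * zonalPoly r y k) := by
  rw [zonalPoly, ← mul_assoc, ← map_mul, mul_one_div_cancel (by positivity), map_one, one_mul]

theorem gegenbauer_eval_rec (r : ℝ) (k : ℕ) (t : ℝ) :
    ((k : ℝ) + 2) * (gegenbauer r (k + 2)).eval t =
      2 * ((k : ℝ) + 1 + r) * t * (gegenbauer r (k + 1)).eval t
        - ((k : ℝ) + 2 * r) * (gegenbauer r k).eval t := by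
  rw [gegenbauer]
  simp only [Polynomial.eval_mul, Polynomial.eval_sub, Polynomial.eval_C, Polynomial.eval_X]
  field_simp

theorem eval_zonalPoly (r : ℝ) (x y : σ → ℝ) (hx : ∑ i, x i * x i = 1) (k : ℕ) :
    MvPolynomial.eval x (zonalPoly r y k) = (gegenbauer r k).eval (∑ i, x i * y i) := by
  have hl : MvPolynomial.eval x (linearFormPoly y) = ∑ i, x i * y i := by
    simp [linearFormPoly, mul_comm]
  have hn : MvPolynomial.eval x (normSqPoly σ) = 1 := by simp [normSqPoly, hx]
  induction k using Nat.twoStepInduction with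
  | zero => simp [zonalPoly, gegenbauer]
  | one => simp [zonalPoly, gegenbauer, hl]
  | more k ih1 ih2 =>
    have h1 := congrArg (MvPolynomial.eval x) (zonalPoly_rec r y k)
    have h2 := gegenbauer_eval_rec r k (∑ i, x i * y i)
    simp only [map_mul, map_sub, MvPolynomial.eval_C, hl, hn, ih1, ih2] at h1
    refine mul_left_cancel₀ (show (k : ℝ) + 2 ≠ 0 by positivity) ?_
    rw [h1, h2]; ring

theorem linearFormPoly_isHomogeneous (y : σ → ℝ) : (linearFormPoly y).IsHomogeneous 1 :=
  MvPolynomial.IsHomogeneous.sum _ _ _ fun i _ => by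
    simpa using (isHomogeneous_C σ (y i)).mul (isHomogeneous_X ℝ i)

theorem normSqPoly_isHomogeneous : (normSqPoly σ).IsHomogeneous 2 :=
  MvPolynomial.IsHomogeneous.sum _ _ _ fun i _ => (isHomogeneous_X ℝ i).mul (isHomogeneous_X ℝ i)

theorem zonalPoly_isHomogeneous (r : ℝ) (y : σ → ℝ) (k : ℕ) :
    (zonalPoly r y k).IsHomogeneous k := by
  induction k using Nat.twoStepInduction with
  | zero => simpa [zonalPoly] using isHomogeneous_one σ ℝ
  | one => simpa [zonalPoly] using (isHomogeneous_C σ (2 * r)).mul (linearFormPoly_isHomogeneous y)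
  | more k ih1 ih2 =>
    have e1 := (isHomogeneous_C σ (2 * ((k : ℝ) + 1 + r))).mul
      ((linearFormPoly_isHomogeneous y).mul ih2)
    have e2 := (isHomogeneous_C σ ((k : ℝ) + 2 * r)).mul (normSqPoly_isHomogeneous.mul ih1)
    rw [zonalPoly]
    have := (isHomogeneous_C σ (1 / ((k : ℝ) + 2))).mul
      ((show 0 + (1 + (k + 1)) = k + 2 by ring) ▸ e1 |>.sub
        ((show 0 + (2 + k) = k + 2 by ring) ▸ e2))
    simpa using this

theorem dirDeriv_C_mul (y : σ → ℝ) (a : ℝ) (p : MvPolynomial σ ℝ) :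
    dirDeriv y (MvPolynomial.C a * p) = MvPolynomial.C a * dirDeriv y p := by
  rw [← MvPolynomial.smul_eq_C_mul, Derivation.map_smul, MvPolynomial.smul_eq_C_mul]

theorem polyLaplacian_C_mul (a : ℝ) (p : MvPolynomial σ ℝ) :
    polyLaplacian (MvPolynomial.C a * p) = MvPolynomial.C a * polyLaplacian p := by
  rw [← MvPolynomial.smul_eq_C_mul, map_smul, MvPolynomial.smul_eq_C_mul]

theorem C_mul_cancel {τ : Type*} {a : ℝ} (ha : a ≠ 0) {p q : MvPolynomial τ ℝ}
    (h : MvPolynomial.C a * p = MvPolynomial.C a * q) : p = q :=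
  mul_left_cancel₀ (by simpa using ha) h

/-- Applying `∂_y` to the recurrence and inserting the formula for lower degrees leaves a multiple
of the recurrence one degree lower. -/
theorem dirDeriv_zonalPoly (r : ℝ) {y : σ → ℝ} (hy : ∑ i, y i * y i = 1) (k : ℕ) :
    dirDeriv y (zonalPoly r y (k + 1)) = MvPolynomial.C ((k : ℝ) + 2 * r) * zonalPoly r y k := by
  induction k using Nat.strong_induction_on with
  | _ k ih =>
  rcases k with _ | k
  · simp [zonalPoly, dirDeriv_linearFormPoly hy]
  have h1 := congrArg (dirDeriv y) (zonalPoly_rec r y k)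
  refine C_mul_cancel (show (k : ℝ) + 2 ≠ 0 by positivity) ?_
  have ih1 := ih k (by lia)
  rw [dirDeriv_C_mul] at h1
  rw [h1, map_sub, dirDeriv_C_mul, dirDeriv_C_mul, Derivation.leibniz, Derivation.leibniz, ih1,
    dirDeriv_linearFormPoly hy, dirDeriv_normSqPoly]
  -- The lowest case is separate: there the polynomial multiplying `|x|²` is the constant 1, with
  -- derivative zero.
  rcases k with _ | k
  · simp only [zonalPoly, smul_eq_mul, map_add, map_mul, map_one, map_natCast, map_ofNat,
      Derivation.map_one_eq_zero]
    push_cast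
    ring
  · have ih0 := ih k (by lia)
    have hr := zonalPoly_rec r y k
    rw [ih0]
    simp only [smul_eq_mul, map_add, map_mul, map_one, map_natCast, map_ofNat, Nat.cast_add,
      Nat.cast_one] at hr ⊢
    linear_combination (-((k : MvPolynomial σ ℝ) + 1 + 2 * MvPolynomial.C r)) * hr

/-- By the two product rules the recurrence contributes `4(k+1+r)(k+2r)` and `(k+2r)(4k+2n)` times
the degree `k` polynomial, `n` being the dimension; these cancel exactly when `n = 2r+2`. -/
theorem polyLaplacian_zonalPoly {r : ℝ} (hr : (Fintype.card σ : ℝ) = 2 * r + 2) {y : σ → ℝ}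
    (hy : ∑ i, y i * y i = 1) (k : ℕ) : polyLaplacian (zonalPoly r y k) = 0 := by
  induction k using Nat.twoStepInduction with
  | zero => simp [zonalPoly, polyLaplacian_apply]
  | one => simp [zonalPoly, polyLaplacian_apply, pderiv_linearFormPoly]
  | more k ih1 ih2 =>
    refine C_mul_cancel (show (k : ℝ) + 2 ≠ 0 by positivity) ?_
    rw [← polyLaplacian_C_mul, zonalPoly_rec, map_sub, polyLaplacian_C_mul, polyLaplacian_C_mul,
      polyLaplacian_linearFormPoly_mul, polyLaplacian_normSqPoly_mul (zonalPoly_isHomogeneous r y k),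
      ih1, ih2, dirDeriv_zonalPoly r hy, hr]
    simp only [map_add, map_mul, map_one, map_natCast, map_ofNat]
    ring

/-- The Fischer product `∑ α! p_α q_α` of two polynomials. -/
noncomputable def fischerForm (q : MvPolynomial σ ℝ) : MvPolynomial σ ℝ →ₗ[ℝ] ℝ :=
  (MvPolynomial.basisMonomials σ ℝ).constr ℝ
    fun α : σ →₀ ℕ => (∏ i, ((α i).factorial : ℝ)) * MvPolynomial.coeff α q

theorem fischerForm_monomial (q : MvPolynomial σ ℝ) (α : σ →₀ ℕ) (a : ℝ) :
    fischerForm q (MvPolynomial.monomial α a) =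
      a * ((∏ i, ((α i).factorial : ℝ)) * MvPolynomial.coeff α q) := by
  have : MvPolynomial.monomial α a = a • MvPolynomial.basisMonomials σ ℝ α := by
    simp [MvPolynomial.smul_monomial]
  rw [this, map_smul, fischerForm, Module.Basis.constr_basis, smul_eq_mul]

theorem fischerForm_eq_sum (p q : MvPolynomial σ ℝ) {T : Finset (σ →₀ ℕ)} (hT : p.support ⊆ T) :
    fischerForm q p = ∑ α ∈ T,
      (∏ i, ((α i).factorial : ℝ)) * MvPolynomial.coeff α p * MvPolynomial.coeff α q := by
  conv_lhs => rw [p.as_sum]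
  rw [map_sum, Finset.sum_subset hT]
  · exact Finset.sum_congr rfl fun α _ => by rw [fischerForm_monomial]; ring
  · intro α _ hα
    simp [MvPolynomial.notMem_support_iff.1 hα]

/-- Multiplication by `xᵢ` is adjoint to `∂ᵢ` because `(αᵢ+1)! = (αᵢ+1) αᵢ!`. Hence multiplication
by `y·x` is adjoint to `∂_y`, and by `|x|²` to the Laplacian. -/
theorem fischerForm_X_mul (q p : MvPolynomial σ ℝ) (i : σ) :
    fischerForm q (MvPolynomial.X i * p) = fischerForm (MvPolynomial.pderiv i q) p := by
  classical
  induction p using MvPolynomial.induction_on' with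
  | add p₁ p₂ h₁ h₂ => rw [mul_add, map_add, map_add, h₁, h₂]
  | monomial α a =>
    rw [mul_comm, MvPolynomial.X, MvPolynomial.monomial_mul, mul_one, fischerForm_monomial,
      fischerForm_monomial, coeff_pderiv, Finset.prod_eq_mul_prod_sdiff_singleton_of_mem
        (Finset.mem_univ i),
      Finset.prod_eq_mul_prod_sdiff_singleton_of_mem (Finset.mem_univ i)
        (fun j => ((α j).factorial : ℝ))]
    have : ∏ j ∈ Finset.univ \ {i}, ((((α + Finsupp.single i 1 : σ →₀ ℕ)) j).factorial : ℝ) =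
        ∏ j ∈ Finset.univ \ {i}, ((α j).factorial : ℝ) := by
      refine Finset.prod_congr rfl fun j hj => ?_
      have : i ≠ j := by rintro rfl; simp at hj
      simp [this]
    rw [this]
    simp only [Finsupp.add_apply, Finsupp.single_eq_same, Nat.factorial_succ]
    push_cast
    ring

theorem fischerForm_C_mul (q p : MvPolynomial σ ℝ) (a : ℝ) :
    fischerForm q (MvPolynomial.C a * p) = a * fischerForm q p := by
  rw [← MvPolynomial.smul_eq_C_mul, map_smul, smul_eq_mul]

theorem fischerForm_add_left (q₁ q₂ p : MvPolynomial σ ℝ) :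
    fischerForm (q₁ + q₂) p = fischerForm q₁ p + fischerForm q₂ p := by
  rw [fischerForm_eq_sum _ _ subset_rfl, fischerForm_eq_sum _ _ subset_rfl,
    fischerForm_eq_sum _ _ subset_rfl, ← Finset.sum_add_distrib]
  exact Finset.sum_congr rfl fun α _ => by rw [MvPolynomial.coeff_add]; ring

theorem fischerForm_C_mul_left (a : ℝ) (q p : MvPolynomial σ ℝ) :
    fischerForm (MvPolynomial.C a * q) p = a * fischerForm q p := by
  rw [fischerForm_eq_sum _ _ subset_rfl, fischerForm_eq_sum _ _ subset_rfl, Finset.mul_sum]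
  exact Finset.sum_congr rfl fun α _ => by rw [MvPolynomial.coeff_C_mul]; ring

theorem fischerForm_zero_left (p : MvPolynomial σ ℝ) : fischerForm 0 p = 0 := by
  rw [fischerForm_eq_sum _ _ subset_rfl]; simp

theorem fischerForm_sum_left {ι : Type*} (s : Finset ι) (q : ι → MvPolynomial σ ℝ)
    (p : MvPolynomial σ ℝ) : fischerForm (∑ i ∈ s, q i) p = ∑ i ∈ s, fischerForm (q i) p := by
  classical
  induction s using Finset.induction_on with
  | empty => simp [fischerForm_zero_left]
  | insert a s ha ih => rw [Finset.sum_insert ha, Finset.sum_insert ha, fischerForm_add_left, ih]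

theorem fischerForm_linearFormPoly_mul (q p : MvPolynomial σ ℝ) (y : σ → ℝ) :
    fischerForm q (linearFormPoly y * p) = fischerForm (dirDeriv y q) p := by
  rw [linearFormPoly, Finset.sum_mul, map_sum, dirDeriv_apply, fischerForm_sum_left]
  exact Finset.sum_congr rfl fun i _ => by
    rw [mul_assoc, fischerForm_C_mul, fischerForm_X_mul, fischerForm_C_mul_left]

theorem fischerForm_normSqPoly_mul (q p : MvPolynomial σ ℝ) :
    fischerForm q (normSqPoly σ * p) = fischerForm (polyLaplacian q) p := by
  rw [normSqPoly, Finset.sum_mul, map_sum, polyLaplacian_apply, fischerForm_sum_left]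
  exact Finset.sum_congr rfl fun i _ => by
    rw [mul_assoc, fischerForm_X_mul, fischerForm_X_mul]

theorem eval_dirDeriv_self {h : MvPolynomial σ ℝ} {k : ℕ} (hh : h.IsHomogeneous k) (y : σ → ℝ) :
    MvPolynomial.eval y (dirDeriv y h) = k * MvPolynomial.eval y h := by
  have := congrArg (MvPolynomial.eval y) hh.sum_X_mul_pderiv
  rw [dirDeriv_apply]
  simpa using this

theorem dirDeriv_isHomogeneous {h : MvPolynomial σ ℝ} {k : ℕ} (hh : h.IsHomogeneous k)
    (y : σ → ℝ) : (dirDeriv y h).IsHomogeneous (k - 1) := by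
  rw [dirDeriv_apply]
  exact MvPolynomial.IsHomogeneous.sum _ _ _ fun i _ => by
    simpa using (isHomogeneous_C σ (y i)).mul (hh.pderiv (i := i))

theorem polyLaplacian_dirDeriv {h : MvPolynomial σ ℝ} (hh : polyLaplacian h = 0) (y : σ → ℝ) :
    polyLaplacian (dirDeriv y h) = 0 := by
  have hcomm : ∀ (i j : σ) (p : MvPolynomial σ ℝ),
      MvPolynomial.pderiv i (MvPolynomial.pderiv j p) =
        MvPolynomial.pderiv j (MvPolynomial.pderiv i p) := by
    intro i j p
    classical
    ext m
    simp only [coeff_pderiv]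
    by_cases hij : i = j
    · subst hij; rfl
    · rw [add_right_comm]
      simp [hij, Ne.symm hij]
      ring
  have : polyLaplacian (dirDeriv y h) = dirDeriv y (polyLaplacian h) := by
    simp only [polyLaplacian_apply, dirDeriv_apply, map_sum]
    rw [Finset.sum_comm]
    refine Finset.sum_congr rfl fun i _ => Finset.sum_congr rfl fun j _ => ?_
    simp only [Derivation.leibniz, MvPolynomial.pderiv_C, smul_eq_mul, mul_zero, add_zero]
    rw [hcomm j i, hcomm j i]
  rw [this, hh, map_zero]

/-- Zonal polynomials reproduce harmonic polynomials for the Fischer product. -/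
theorem fischerForm_zonalPoly (r : ℝ) (y : σ → ℝ) (k : ℕ) (h : MvPolynomial σ ℝ)
    (hh : h.IsHomogeneous k) (hΔ : polyLaplacian h = 0) :
    fischerForm h (zonalPoly r y k) =
      (∏ j ∈ Finset.range k, 2 * ((j : ℝ) + r)) * MvPolynomial.eval y h := by
  have h0 : ∀ q : MvPolynomial σ ℝ, q.IsHomogeneous 0 → fischerForm q 1 = MvPolynomial.eval y q := by
    intro q hq
    obtain ⟨a, rfl⟩ : ∃ a, q = MvPolynomial.C a :=
      ⟨_, (MvPolynomial.totalDegree_eq_zero_iff_eq_C).1 ((totalDegree_zero_iff_isHomogeneous σ).2 hq)⟩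
    have := fischerForm_monomial (MvPolynomial.C a) (0 : σ →₀ ℕ) 1
    simpa using this
  have h1 : ∀ q : MvPolynomial σ ℝ, q.IsHomogeneous 1 →
      fischerForm q (linearFormPoly y) = MvPolynomial.eval y q := by
    intro q hq
    have := fischerForm_linearFormPoly_mul q 1 y
    rw [mul_one] at this
    rw [this, h0 _ (dirDeriv_isHomogeneous hq y), eval_dirDeriv_self hq]
    simp
  induction k using Nat.twoStepInduction generalizing h with
  | zero => simpa [zonalPoly] using h0 h hh
  | one =>
    rw [zonalPoly, fischerForm_C_mul, h1 h hh]
    simp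
  | more k ih1 ih2 =>
    -- The `|x|²` term pairs with `Δh = 0`. The other term pairs with `∂_y h`, harmonic of one
    -- degree less, whose value at `y` is `(k+2) h(y)` by Euler.
    have e := congrArg (fischerForm h) (zonalPoly_rec r y k)
    rw [map_sub, fischerForm_C_mul, fischerForm_C_mul, fischerForm_C_mul,
      fischerForm_linearFormPoly_mul, fischerForm_normSqPoly_mul, hΔ, fischerForm_zero_left,
      ih2 _ (dirDeriv_isHomogeneous hh y) (polyLaplacian_dirDeriv hΔ y),
      eval_dirDeriv_self hh] at e
    refine mul_left_cancel₀ (show (k : ℝ) + 2 ≠ 0 by positivity) ?_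
    rw [e, Finset.prod_range_succ _ (k + 1)]
    push_cast
    ring

end Fischer

/-! ### Gegenbauer polynomials as Gram kernels on the sphere -/

theorem inner_eq_sum_mul {n : ℕ} (x y : EuclideanSpace ℝ (Fin n)) :
    inner ℝ x y = ∑ i, x i * y i := by
  simp [PiLp.inner_apply, mul_comm]

theorem sum_mul_self_unitSphere {d : ℕ} (x : UnitSphere d) :
    ∑ i, (x : EuclideanSpace ℝ (Fin (d + 1))) i * (x : EuclideanSpace ℝ (Fin (d + 1))) i = 1 := by
  rw [← inner_eq_sum_mul, real_inner_self_eq_norm_sq]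
  simp

/-- The kernel `C_k^((d-1)/2)(x · y)` is a Gram kernel on every finite family of points of `S^d`. -/
theorem exists_gram_gegenbauerSphere {d : ℕ} (hd : 2 ≤ d) (k : ℕ) {ι : Type*} [Fintype ι]
    (x : ι → UnitSphere d) : ∃ (T : Finset (Fin (d + 1) →₀ ℕ)) (V : T → ι → ℝ), ∀ i j,
      gegenbauerSphere d k (inner ℝ (x i : EuclideanSpace ℝ (Fin (d + 1))) (x j)) =
        ∑ t, V t i * V t j := by
  classical
  set r : ℝ := ((d : ℝ) - 1) / 2 with hr
  have hr0 : 0 < r := by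
    have : (2 : ℝ) ≤ d := by exact_mod_cast hd
    rw [hr]; linarith
  set c : ℝ := ∏ j ∈ Finset.range k, 2 * ((j : ℝ) + r) with hc
  have hc0 : 0 < c := Finset.prod_pos fun j _ => by positivity
  let z : ι → MvPolynomial (Fin (d + 1)) ℝ := fun i =>
    zonalPoly r (fun m => (x i : EuclideanSpace ℝ (Fin (d + 1))) m) k
  let T : Finset (Fin (d + 1) →₀ ℕ) := Finset.univ.biUnion fun i => (z i).support
  -- The Gram vectors are the coefficient vectors of the zonal polynomials, rescaled so that the
  -- Euclidean product becomes the Fischer product divided by `c`.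
  refine ⟨T, fun t i => √(c⁻¹ * ∏ m, ((t.1 m).factorial : ℝ)) * MvPolynomial.coeff t.1 (z i),
    fun i j => ?_⟩
  have hcard : (Fintype.card (Fin (d + 1)) : ℝ) = 2 * r + 2 := by
    rw [hr, Fintype.card_fin]; push_cast; ring
  -- Reproduce the zonal polynomial of pole `x j` at the pole `x i`: its value there is `C_k(x i · x
  -- j)`.
  have key := fischerForm_zonalPoly r (fun m => (x i : EuclideanSpace ℝ (Fin (d + 1))) m) k (z j)
    (zonalPoly_isHomogeneous _ _ _)
    (polyLaplacian_zonalPoly hcard (sum_mul_self_unitSphere (x j)) k)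
  rw [eval_zonalPoly _ _ _ (sum_mul_self_unitSphere (x i)), ← inner_eq_sum_mul, ← hc,
    fischerForm_eq_sum _ _ (Finset.subset_biUnion_of_mem (fun i => (z i).support)
      (Finset.mem_univ i))] at key
  rw [gegenbauerSphere, ← hr, ← inv_mul_cancel_left₀ hc0.ne' (Polynomial.eval _ _), ← key,
    ← Finset.sum_coe_sort, Finset.mul_sum]
  refine Finset.sum_congr rfl fun t _ => ?_
  have : 0 ≤ c⁻¹ * ∏ m, ((t.1 m).factorial : ℝ) := by positivity
  linear_combination (-(MvPolynomial.coeff t.1 (z i)) * MvPolynomial.coeff t.1 (z j)) *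
    Real.mul_self_sqrt this

/-! ### Recurrence, derivative, parity and the Gegenbauer cone -/

section GegenbauerAlgebra

theorem gegenbauer_rec (r : ℝ) (k : ℕ) :
    ((k : ℝ[X]) + 2) * gegenbauer r (k + 2) =
      2 * ((k : ℝ[X]) + 1 + C r) * X * gegenbauer r (k + 1)
        - ((k : ℝ[X]) + 2 * C r) * gegenbauer r k := by
  have h : ((k : ℝ[X]) + 2) * C (1 / ((k : ℝ) + 2)) = 1 := by
    rw [show ((k : ℝ[X]) + 2) = C ((k : ℝ) + 2) by simp [map_ofNat], ← C_mul,
      mul_one_div_cancel (by positivity), C_1]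
  rw [gegenbauer, ← mul_assoc, h]
  simp only [map_add, map_mul, map_one, map_natCast, map_ofNat, one_mul]

/-- Obtained by differentiating the recurrence. Combined with integration by parts against the
weight, it evaluates the integral of `C_k`. -/
theorem gegenbauer_derivative (r : ℝ) (k : ℕ) :
    (1 - X ^ 2) * derivative (gegenbauer r (k + 1)) =
      -((k : ℝ[X]) + 1) * X * gegenbauer r (k + 1) + ((k : ℝ[X]) + 2 * C r) * gegenbauer r k := by
  induction k using Nat.strong_induction_on with
  | _ k ih =>
  rcases k with _ | k
  · simp [gegenbauer, map_ofNat]; ring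
  have hd := congrArg derivative (gegenbauer_rec r k)
  have hn : derivative ((k : ℝ[X]) + 2) = 0 := by
    simp
  have h2 : derivative (2 : ℝ[X]) = 0 := derivative_ofNat 2
  simp only [derivative_mul, derivative_sub, derivative_add, derivative_natCast, derivative_C,
    derivative_X, derivative_one, h2, zero_mul, mul_zero, zero_add, add_zero] at hd
  have hc : ((k : ℝ[X]) + 2) ≠ 0 := by
    have : ((k + 2 : ℕ) : ℝ[X]) ≠ 0 := Nat.cast_ne_zero.2 (by lia)
    simpa using this
  refine mul_left_cancel₀ hc ?_
  have i1 := ih k (by lia)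
  have hr := gegenbauer_rec r k
  rcases k with _ | k
  · have g0 : gegenbauer r 0 = 1 := by rw [gegenbauer]
    have g1 : gegenbauer r 1 = 2 * C r * X := by rw [gegenbauer, C_mul, map_ofNat]
    simp only [g0, derivative_one, Nat.cast_zero, Nat.cast_one, zero_add, mul_zero, sub_zero]
      at hd i1 hr ⊢
    linear_combination (1 - X ^ 2) * hd + 2 * (1 + C r) * X * i1 + (2 * X) * hr - 2 * C r * g1
  · have i0 := ih k (by lia)
    have hr0 := gegenbauer_rec r k
    simp only [Nat.cast_add, Nat.cast_one] at hd i1 hr ⊢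
    linear_combination (1 - X ^ 2) * hd + 2 * ((k : ℝ[X]) + 1 + 1 + C r) * X * i1
      - ((k : ℝ[X]) + 1 + 2 * C r) * i0 + (((k : ℝ[X]) + 3) * X) * hr
      - ((k : ℝ[X]) + 1 + 2 * C r) * hr0

theorem gegenbauer_eval_one_succ (r : ℝ) (k : ℕ) :
    ((k : ℝ) + 1) * (gegenbauer r (k + 1)).eval 1 =
      ((k : ℝ) + 2 * r) * (gegenbauer r k).eval 1 := by
  induction k with
  | zero => simp [gegenbauer]
  | succ k ih =>
    have h := gegenbauer_eval_rec r k 1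
    push_cast
    linear_combination h + ih

theorem gegenbauer_eval_one_pos {r : ℝ} (hr : 0 < r) (k : ℕ) :
    0 < (gegenbauer r k).eval 1 := by
  induction k with
  | zero => simp [gegenbauer]
  | succ k ih =>
    have h := gegenbauer_eval_one_succ r k
    have : 0 < ((k : ℝ) + 1) * (gegenbauer r (k + 1)).eval 1 := by rw [h]; positivity
    exact pos_of_mul_pos_right this (by positivity)

theorem gegenbauer_eval_neg (r : ℝ) (k : ℕ) (t : ℝ) :
    (gegenbauer r k).eval (-t) = (-1) ^ k * (gegenbauer r k).eval t := by
  induction k using Nat.twoStepInduction with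
  | zero => simp [gegenbauer]
  | one => simp [gegenbauer]
  | more k ih1 ih2 =>
    refine mul_left_cancel₀ (show (k : ℝ) + 2 ≠ 0 by positivity) ?_
    rw [gegenbauer_eval_rec, ih1, ih2]
    linear_combination (-(-1) ^ k) * gegenbauer_eval_rec r k t

theorem gegenbauer_coeff_eq_zero (r : ℝ) (k m : ℕ) (h : k < m ∨ Odd (m + k)) :
    (gegenbauer r k).coeff m = 0 := by
  induction k using Nat.twoStepInduction generalizing m with
  | zero =>
    have : m ≠ 0 := by rintro rfl; simp at h
    simp [gegenbauer, coeff_one, this]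
  | one =>
    have : m ≠ 1 := by
      rintro rfl
      revert h
      decide
    rw [gegenbauer, coeff_C_mul, coeff_X_of_ne_one this, mul_zero]
  | more k ih1 ih2 =>
    have e := congrArg (fun p => coeff p m) (gegenbauer_rec r k)
    simp only [coeff_sub] at e
    rw [show ((k : ℝ[X]) + 2) = C ((k : ℝ) + 2) by simp [map_ofNat],
      show 2 * ((k : ℝ[X]) + 1 + C r) = C (2 * ((k : ℝ) + 1 + r)) by simp [map_ofNat],
      show (k : ℝ[X]) + 2 * C r = C ((k : ℝ) + 2 * r) by simp [map_ofNat], mul_assoc,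
      coeff_C_mul, coeff_C_mul, coeff_C_mul, ih1 m (by grind), mul_zero, sub_zero] at e
    refine (mul_eq_zero.1 (e.trans ?_)).resolve_left (by positivity)
    rcases m with _ | m
    · simp
    · rw [coeff_X_mul, ih2 m (by grind), mul_zero]

theorem gegenbauer_natDegree_le (r : ℝ) (k : ℕ) : (gegenbauer r k).natDegree ≤ k :=
  natDegree_le_iff_coeff_eq_zero.2 fun m hm => gegenbauer_coeff_eq_zero r k m (Or.inl hm)

/-- The convex cone spanned by the Gegenbauer polynomials. -/
noncomputable def gegenbauerCone (r : ℝ) : Submodule NNReal ℝ[X] :=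
  Submodule.span NNReal (Set.range (gegenbauer r))

theorem nnreal_smul_mem_gegenbauerCone {r a : ℝ} (ha : 0 ≤ a) {p : ℝ[X]}
    (hp : p ∈ gegenbauerCone r) : C a * p ∈ gegenbauerCone r := by
  have : C a * p = (⟨a, ha⟩ : NNReal) • p := by
    ext n
    simp
  rw [this]
  exact Submodule.smul_mem _ _ hp

/-- Solved for `X C_(k+1)`, the three-term recurrence has nonnegative coefficients when `r > 0`. -/
theorem X_mul_mem_gegenbauerCone {r : ℝ} (hr : 0 < r) {p : ℝ[X]}
    (hp : p ∈ gegenbauerCone r) : X * p ∈ gegenbauerCone r := by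
  have hG : ∀ k, gegenbauer r k ∈ gegenbauerCone r := fun k => Submodule.subset_span ⟨k, rfl⟩
  induction hp using Submodule.span_induction with
  | mem p hp =>
    obtain ⟨k, rfl⟩ := hp
    rcases k with _ | k
    · have : X * gegenbauer r 0 = C (1 / (2 * r)) * gegenbauer r 1 := by
        rw [gegenbauer, gegenbauer, ← mul_assoc, ← C_mul, one_div_mul_cancel (by positivity), C_1]
        ring
      rw [this]
      exact nnreal_smul_mem_gegenbauerCone (by positivity) (hG 1)
    · have : X * gegenbauer r (k + 1) =
          C (((k : ℝ) + 2) / (2 * (k + 1 + r))) * gegenbauer r (k + 2)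
          + C (((k : ℝ) + 2 * r) / (2 * (k + 1 + r))) * gegenbauer r k := by
        have hne : C (2 * ((k : ℝ) + 1 + r)) ≠ 0 := by
          rw [Ne, C_eq_zero]; positivity
        refine mul_left_cancel₀ hne ?_
        rw [mul_add (C _), ← mul_assoc (C _) (C _), ← mul_assoc (C _) (C _), ← C_mul, ← C_mul,
          mul_div_cancel₀ _ (by positivity), mul_div_cancel₀ _ (by positivity)]
        have := gegenbauer_rec r k
        simp only [map_add, map_mul, map_one, map_natCast, map_ofNat] at this ⊢
        linear_combination -this
      rw [this]
      exact add_mem (nnreal_smul_mem_gegenbauerCone (by positivity) (hG _))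
        (nnreal_smul_mem_gegenbauerCone (by positivity) (hG _))
  | zero => simp
  | add p q _ _ hp hq => rw [mul_add]; exact add_mem hp hq
  | smul a p _ hp => rw [mul_smul_comm]; exact Submodule.smul_mem _ _ hp

/-- On `[-1,1]` these powers peak at 1; they are the test functions that bound the Gegenbauer
coefficients of a positive definite function. -/
theorem one_add_X_pow_mem_gegenbauerCone {r : ℝ} (hr : 0 < r) (n : ℕ) :
    (1 + X) ^ n ∈ gegenbauerCone r := by
  induction n with
  | zero => exact Submodule.subset_span ⟨0, by simp [gegenbauer]⟩
  | succ n ih => rw [pow_succ', add_mul, one_mul]; exact add_mem ih (X_mul_mem_gegenbauerCone hr ih)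

end GegenbauerAlgebra

/-! ### Laplace's integral representation -/

section Laplace

/-- Laplace's integral `∫₀^π (t + i √(1-t²) cos φ)^k sin^e φ dφ`. -/
noncomputable def laplaceIntegral (e k : ℕ) (t : ℝ) : ℂ :=
  ∫ φ in (0 : ℝ)..Real.pi,
    ((t : ℂ) + Complex.I * √(1 - t ^ 2) * Real.cos φ) ^ k * (Real.sin φ : ℂ) ^ e

/-- Integrate an exact derivative whose boundary values vanish with `sin`. With `2r = e+1` this is
the recurrence of the normalized polynomials `C_k(t)/C_k(1)`. -/
theorem laplaceIntegral_rec (e k : ℕ) {t : ℝ} (ht : t ∈ Set.Icc (-1 : ℝ) 1) :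
    ((k : ℂ) + e + 2) * laplaceIntegral e (k + 2) t =
      (2 * k + e + 3) * t * laplaceIntegral e (k + 1) t - (k + 1) * laplaceIntegral e k t := by
  set s : ℂ := Complex.I * √(1 - t ^ 2) with hs
  have hs2 : s ^ 2 = (t : ℂ) ^ 2 - 1 := by
    have : (√(1 - t ^ 2) : ℂ) ^ 2 = 1 - (t : ℂ) ^ 2 := by
      rw [← Complex.ofReal_pow, Real.sq_sqrt (by nlinarith [ht.1, ht.2])]
      push_cast; ring
    rw [hs, mul_pow, Complex.I_sq, this]; ring
  have hderiv : ∀ φ : ℝ, HasDerivAt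
      (fun φ : ℝ => s * ((Real.sin φ : ℂ) ^ (e + 1) * ((t : ℂ) + s * Real.cos φ) ^ (k + 1)))
      (((k : ℂ) + e + 2) * (((t : ℂ) + s * Real.cos φ) ^ (k + 2) * (Real.sin φ : ℂ) ^ e)
        - (2 * k + e + 3) * t * (((t : ℂ) + s * Real.cos φ) ^ (k + 1) * (Real.sin φ : ℂ) ^ e)
        + (k + 1) * (((t : ℂ) + s * Real.cos φ) ^ k * (Real.sin φ : ℂ) ^ e)) φ := by
    intro φ
    have h1 := ((Real.hasDerivAt_sin φ).ofReal_comp).pow (e + 1)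
    have h2 := ((((Real.hasDerivAt_cos φ).ofReal_comp).const_mul s).const_add (t : ℂ)).pow (k + 1)
    refine ((h1.mul h2).const_mul s).congr_deriv ?_
    have hsc : (Real.sin φ : ℂ) ^ 2 = 1 - (Real.cos φ : ℂ) ^ 2 := by
      rw [← Complex.ofReal_pow, Real.sin_sq]; push_cast; ring
    simp only [Pi.pow_apply, Nat.add_sub_cancel, Nat.cast_add, Nat.cast_one, Complex.ofReal_neg]
    generalize (Real.sin φ : ℂ) = S at *
    generalize (Real.cos φ : ℂ) = c at *
    linear_combination (-(k + 1) * S ^ e * (t + s * c) ^ k) * hs2 -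
      (s ^ 2 * (k + 1) * S ^ e * (t + s * c) ^ k) * hsc
  have hint : ∀ n, IntervalIntegrable
      (fun φ : ℝ => ((t : ℂ) + s * Real.cos φ) ^ n * (Real.sin φ : ℂ) ^ e) volume 0 Real.pi := by
    intro n
    exact Continuous.intervalIntegrable (by fun_prop) _ _
  have key := intervalIntegral.integral_eq_sub_of_hasDerivAt (a := 0) (b := Real.pi)
    (fun φ _ => hderiv φ) ((((hint (k + 2)).const_mul _).sub ((hint (k + 1)).const_mul _)).add
      ((hint k).const_mul _))
  rw [intervalIntegral.integral_add (((hint (k + 2)).const_mul _).sub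
      ((hint (k + 1)).const_mul _)) ((hint k).const_mul _),
    intervalIntegral.integral_sub ((hint (k + 2)).const_mul _) ((hint (k + 1)).const_mul _),
    intervalIntegral.integral_const_mul, intervalIntegral.integral_const_mul,
    intervalIntegral.integral_const_mul] at key
  simp only [Real.sin_zero, Real.sin_pi, Complex.ofReal_zero, ne_eq, Nat.add_eq_zero_iff,
    one_ne_zero, and_false, not_false_eq_true, zero_pow, zero_mul, mul_zero, sub_zero] at key
  simp only [laplaceIntegral, ← hs]
  linear_combination key

/-- Both sides obey the same three-term recurrence once `C_k(1)` is tracked by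
`gegenbauer_eval_one_succ`. In degree 1 the extra term is the integral of an exact derivative,
namely that of a multiple of `sin^(e+1)`. -/
theorem gegenbauer_laplace (e k : ℕ) {t : ℝ} (ht : t ∈ Set.Icc (-1 : ℝ) 1) :
    (((gegenbauer (((e : ℝ) + 1) / 2) k).eval t : ℝ) : ℂ) * laplaceIntegral e 0 t =
      (((gegenbauer (((e : ℝ) + 1) / 2) k).eval 1 : ℝ) : ℂ) * laplaceIntegral e k t := by
  induction k using Nat.twoStepInduction with
  | zero => simp [gegenbauer]
  | one =>
    set s : ℂ := Complex.I * √(1 - t ^ 2) with hs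
    have hcos : (∫ φ in (0 : ℝ)..Real.pi, s * Real.cos φ * (Real.sin φ : ℂ) ^ e) = 0 := by
      have hderiv : ∀ φ : ℝ, HasDerivAt
          (fun φ : ℝ => s * (Real.sin φ : ℂ) ^ (e + 1) / ((e : ℂ) + 1))
          (s * Real.cos φ * (Real.sin φ : ℂ) ^ e) φ := by
        intro φ
        have h1 := ((((Real.hasDerivAt_sin φ).ofReal_comp).pow (e + 1)).const_mul s).div_const
          ((e : ℂ) + 1)
        refine h1.congr_deriv ?_
        have : (e : ℂ) + 1 ≠ 0 := by exact_mod_cast Nat.succ_ne_zero e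
        simp only [Nat.add_sub_cancel, Nat.cast_add, Nat.cast_one]
        field_simp
      rw [intervalIntegral.integral_eq_sub_of_hasDerivAt (fun φ _ => hderiv φ)
        (Continuous.intervalIntegrable (by fun_prop) _ _)]
      simp
    have : laplaceIntegral e 1 t = t * laplaceIntegral e 0 t := by
      simp only [laplaceIntegral, ← hs, pow_one, pow_zero, one_mul, add_mul]
      rw [intervalIntegral.integral_add, hcos, intervalIntegral.integral_const_mul, add_zero] <;>
      exact Continuous.intervalIntegrable (by fun_prop) _ _
    rw [this]
    simp [gegenbauer]
    ring
  | more k ih1 ih2 =>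
    have h0 := congrArg Complex.ofReal (gegenbauer_eval_rec (((e : ℝ) + 1) / 2) k t)
    have h1 := congrArg Complex.ofReal (gegenbauer_eval_one_succ (((e : ℝ) + 1) / 2) k)
    have h2 := congrArg Complex.ofReal (gegenbauer_eval_one_succ (((e : ℝ) + 1) / 2) (k + 1))
    have h3 := laplaceIntegral_rec e k ht
    push_cast at h0 h1 h2
    refine mul_left_cancel₀ (show (k : ℂ) + 2 ≠ 0 by exact_mod_cast (by lia : k + 2 ≠ 0)) ?_
    generalize laplaceIntegral e (k + 2) t = J2 at *
    generalize laplaceIntegral e (k + 1) t = J1 at *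
    generalize laplaceIntegral e k t = J0 at *
    generalize laplaceIntegral e 0 t = J at *
    set G := fun k => (((gegenbauer (((e : ℝ) + 1) / 2) k).eval t : ℝ) : ℂ)
    set A := fun k => (((gegenbauer (((e : ℝ) + 1) / 2) k).eval 1 : ℝ) : ℂ)
    change ((k : ℂ) + 2) * (G (k + 2) * J) = ((k : ℂ) + 2) * (A (k + 2) * J2)
    change ((k : ℂ) + 2) * G (k + 2) = _ * G (k + 1) - _ * G k at h0
    change _ * A (k + 1) = _ * A k at h1
    change _ * A (k + 1 + 1) = _ * A (k + 1) at h2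
    change G k * J = A k * J0 at ih1
    change G (k + 1) * J = A (k + 1) * J1 at ih2
    simp only [add_assoc, one_add_one_eq_two] at *
    linear_combination J * h0 - J2 * h2 + J0 * h1 - A (k + 1) * h3 +
      2 * (k + (1 + (e + 1) / 2)) * t * ih2 - (k + 2 * ((e + 1) / 2)) * ih1

theorem norm_laplace_base_sq_le {t : ℝ} (ht : t ∈ Set.Icc (-1 : ℝ) 1) (φ : ℝ) :
    ‖(t : ℂ) + Complex.I * √(1 - t ^ 2) * Real.cos φ‖ ^ 2 = t ^ 2 + (1 - t ^ 2) * Real.cos φ ^ 2 := by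
  have h1 : (t : ℂ) + Complex.I * √(1 - t ^ 2) * Real.cos φ =
      ((t : ℝ) : ℂ) + ((√(1 - t ^ 2) * Real.cos φ : ℝ) : ℂ) * Complex.I := by push_cast; ring
  rw [h1, ← Complex.normSq_eq_norm_sq, Complex.normSq_add_mul_I, mul_pow, Real.sq_sqrt]
  nlinarith [ht.1, ht.2]

theorem norm_laplace_base_le {t : ℝ} (ht : t ∈ Set.Icc (-1 : ℝ) 1) (φ : ℝ) :
    ‖(t : ℂ) + Complex.I * √(1 - t ^ 2) * Real.cos φ‖ ≤ 1 := by
  refine (sq_le_one_iff₀ (norm_nonneg _)).1 ?_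
  rw [norm_laplace_base_sq_le ht]
  have h1 : 0 ≤ 1 - t ^ 2 := by nlinarith [ht.1, ht.2]
  nlinarith [mul_nonneg h1 (sub_nonneg.2 (Real.cos_sq_le_one φ))]

theorem laplaceIntegral_zero (e : ℕ) (t : ℝ) :
    laplaceIntegral e 0 t = ((∫ φ in (0 : ℝ)..Real.pi, Real.sin φ ^ e : ℝ) : ℂ) := by
  rw [laplaceIntegral, ← intervalIntegral.integral_ofReal]
  simp

theorem norm_laplaceIntegral_le (e k : ℕ) {t : ℝ} (ht : t ∈ Set.Icc (-1 : ℝ) 1) :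
    ‖laplaceIntegral e k t‖ ≤ ∫ φ in (0 : ℝ)..Real.pi, Real.sin φ ^ e := by
  refine intervalIntegral.norm_integral_le_of_norm_le Real.pi_pos.le ?_
    (Continuous.intervalIntegrable (by fun_prop) _ _)
  refine (ae_of_all _ fun φ hφ => ?_)
  have hs : 0 ≤ Real.sin φ := Real.sin_nonneg_of_nonneg_of_le_pi hφ.1.le hφ.2
  rw [norm_mul, norm_pow, norm_pow, Complex.norm_real, Real.norm_of_nonneg hs]
  exact mul_le_of_le_one_left (by positivity)
    (pow_le_one₀ (norm_nonneg _) (norm_laplace_base_le ht φ))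

/-- The squared modulus of the base is `1 - (1-t²) sin²φ`, less than 1 for `0 < φ < π`; dominated
convergence applies. -/
theorem tendsto_laplaceIntegral (e : ℕ) {t : ℝ} (ht : t ∈ Set.Ioo (-1 : ℝ) 1) :
    Filter.Tendsto (fun k => laplaceIntegral e k t) Filter.atTop (nhds 0) := by
  have ht' : t ∈ Set.Icc (-1 : ℝ) 1 := Set.Ioo_subset_Icc_self ht
  have := intervalIntegral.tendsto_integral_filter_of_dominated_convergence
    (μ := volume) (a := (0 : ℝ)) (b := Real.pi) (l := Filter.atTop)
    (F := fun k : ℕ => fun φ : ℝ =>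
      ((t : ℂ) + Complex.I * √(1 - t ^ 2) * Real.cos φ) ^ k * (Real.sin φ : ℂ) ^ e)
    (f := fun _ => (0 : ℂ)) (fun _ => 1)
    (Filter.Eventually.of_forall fun k => (Continuous.aestronglyMeasurable (by fun_prop)))
    (Filter.Eventually.of_forall fun k => ae_of_all _ fun φ _ => by
      rw [norm_mul, norm_pow, norm_pow, Complex.norm_real]
      exact mul_le_one₀ (pow_le_one₀ (norm_nonneg _) (norm_laplace_base_le ht' φ)) (by positivity)
        (pow_le_one₀ (norm_nonneg _) (Real.abs_sin_le_one φ)))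
    intervalIntegrable_const ?_
  · simpa [laplaceIntegral] using this
  · have hne : ∀ᵐ φ : ℝ, φ ≠ Real.pi := by simp [ae_iff]
    filter_upwards [hne] with φ hφ hmem
    rw [Set.uIoc_of_le Real.pi_pos.le] at hmem
    have hs : 0 < Real.sin φ := Real.sin_pos_of_pos_of_lt_pi hmem.1 (lt_of_le_of_ne hmem.2 hφ)
    have hlt : ‖(t : ℂ) + Complex.I * √(1 - t ^ 2) * Real.cos φ‖ < 1 := by
      refine (sq_lt_one_iff₀ (norm_nonneg _)).1 ?_
      rw [norm_laplace_base_sq_le ht', Real.cos_sq']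
      have : 0 < 1 - t ^ 2 := by nlinarith [ht.1, ht.2]
      nlinarith [mul_pos this (pow_pos hs 2)]
    simpa using (tendsto_pow_atTop_nhds_zero_of_norm_lt_one hlt).mul_const ((Real.sin φ : ℂ) ^ e)

end Laplace

/-! ### Bound and decay of `C_k(t)/C_k(1)` -/

section GegenbauerSphere

variable {d : ℕ}

theorem sphere_index_pos (hd : 2 ≤ d) : 0 < ((d : ℝ) - 1) / 2 := by
  have : (2 : ℝ) ≤ d := by exact_mod_cast hd
  linarith

theorem gegenbauerSphere_one_pos (hd : 2 ≤ d) (k : ℕ) : 0 < gegenbauerSphere d k 1 :=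
  gegenbauer_eval_one_pos (sphere_index_pos hd) k

theorem gegenbauerSphere_neg (d k : ℕ) (t : ℝ) :
    gegenbauerSphere d k (-t) = (-1) ^ k * gegenbauerSphere d k t :=
  gegenbauer_eval_neg _ _ _

theorem continuous_gegenbauerSphere (d k : ℕ) : Continuous (gegenbauerSphere d k) :=
  (gegenbauer (((d : ℝ) - 1) / 2) k).continuous

theorem gegenbauerSphere_laplace (hd : 2 ≤ d) (k : ℕ) {t : ℝ} (ht : t ∈ Set.Icc (-1 : ℝ) 1) :
    |gegenbauerSphere d k t| / gegenbauerSphere d k 1 =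
      ‖laplaceIntegral (d - 2) k t‖ / ∫ φ in (0 : ℝ)..Real.pi, Real.sin φ ^ (d - 2) := by
  obtain ⟨e, rfl⟩ := Nat.exists_eq_add_of_le' hd
  have h := congrArg norm (gegenbauer_laplace e k ht)
  have hr : ((((e + 2 : ℕ) : ℝ)) - 1) / 2 = ((e : ℝ) + 1) / 2 := by push_cast; ring
  have hp : 0 < ∫ φ in (0 : ℝ)..Real.pi, Real.sin φ ^ e := integral_sin_pow_pos e
  have h1 := gegenbauer_eval_one_pos (show 0 < ((e : ℝ) + 1) / 2 by positivity) k
  rw [laplaceIntegral_zero, norm_mul, norm_mul, Complex.norm_real, Complex.norm_real,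
    Complex.norm_real, Real.norm_of_nonneg hp.le, Real.norm_of_nonneg h1.le, Real.norm_eq_abs] at h
  simp only [gegenbauerSphere, hr, Nat.add_sub_cancel]
  rw [div_eq_div_iff h1.ne' hp.ne', h, mul_comm]

theorem abs_gegenbauerSphere_le (hd : 2 ≤ d) (k : ℕ) {t : ℝ} (ht : t ∈ Set.Icc (-1 : ℝ) 1) :
    |gegenbauerSphere d k t| ≤ gegenbauerSphere d k 1 := by
  rw [← div_le_one (gegenbauerSphere_one_pos hd k), gegenbauerSphere_laplace hd k ht,
    div_le_one (integral_sin_pow_pos _)]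
  exact norm_laplaceIntegral_le _ _ ht

theorem tendsto_gegenbauerSphere_ratio (hd : 2 ≤ d) {t : ℝ} (ht : t ∈ Set.Ioo (-1 : ℝ) 1) :
    Filter.Tendsto (fun k => |gegenbauerSphere d k t| / gegenbauerSphere d k 1)
      Filter.atTop (nhds 0) := by
  simp only [gegenbauerSphere_laplace hd _ (Set.Ioo_subset_Icc_self ht)]
  simpa using (tendsto_laplaceIntegral (d - 2) ht).norm.div_const _

end GegenbauerSphere

/-! ### The Gegenbauer weight and orthogonality -/

section WeightMeasure

variable {d : ℕ}

theorem continuous_gegenbauerWeight (hd : 2 ≤ d) : Continuous (gegenbauerWeight d) := by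
  have : (2 : ℝ) ≤ d := by exact_mod_cast hd
  exact Continuous.rpow_const (by fun_prop) fun x => Or.inr (by linarith)

theorem gegenbauerWeight_nonneg (d : ℕ) {s : ℝ} (hs : s ∈ Set.Icc (-1 : ℝ) 1) :
    0 ≤ gegenbauerWeight d s :=
  Real.rpow_nonneg (by nlinarith [hs.1, hs.2]) _

theorem gegenbauerWeight_pos (d : ℕ) {s : ℝ} (hs : s ∈ Set.Ioo (-1 : ℝ) 1) :
    0 < gegenbauerWeight d s :=
  Real.rpow_pos_of_pos (by nlinarith [hs.1, hs.2]) _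

/-- The measure on `ℝ` with density `(1 - s²)^((d-2)/2)` on `[-1,1]`. -/
noncomputable def gegenbauerMeasure (d : ℕ) : Measure ℝ :=
  (volume.restrict (Set.Icc (-1 : ℝ) 1)).withDensity fun s => ENNReal.ofReal (gegenbauerWeight d s)

theorem integral_gegenbauerMeasure (hd : 2 ≤ d) {E : Type*} [NormedAddCommGroup E]
    [NormedSpace ℝ E] (q : ℝ → E) :
    ∫ s, q s ∂(gegenbauerMeasure d) = ∫ s in (-1 : ℝ)..1, gegenbauerWeight d s • q s := by
  rw [gegenbauerMeasure, integral_withDensity_eq_integral_toReal_smul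
    (continuous_gegenbauerWeight hd).measurable.ennreal_ofReal
    (ae_of_all _ fun _ => ENNReal.ofReal_lt_top),
    intervalIntegral.integral_of_le (by norm_num), ← integral_Icc_eq_integral_Ioc]
  exact setIntegral_congr_fun measurableSet_Icc fun s hs => by
    simp only [ENNReal.toReal_ofReal (gegenbauerWeight_nonneg d hs)]

theorem isFiniteMeasure_gegenbauerMeasure (hd : 2 ≤ d) :
    IsFiniteMeasure (gegenbauerMeasure d) := by
  refine isFiniteMeasure_withDensity_ofReal ?_
  exact (((continuous_gegenbauerWeight hd).continuousOn.integrableOn_Icc)).2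

theorem ae_mem_Icc_gegenbauerMeasure (d : ℕ) :
    ∀ᵐ s ∂(gegenbauerMeasure d), s ∈ Set.Icc (-1 : ℝ) 1 :=
  (withDensity_absolutelyContinuous _ _).ae_le (ae_restrict_mem measurableSet_Icc)

theorem restrict_gegenbauerMeasure (d : ℕ) :
    (gegenbauerMeasure d).restrict (Set.Icc (-1 : ℝ) 1) = gegenbauerMeasure d :=
  Measure.restrict_eq_self_of_ae_mem (ae_mem_Icc_gegenbauerMeasure d)

theorem integrable_gegenbauerMeasure (hd : 2 ≤ d) {E : Type*} [NormedAddCommGroup E] {q : ℝ → E}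
    (hq : ContinuousOn q (Set.Icc (-1) 1)) : Integrable q (gegenbauerMeasure d) := by
  have := isFiniteMeasure_gegenbauerMeasure hd
  rw [← restrict_gegenbauerMeasure]
  exact hq.integrableOn_compact isCompact_Icc

theorem integral_gegenbauerMeasure_congr {E : Type*} [NormedAddCommGroup E] [NormedSpace ℝ E]
    {p q : ℝ → E} (h : ∀ s ∈ Set.Icc (-1 : ℝ) 1, p s = q s) :
    ∫ s, p s ∂(gegenbauerMeasure d) = ∫ s, q s ∂(gegenbauerMeasure d) :=
  integral_congr_ae ((ae_mem_Icc_gegenbauerMeasure d).mono h)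

theorem gegenbauerMeasure_pos (hd : 2 ≤ d) {u : Set ℝ} (hu : IsOpen u) (h1 : (1 : ℝ) ∈ u) :
    0 < gegenbauerMeasure d (u ∩ Set.Icc (-1) 1) := by
  have hvol : 0 < volume (u ∩ Set.Ioo (-1 : ℝ) 1) := by
    refine (hu.inter isOpen_Ioo).measure_pos volume ?_
    have : (1 : ℝ) ∈ closure (Set.Ioo (-1 : ℝ) 1) := by
      rw [closure_Ioo (by norm_num)]; norm_num
    exact mem_closure_iff.1 this u hu h1
  refine pos_iff_ne_zero.2 fun h => hvol.ne' ?_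
  rw [gegenbauerMeasure, withDensity_apply_eq_zero
    (continuous_gegenbauerWeight hd).measurable.ennreal_ofReal] at h
  refine measure_mono_null ?_ ((Measure.restrict_apply_eq_zero' measurableSet_Icc).1 h)
  intro s hs
  refine ⟨⟨?_, hs.1, Set.Ioo_subset_Icc_self hs.2⟩, Set.Ioo_subset_Icc_self hs.2⟩
  simpa using gegenbauerWeight_pos d hs.2

theorem eq_zero_of_integral_gegenbauerMeasure_eq_zero (hd : 2 ≤ d) {q : ℝ → ℝ}
    (hq : ContinuousOn q (Set.Icc (-1) 1)) (h0 : ∀ s ∈ Set.Icc (-1 : ℝ) 1, 0 ≤ q s)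
    (hint : ∫ s, q s ∂(gegenbauerMeasure d) = 0) {s : ℝ} (hs : s ∈ Set.Icc (-1 : ℝ) 1) :
    q s = 0 := by
  rw [integral_gegenbauerMeasure hd, intervalIntegral.integral_of_le (by norm_num),
    ← integral_Icc_eq_integral_Ioc] at hint
  have hc : ContinuousOn (fun s => gegenbauerWeight d s • q s) (Set.Icc (-1) 1) :=
    (continuous_gegenbauerWeight hd).continuousOn.smul hq
  simp only [smul_eq_mul] at hint hc
  rw [setIntegral_eq_zero_iff_of_nonneg_ae
    ((ae_restrict_mem measurableSet_Icc).mono fun s hs =>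
      mul_nonneg (gegenbauerWeight_nonneg d hs) (h0 s hs))
    (hc.integrableOn_compact isCompact_Icc)] at hint
  have hprod := Measure.eqOn_Icc_of_ae_eq volume (by norm_num : (-1 : ℝ) ≠ 1) hint hc
    continuousOn_const
  have hIoo : Set.EqOn q (fun _ => 0) (Set.Ioo (-1) 1) := fun s hs =>
    (mul_eq_zero.1 (hprod (Set.Ioo_subset_Icc_self hs))).resolve_left
      (gegenbauerWeight_pos d hs).ne'
  refine Set.EqOn.of_subset_closure hIoo hq continuousOn_const Set.Ioo_subset_Icc_self ?_ hs
  rw [closure_Ioo (by norm_num)]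

/-- Against the weight, the integrand is the derivative of `(1-s²)^(d/2) p(s)`, which vanishes at
both ends. -/
theorem integral_gegenbauerMeasure_by_parts (hd : 2 ≤ d) (p : ℝ[X]) :
    ∫ s, ((1 - X ^ 2) * derivative p - (d : ℝ[X]) * X * p).eval s ∂(gegenbauerMeasure d) = 0 := by
  have hd' : (2 : ℝ) ≤ d := by exact_mod_cast hd
  have hderiv : ∀ s : ℝ, HasDerivAt (fun s => (1 - s ^ 2) ^ ((d : ℝ) / 2) * p.eval s)
      (-(2 * s) * ((d : ℝ) / 2) * (1 - s ^ 2) ^ ((d : ℝ) / 2 - 1) * p.eval s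
        + (1 - s ^ 2) ^ ((d : ℝ) / 2) * (derivative p).eval s) s := by
    intro s
    have h1 : HasDerivAt (fun s : ℝ => 1 - s ^ 2) (-(2 * s)) s := by
      simpa using (hasDerivAt_pow 2 s).const_sub 1
    exact (h1.rpow_const (p := (d : ℝ) / 2) (Or.inr (by linarith))).mul (p.hasDerivAt s)
  have hcont : Continuous fun s : ℝ => -(2 * s) * ((d : ℝ) / 2) * (1 - s ^ 2) ^ ((d : ℝ) / 2 - 1)
      * p.eval s + (1 - s ^ 2) ^ ((d : ℝ) / 2) * (derivative p).eval s := by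
    have e1 : Continuous fun s : ℝ => (1 - s ^ 2) ^ ((d : ℝ) / 2 - 1) :=
      Continuous.rpow_const (by fun_prop) fun x => Or.inr (by linarith)
    have e2 : Continuous fun s : ℝ => (1 - s ^ 2) ^ ((d : ℝ) / 2) :=
      Continuous.rpow_const (by fun_prop) fun x => Or.inr (by linarith)
    have e3 := p.continuous
    have e4 := (derivative p).continuous
    fun_prop
  have key := intervalIntegral.integral_eq_sub_of_hasDerivAt (a := -1) (b := 1)
    (fun s _ => hderiv s) (hcont.intervalIntegrable _ _)
  have hz : (0 : ℝ) ^ ((d : ℝ) / 2) = 0 := Real.zero_rpow (by linarith)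
  norm_num [hz] at key
  rw [integral_gegenbauerMeasure hd, ← key]
  refine intervalIntegral.integral_congr fun s hs => ?_
  rw [Set.uIcc_of_le (by norm_num)] at hs
  have hs0 : 0 ≤ 1 - s ^ 2 := by nlinarith [hs.1, hs.2]
  have hw : (1 - s ^ 2) ^ ((d : ℝ) / 2) = gegenbauerWeight d s * (1 - s ^ 2) := by
    rw [gegenbauerWeight, ← Real.rpow_add_one' hs0 (by linarith)]
    congr 1; ring
  have hw' : (1 - s ^ 2) ^ ((d : ℝ) / 2 - 1) = gegenbauerWeight d s := by
    rw [gegenbauerWeight]; congr 1; ring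
  simp only [hw, hw', smul_eq_mul, eval_sub, eval_mul, eval_one, eval_pow, eval_X, eval_natCast]
  ring

theorem integrable_eval_gegenbauerMeasure (hd : 2 ≤ d) (p : ℝ[X]) :
    Integrable (fun s => p.eval s) (gegenbauerMeasure d) :=
  integrable_gegenbauerMeasure hd p.continuous.continuousOn

/-- Integration of polynomials against the Gegenbauer weight, as a linear functional. -/
noncomputable def gegenbauerFunctional (hd : 2 ≤ d) : ℝ[X] →ₗ[ℝ] ℝ where
  toFun p := ∫ s, p.eval s ∂(gegenbauerMeasure d)
  map_add' p q := by
    simp only [eval_add]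
    exact integral_add (integrable_eval_gegenbauerMeasure hd p)
      (integrable_eval_gegenbauerMeasure hd q)
  map_smul' a p := by
    simp only [eval_smul, smul_eq_mul, integral_const_mul, RingHom.id_apply]

theorem gegenbauerFunctional_C_mul (hd : 2 ≤ d) (a : ℝ) (p : ℝ[X]) :
    gegenbauerFunctional hd (C a * p) = a * gegenbauerFunctional hd p := by
  rw [← smul_eq_C_mul, map_smul, smul_eq_mul]

theorem gegenbauerFunctional_natCast_mul (hd : 2 ≤ d) (n : ℕ) (p : ℝ[X]) :
    gegenbauerFunctional hd ((n : ℝ[X]) * p) = n * gegenbauerFunctional hd p := by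
  simpa using gegenbauerFunctional_C_mul hd n p

/-- Integration by parts for `X^(j+1)`. The moments of the sphere measure along an axis satisfy the
same recurrence. -/
theorem gegenbauerFunctional_moment (hd : 2 ≤ d) (j : ℕ) :
    ((j : ℝ) + d + 1) * gegenbauerFunctional hd (X ^ (j + 2)) =
      (j + 1) * gegenbauerFunctional hd (X ^ j) := by
  have h : gegenbauerFunctional hd ((1 - X ^ 2) * derivative (X ^ (j + 1))
      - (d : ℝ[X]) * X * X ^ (j + 1)) = 0 := integral_gegenbauerMeasure_by_parts hd _
  have e : (1 - X ^ 2) * derivative (X ^ (j + 1)) - (d : ℝ[X]) * X * X ^ (j + 1) =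
      ((j + 1 : ℕ) : ℝ[X]) * X ^ j - ((j + 1 + d : ℕ) : ℝ[X]) * X ^ (j + 2) := by
    rw [derivative_X_pow]
    push_cast
    simp only [map_add, map_natCast, map_one]
    ring
  rw [e, map_sub, gegenbauerFunctional_natCast_mul, gegenbauerFunctional_natCast_mul] at h
  push_cast at h
  linear_combination -h

theorem gegenbauerFunctional_X (hd : 2 ≤ d) : gegenbauerFunctional hd X = 0 := by
  have h : gegenbauerFunctional hd ((1 - X ^ 2) * derivative (1 : ℝ[X])
      - (d : ℝ[X]) * X * 1) = 0 := integral_gegenbauerMeasure_by_parts hd _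
  have hd' : (2 : ℝ) ≤ d := by exact_mod_cast hd
  rw [derivative_one, mul_zero, zero_sub, mul_one, map_neg, neg_eq_zero,
    gegenbauerFunctional_natCast_mul] at h
  exact (mul_eq_zero.1 h).resolve_left (by positivity)

theorem gegenbauerFunctional_one_pos (hd : 2 ≤ d) : 0 < gegenbauerFunctional hd 1 := by
  have := isFiniteMeasure_gegenbauerMeasure hd
  have h : gegenbauerFunctional hd 1 = (gegenbauerMeasure d).real Set.univ := by
    simp [gegenbauerFunctional]
  rw [h]
  refine ENNReal.toReal_pos ?_ (measure_ne_top _ _)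
  exact ((gegenbauerMeasure_pos hd isOpen_univ (Set.mem_univ _)).trans_le
    (measure_mono (Set.subset_univ _))).ne'

/-- The Gegenbauer polynomial of degree `k` attached to `S^d`. -/
noncomputable abbrev gegenbauerSpherePoly (d k : ℕ) : ℝ[X] := gegenbauer (((d : ℝ) - 1) / 2) k

theorem gegenbauerSpherePoly_rec (d k : ℕ) :
    C ((k : ℝ) + 2) * gegenbauerSpherePoly d (k + 2) =
      C (2 * (k : ℝ) + 1 + d) * (X * gegenbauerSpherePoly d (k + 1)) -
        C ((k : ℝ) + d - 1) * gegenbauerSpherePoly d k := by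
  have h := gegenbauer_rec (((d : ℝ) - 1) / 2) k
  have h2 : (2 : ℝ[X]) * C (((d : ℝ) - 1) / 2) = C (d : ℝ) - 1 := by
    rw [← map_ofNat C, ← C_mul, ← C_1, ← C_sub]; congr 1; ring
  rw [show 2 * ((k : ℝ[X]) + 1 + C (((d : ℝ) - 1) / 2)) =
    2 * ((k : ℝ[X]) + 1) + 2 * C (((d : ℝ) - 1) / 2) by ring, h2] at h
  simp only [map_add, map_sub, map_mul, map_natCast, map_ofNat, map_one] at h ⊢
  linear_combination h

/-- Integration by parts with the derivative formula gives one relation between the integrals of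
`C_k` and `X C_(k+1)`; the recurrence gives another, involving `C_(k+2)`. Eliminating `X C_(k+1)`
leaves the integral of `C_(k+2)` as a multiple of `k` times that of `C_k`. -/
theorem gegenbauerFunctional_gegenbauer (hd : 2 ≤ d) (k : ℕ) :
    gegenbauerFunctional hd (gegenbauerSpherePoly d (k + 1)) = 0 := by
  have hd' : (2 : ℝ) ≤ d := by exact_mod_cast hd
  induction k using Nat.strong_induction_on with
  | _ k ih =>
  rcases k with _ | k
  · rw [gegenbauerSpherePoly, gegenbauer, gegenbauerFunctional_C_mul, gegenbauerFunctional_X,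
      mul_zero]
  have h : gegenbauerFunctional hd ((1 - X ^ 2) * derivative (gegenbauerSpherePoly d (k + 1))
      - (d : ℝ[X]) * X * gegenbauerSpherePoly d (k + 1)) = 0 :=
    integral_gegenbauerMeasure_by_parts hd _
  have e : (1 - X ^ 2) * derivative (gegenbauerSpherePoly d (k + 1))
      - (d : ℝ[X]) * X * gegenbauerSpherePoly d (k + 1) =
      C ((k : ℝ) + d - 1) * gegenbauerSpherePoly d k -
        C ((k : ℝ) + 1 + d) * (X * gegenbauerSpherePoly d (k + 1)) := by
    rw [gegenbauer_derivative]
    have h2 : (2 : ℝ[X]) * C (((d : ℝ) - 1) / 2) = C (d : ℝ) - 1 := by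
      rw [← map_ofNat C, ← C_mul, ← C_1, ← C_sub]; congr 1; ring
    rw [h2]
    simp only [map_add, map_sub, map_natCast, map_one]
    ring
  rw [e, map_sub, gegenbauerFunctional_C_mul, gegenbauerFunctional_C_mul] at h
  have hr := congrArg (gegenbauerFunctional hd) (gegenbauerSpherePoly_rec d k)
  rw [map_sub, gegenbauerFunctional_C_mul, gegenbauerFunctional_C_mul,
    gegenbauerFunctional_C_mul] at hr
  -- The factor `k` takes care of `C_0 = 1`, whose integral is not zero.
  have hk : (k : ℝ) * gegenbauerFunctional hd (gegenbauerSpherePoly d k) = 0 := by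
    rcases k with _ | k
    · simp
    · rw [ih k (by lia), mul_zero]
  have : (((k : ℝ) + 2) * (k + 1 + d)) *
      gegenbauerFunctional hd (gegenbauerSpherePoly d (k + 2)) = 0 := by
    linear_combination (k + 1 + d : ℝ) * hr - (2 * k + 1 + d : ℝ) * h + (k + d - 1 : ℝ) * hk
  exact (mul_eq_zero.1 this).resolve_left (by positivity)

/-- By the recurrence, one factor `X` is traded for a shift of the index of the Gegenbauer
polynomial by one up or down, which keeps it above the remaining exponent. -/
theorem gegenbauerFunctional_X_pow_mul (hd : 2 ≤ d) (j k : ℕ) (hjk : j < k) :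
    gegenbauerFunctional hd (X ^ j * gegenbauerSpherePoly d k) = 0 := by
  induction j generalizing k with
  | zero =>
    obtain ⟨k, rfl⟩ := Nat.exists_eq_add_of_lt hjk
    simpa using gegenbauerFunctional_gegenbauer hd k
  | succ j ih =>
    obtain ⟨k, rfl⟩ := Nat.exists_eq_add_of_le' (show 1 ≤ k by lia)
    have hr := congrArg (fun p => gegenbauerFunctional hd (X ^ j * p))
      (gegenbauerSpherePoly_rec d k)
    simp only [mul_sub (X ^ j), map_sub (gegenbauerFunctional hd), mul_left_comm (X ^ j) (C _), gegenbauerFunctional_C_mul] at hr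
    rw [ih (k + 2) (by lia), ih k (by lia), mul_zero, mul_zero, sub_zero, ← mul_assoc,
      ← pow_succ] at hr
    exact (mul_eq_zero.1 hr.symm).resolve_left (by positivity)

theorem gegenbauerFunctional_mul_of_natDegree_lt (hd : 2 ≤ d) {k : ℕ} {p : ℝ[X]}
    (hp : p.natDegree < k) : gegenbauerFunctional hd (p * gegenbauerSpherePoly d k) = 0 := by
  rw [p.as_sum_range' k hp, Finset.sum_mul, map_sum]
  refine Finset.sum_eq_zero fun j hj => ?_
  rw [← C_mul_X_pow_eq_monomial, mul_assoc, gegenbauerFunctional_C_mul,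
    gegenbauerFunctional_X_pow_mul hd j k (Finset.mem_range.1 hj), mul_zero]

theorem gegenbauerFunctional_orthogonal (hd : 2 ≤ d) {k l : ℕ} (hkl : k ≠ l) :
    gegenbauerFunctional hd (gegenbauerSpherePoly d k * gegenbauerSpherePoly d l) = 0 := by
  rcases lt_or_gt_of_ne hkl with h | h
  · exact gegenbauerFunctional_mul_of_natDegree_lt hd ((gegenbauer_natDegree_le _ k).trans_lt h)
  · rw [mul_comm]
    exact gegenbauerFunctional_mul_of_natDegree_lt hd ((gegenbauer_natDegree_le _ l).trans_lt h)

theorem gegenbauerFunctional_sq_pos (hd : 2 ≤ d) (k : ℕ) :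
    0 < gegenbauerFunctional hd (gegenbauerSpherePoly d k * gegenbauerSpherePoly d k) := by
  have hnn : 0 ≤ gegenbauerFunctional hd (gegenbauerSpherePoly d k * gegenbauerSpherePoly d k) :=
    integral_nonneg fun s => by simpa using mul_self_nonneg _
  refine lt_of_le_of_ne hnn fun h => ?_
  have := eq_zero_of_integral_gegenbauerMeasure_eq_zero hd
    (q := fun s => (gegenbauerSpherePoly d k * gegenbauerSpherePoly d k).eval s)
    (Polynomial.continuous _).continuousOn (fun s _ => by simpa using mul_self_nonneg _) h.symm
    (show (1 : ℝ) ∈ Set.Icc (-1 : ℝ) 1 by norm_num)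
  simp only [eval_mul] at this
  exact (gegenbauerSphere_one_pos hd k).ne' (mul_self_eq_zero.1 this)

theorem gegenbauerNormalization_eq (hd : 2 ≤ d) (k : ℕ) : gegenbauerNormalization d k =
    (gegenbauerFunctional hd (gegenbauerSpherePoly d k * gegenbauerSpherePoly d k))⁻¹ := by
  rw [gegenbauerNormalization]
  congr 1
  change _ = ∫ s, _ ∂(gegenbauerMeasure d)
  rw [integral_gegenbauerMeasure hd]
  refine intervalIntegral.integral_congr fun s _ => ?_
  simp only [gegenbauerSphere, eval_mul, smul_eq_mul]
  ring

theorem gegenbauerNormalization_pos (hd : 2 ≤ d) (k : ℕ) : 0 < gegenbauerNormalization d k := by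
  rw [gegenbauerNormalization_eq hd]
  exact inv_pos.2 (gegenbauerFunctional_sq_pos hd k)

end WeightMeasure

/-! ### The sphere measure and its projection to an axis -/

section SphereMeasure

/-- The integral `∫₀^∞ r^m exp (-r²) dr`. -/
noncomputable def gaussianMoment (m : ℕ) : ℝ :=
  ∫ r in Set.Ioi (0 : ℝ), r ^ (m : ℝ) * Real.exp (-1 * r ^ (2 : ℝ))

theorem gaussianMoment_eq (m : ℕ) : gaussianMoment m = Real.Gamma (((m : ℝ) + 1) / 2) / 2 := by
  have hm : (-1 : ℝ) < m := by have := Nat.cast_nonneg (α := ℝ) m; linarith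
  rw [gaussianMoment, integral_rpow_mul_exp_neg_mul_rpow (by norm_num) hm (by norm_num)]
  simp only [Real.one_rpow]
  ring

theorem gaussianMoment_pos (m : ℕ) : 0 < gaussianMoment m := by
  rw [gaussianMoment_eq]
  have := Real.Gamma_pos_of_pos (show 0 < ((m : ℝ) + 1) / 2 by positivity)
  positivity

theorem gaussianMoment_add_two (m : ℕ) :
    2 * gaussianMoment (m + 2) = ((m : ℝ) + 1) * gaussianMoment m := by
  rw [gaussianMoment_eq, gaussianMoment_eq,
    show (((m + 2 : ℕ) : ℝ) + 1) / 2 = ((m : ℝ) + 1) / 2 + 1 by push_cast; ring,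
    Real.Gamma_add_one (by positivity)]
  ring

variable {d : ℕ}

/-- Polar coordinates: the integrand is homogeneous of degree `j` times a radial Gaussian, and the
radial measure has density `r^d`. -/
theorem integral_inner_pow_mul_exp (y : EuclideanSpace ℝ (Fin (d + 1))) (j : ℕ) :
    ∫ x : EuclideanSpace ℝ (Fin (d + 1)), inner ℝ y x ^ j * Real.exp (-1 * ‖x‖ ^ 2) =
      (∫ x : UnitSphere d, inner ℝ y x ^ j
        ∂(volume : Measure (EuclideanSpace ℝ (Fin (d + 1)))).toSphere) * gaussianMoment (j + d) := by
  let E := EuclideanSpace ℝ (Fin (d + 1))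
  have hdim : Module.finrank ℝ E - 1 = d := by simp [E]
  calc ∫ x : E, inner ℝ y x ^ j * Real.exp (-1 * ‖x‖ ^ 2)
      = ∫ x : ({(0)}ᶜ : Set E), inner ℝ y (x : E) ^ j * Real.exp (-1 * ‖(x : E)‖ ^ 2)
          ∂((volume : Measure E).comap (↑)) := by
        rw [integral_subtype_comap (measurableSet_singleton _).compl
          fun x : E => inner ℝ y x ^ j * Real.exp (-1 * ‖x‖ ^ 2), restrict_compl_singleton]
    _ = ∫ z, (inner ℝ y (z.1 : E) ^ j) * ((z.2 : ℝ) ^ j * Real.exp (-1 * (z.2 : ℝ) ^ 2))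
          ∂((volume : Measure E).toSphere.prod (.volumeIoiPow (Module.finrank ℝ E - 1))) := by
        rw [← (volume : Measure E).measurePreserving_homeomorphUnitSphereProd.integral_comp
          (Homeomorph.measurableEmbedding _)]
        refine integral_congr_ae (ae_of_all _ fun x => ?_)
        have hx : ‖(x : E)‖ ≠ 0 := norm_ne_zero_iff.2 x.2
        simp only [homeomorphUnitSphereProd_apply_fst_coe, homeomorphUnitSphereProd_apply_snd_coe,
          inner_smul_right, mul_pow]
        have h1 : (‖(x : E)‖⁻¹) ^ j * ‖(x : E)‖ ^ j = 1 := by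
          rw [← mul_pow, inv_mul_cancel₀ hx, one_pow]
        linear_combination (-(inner ℝ y (x : E) ^ j * Real.exp (-1 * ‖(x : E)‖ ^ 2))) * h1
    _ = (∫ x : UnitSphere d, inner ℝ y x ^ j ∂(volume : Measure E).toSphere) *
          ∫ r : Set.Ioi (0 : ℝ), ((r : ℝ) ^ j * Real.exp (-1 * (r : ℝ) ^ 2))
            ∂(.volumeIoiPow (Module.finrank ℝ E - 1)) :=
        integral_prod_mul (fun x : UnitSphere d => inner ℝ y (x : E) ^ j)
          (fun r : Set.Ioi (0 : ℝ) => (r : ℝ) ^ j * Real.exp (-1 * (r : ℝ) ^ 2))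
    _ = _ := by
        congr 1
        simp only [hdim, Measure.volumeIoiPow, ENNReal.ofReal]
        rw [integral_withDensity_eq_integral_smul (by fun_prop),
          integral_subtype_comap measurableSet_Ioi fun a : ℝ =>
            Real.toNNReal (a ^ d) • (a ^ j * Real.exp (-1 * a ^ 2)), gaussianMoment]
        refine setIntegral_congr_fun measurableSet_Ioi fun r hr => ?_
        have hr' : (0 : ℝ) ≤ r := le_of_lt hr
        simp only [NNReal.smul_def, Real.coe_toNNReal _ (pow_nonneg hr' d), smul_eq_mul,
          Real.rpow_natCast, Real.rpow_two, pow_add]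
        ring

theorem integrable_inner_pow_mul_exp (y : EuclideanSpace ℝ (Fin (d + 1))) (j : ℕ) :
    Integrable (fun x : EuclideanSpace ℝ (Fin (d + 1)) =>
      inner ℝ y x ^ j * Real.exp (-1 * ‖x‖ ^ 2)) := by
  have h1 : Integrable (fun x : EuclideanSpace ℝ (Fin (d + 1)) =>
      (fun r : ℝ => r ^ j * Real.exp (-1 * r ^ 2)) ‖x‖) := by
    refine (integrable_fun_norm_addHaar (f := fun r : ℝ => r ^ j * Real.exp (-1 * r ^ 2))
      volume).2 ?_
    have hm : (-1 : ℝ) < (d + j : ℕ) := by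
      have := Nat.cast_nonneg (α := ℝ) (d + j); linarith
    refine (integrableOn_rpow_mul_exp_neg_mul_sq one_pos hm).congr_fun (fun r _ => ?_)
      measurableSet_Ioi
    simp only [Real.rpow_natCast, pow_add, smul_eq_mul, finrank_euclideanSpace_fin,
      Nat.add_sub_cancel]
    ring
  refine (h1.const_mul (‖y‖ ^ j)).mono' (by fun_prop) (ae_of_all _ fun x => ?_)
  rw [norm_mul, norm_pow, Real.norm_eq_abs, Real.norm_of_nonneg (Real.exp_pos _).le, ← mul_assoc,
    ← mul_pow]
  gcongr
  exact abs_real_inner_le_norm y x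

/-- Integration by parts in the direction `y`, where the Gaussian has derivative `-2 (y·x)
exp(-|x|²)`. -/
theorem integral_inner_pow_mul_exp_add_two {y : EuclideanSpace ℝ (Fin (d + 1))} (hy : ‖y‖ = 1)
    (j : ℕ) : 2 * ∫ x : EuclideanSpace ℝ (Fin (d + 1)),
        inner ℝ y x ^ (j + 1) * (inner ℝ y x * Real.exp (-1 * ‖x‖ ^ 2)) =
      (j + 1) * ∫ x : EuclideanSpace ℝ (Fin (d + 1)),
        inner ℝ y x ^ j * Real.exp (-1 * ‖x‖ ^ 2) := by
  have hf : ∀ x : EuclideanSpace ℝ (Fin (d + 1)), HasFDerivAt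
      (fun x => inner ℝ y x ^ (j + 1)) (((j + 1 : ℕ) * inner ℝ y x ^ j) • innerSL ℝ y) x := by
    intro x
    have := ((innerSL ℝ y).hasFDerivAt (x := x)).pow (j + 1)
    simpa using this
  have hg : ∀ x : EuclideanSpace ℝ (Fin (d + 1)), HasFDerivAt
      (fun x => Real.exp (-1 * ‖x‖ ^ 2))
      (Real.exp (-1 * ‖x‖ ^ 2) • ((-1 : ℝ) • (2 • innerSL ℝ x))) x := by
    intro x
    exact (((hasStrictFDerivAt_norm_sq x).hasFDerivAt).const_mul (-1)).exp
  have hf' : ∀ x, fderiv ℝ (fun x => inner ℝ y x ^ (j + 1)) x y = (j + 1) * inner ℝ y x ^ j := by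
    intro x
    rw [(hf x).fderiv]
    simp [hy]
  have hg' : ∀ x : EuclideanSpace ℝ (Fin (d + 1)),
      fderiv ℝ (fun x => Real.exp (-1 * ‖x‖ ^ 2)) x y =
        -2 * (inner ℝ y x * Real.exp (-1 * ‖x‖ ^ 2)) := by
    intro x
    rw [(hg x).fderiv]
    simp [real_inner_comm]
    ring
  have i1 := integrable_inner_pow_mul_exp y j
  have i2 := integrable_inner_pow_mul_exp y (j + 1)
  have i3 := integrable_inner_pow_mul_exp y (j + 2)
  have key := integral_mul_fderiv_eq_neg_fderiv_mul_of_integrable (μ := volume) (𝕜 := ℝ)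
    (f := fun x : EuclideanSpace ℝ (Fin (d + 1)) => inner ℝ y x ^ (j + 1))
    (g := fun x => Real.exp (-1 * ‖x‖ ^ 2)) (v := y)
    ((i1.const_mul (j + 1 : ℝ)).congr (ae_of_all _ fun x => by simp only [hf']; ring))
    ((i3.const_mul (-2 : ℝ)).congr (ae_of_all _ fun x => by simp only [hg']; ring))
    i2 (fun x _ => (hf x).differentiableAt) (fun x _ => (hg x).differentiableAt)
  simp only [hf', hg', mul_assoc, mul_left_comm _ (-2 : ℝ), integral_const_mul] at key
  linear_combination -key

theorem integral_inner_exp (y : EuclideanSpace ℝ (Fin (d + 1))) :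
    ∫ x : EuclideanSpace ℝ (Fin (d + 1)), inner ℝ y x ^ 1 * Real.exp (-1 * ‖x‖ ^ 2) = 0 := by
  have h := integral_neg_eq_self (fun x : EuclideanSpace ℝ (Fin (d + 1)) =>
    inner ℝ y x ^ 1 * Real.exp (-1 * ‖x‖ ^ 2)) volume
  simp only [inner_neg_right, norm_neg, pow_one, neg_mul, integral_neg] at h ⊢
  linarith

/-- The rotation invariant measure on `S^d`. -/
noncomputable abbrev sphereMeasure (d : ℕ) : Measure (UnitSphere d) :=
  (volume : Measure (EuclideanSpace ℝ (Fin (d + 1)))).toSphere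

/-- The ratio between the masses of the measure of `S^d` and of the Gegenbauer weight. -/
noncomputable def sphereRatio (hd : 2 ≤ d) : ℝ :=
  (sphereMeasure d).real Set.univ / gegenbauerFunctional hd 1

theorem sphereMeasure_real_univ_pos (d : ℕ) : 0 < (sphereMeasure d).real Set.univ :=
  ENNReal.toReal_pos (Measure.measure_univ_ne_zero.2 (Measure.toSphere_ne_zero _))
    (measure_ne_top _ _)

theorem sphereRatio_pos (hd : 2 ≤ d) : 0 < sphereRatio hd :=
  div_pos (sphereMeasure_real_univ_pos d) (gegenbauerFunctional_one_pos hd)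

/-- Dividing the Gaussian recurrence by the radial moments gives `(j+d+1) S_(j+2) = (j+1) S_j` for
the sphere moments `S_j`, the recurrence of the Gegenbauer weight. `sphereRatio` matches `j = 0`,
and both moments vanish for `j = 1`. -/
theorem integral_sphereMeasure_inner_pow (hd : 2 ≤ d) (y : UnitSphere d) (j : ℕ) :
    ∫ x : UnitSphere d, inner ℝ (y : EuclideanSpace ℝ (Fin (d + 1))) x ^ j ∂(sphereMeasure d) =
      sphereRatio hd * gegenbauerFunctional hd (X ^ j) := by
  have hy : ‖(y : EuclideanSpace ℝ (Fin (d + 1)))‖ = 1 := by simp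
  induction j using Nat.twoStepInduction with
  | zero =>
    simp only [pow_zero, integral_const, smul_eq_mul, mul_one, sphereRatio]
    rw [div_mul_cancel₀ _ (gegenbauerFunctional_one_pos hd).ne']
  | one =>
    have h := integral_inner_pow_mul_exp (y : EuclideanSpace ℝ (Fin (d + 1))) 1
    rw [integral_inner_exp] at h
    rw [(mul_eq_zero.1 h.symm).resolve_right (gaussianMoment_pos _).ne', pow_one,
      gegenbauerFunctional_X, mul_zero]
  | more j ih _ =>
    have h0 := integral_inner_pow_mul_exp (y : EuclideanSpace ℝ (Fin (d + 1))) j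
    have h2 := integral_inner_pow_mul_exp (y : EuclideanSpace ℝ (Fin (d + 1))) (j + 2)
    have hr := integral_inner_pow_mul_exp_add_two hy j
    simp only [← mul_assoc, ← pow_succ] at hr
    rw [h0, h2, ih, show j + 2 + d = j + d + 2 by ring] at hr
    have hm := gaussianMoment_add_two (j + d)
    have hL := gegenbauerFunctional_moment hd j
    push_cast at hm
    have hp := gaussianMoment_pos (j + d)
    have hne : gaussianMoment (j + d) * ((j : ℝ) + d + 1) ≠ 0 := by positivity
    refine mul_left_cancel₀ hne ?_
    generalize gaussianMoment (j + d) = a at *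
    generalize gaussianMoment (j + d + 2) = b at *
    generalize gegenbauerFunctional hd (X ^ j) = l0 at *
    generalize gegenbauerFunctional hd (X ^ (j + 2)) = l2 at *
    generalize (∫ x : UnitSphere d, inner ℝ (y : EuclideanSpace ℝ (Fin (d + 1))) x ^ (j + 2)
      ∂(sphereMeasure d)) = s at *
    linear_combination hr - s * hm - sphereRatio hd * a * hL

theorem inner_mem_Icc (x y : UnitSphere d) :
    inner ℝ (x : EuclideanSpace ℝ (Fin (d + 1))) y ∈ Set.Icc (-1 : ℝ) 1 := by
  have := abs_real_inner_le_norm (x : EuclideanSpace ℝ (Fin (d + 1))) y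
  rw [norm_eq_of_mem_sphere, norm_eq_of_mem_sphere, mul_one, abs_le] at this
  exact this

theorem continuous_comp_inner {E : Type*} [TopologicalSpace E] {Q : ℝ → E}
    (hQ : ContinuousOn Q (Set.Icc (-1) 1)) :
    Continuous fun z : UnitSphere d × UnitSphere d =>
      Q (inner ℝ (z.1 : EuclideanSpace ℝ (Fin (d + 1))) z.2) :=
  hQ.comp_continuous (by fun_prop) fun z => inner_mem_Icc z.1 z.2

theorem integral_sphereMeasure_eval (hd : 2 ≤ d) (y : UnitSphere d) (p : ℝ[X]) :
    ∫ x : UnitSphere d, p.eval (inner ℝ (y : EuclideanSpace ℝ (Fin (d + 1))) x)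
      ∂(sphereMeasure d) = sphereRatio hd * gegenbauerFunctional hd p := by
  have hint : ∀ q : ℝ[X], Integrable
      (fun x : UnitSphere d => q.eval (inner ℝ (y : EuclideanSpace ℝ (Fin (d + 1))) x))
      (sphereMeasure d) := fun q =>
    Continuous.integrable_of_hasCompactSupport (q.continuous.comp (by fun_prop))
      (HasCompactSupport.of_compactSpace _)
  induction p using Polynomial.induction_on' with
  | add p q hp hq =>
    simp only [eval_add]
    rw [integral_add (hint p) (hint q), hp, hq, map_add, mul_add]
  | monomial n a =>
    rw [← C_mul_X_pow_eq_monomial]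
    simp only [eval_mul, eval_C, eval_pow, eval_X]
    rw [integral_const_mul, integral_sphereMeasure_inner_pow hd, gegenbauerFunctional_C_mul]
    ring

/-- The image of the measure of `S^d` under `x ↦ y · x` is the Gegenbauer weight, up to a factor. -/
theorem integral_sphereMeasure_comp_inner (hd : 2 ≤ d) (y : UnitSphere d) {Q : ℝ → ℝ}
    (hQ : ContinuousOn Q (Set.Icc (-1) 1)) :
    ∫ x : UnitSphere d, Q (inner ℝ (y : EuclideanSpace ℝ (Fin (d + 1))) x) ∂(sphereMeasure d) =
      sphereRatio hd * ∫ s, Q s ∂(gegenbauerMeasure d) := by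
  have := isFiniteMeasure_gegenbauerMeasure hd
  have hint : ∀ q : ℝ → ℝ, ContinuousOn q (Set.Icc (-1) 1) → Integrable
      (fun x : UnitSphere d => q (inner ℝ (y : EuclideanSpace ℝ (Fin (d + 1))) x))
      (sphereMeasure d) := fun q hq =>
    Continuous.integrable_of_hasCompactSupport
      ((continuous_comp_inner hq).comp (Continuous.prodMk continuous_const continuous_id))
      (HasCompactSupport.of_compactSpace _)
  set M := (sphereMeasure d).real Set.univ
  set N := (gegenbauerMeasure d).real Set.univ
  refine eq_of_abs_sub_le_all fun ε hε => ?_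
  set δ := ε / (M + sphereRatio hd * N + 1) with hδ
  have hM : 0 ≤ M := measureReal_nonneg
  have hN : 0 ≤ N := measureReal_nonneg
  have hR := (sphereRatio_pos hd).le
  have hden : 0 < M + sphereRatio hd * N + 1 := by positivity
  have hδ0 : 0 < δ := div_pos hε hden
  -- Weierstrass approximation carries the identity from polynomials to `Q`; `δ` is chosen so that
  -- the errors, weighted by the two masses, add up to at most `ε`.
  obtain ⟨p, hp⟩ := exists_polynomial_near_of_continuousOn (-1) 1 Q hQ δ hδ0
  have e1 : |∫ x : UnitSphere d, Q (inner ℝ (y : EuclideanSpace ℝ (Fin (d + 1))) x)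
      ∂(sphereMeasure d) - ∫ x : UnitSphere d,
        p.eval (inner ℝ (y : EuclideanSpace ℝ (Fin (d + 1))) x) ∂(sphereMeasure d)| ≤ δ * M := by
    rw [← integral_sub (hint _ hQ) (hint _ p.continuous.continuousOn), ← Real.norm_eq_abs]
    refine norm_integral_le_of_norm_le_const (ae_of_all _ fun x => ?_)
    rw [Real.norm_eq_abs, abs_sub_comm]
    exact (hp _ (inner_mem_Icc y x)).le
  have e2 : |∫ s, Q s ∂(gegenbauerMeasure d) - gegenbauerFunctional hd p| ≤ δ * N := by
    change |_ - ∫ s, p.eval s ∂(gegenbauerMeasure d)| ≤ _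
    rw [← integral_sub (integrable_gegenbauerMeasure hd hQ)
      (integrable_eval_gegenbauerMeasure hd p), ← Real.norm_eq_abs]
    refine norm_integral_le_of_norm_le_const
      ((ae_mem_Icc_gegenbauerMeasure d).mono fun s hs => ?_)
    rw [Real.norm_eq_abs, abs_sub_comm]
    exact (hp _ hs).le
  rw [integral_sphereMeasure_eval hd] at e1
  have e3 : |sphereRatio hd * gegenbauerFunctional hd p -
      sphereRatio hd * ∫ s, Q s ∂(gegenbauerMeasure d)| ≤ sphereRatio hd * (δ * N) := by
    rw [← mul_sub, abs_mul, abs_of_nonneg hR, abs_sub_comm]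
    gcongr
  refine (abs_sub_le _ _ _).trans ((add_le_add e1 e3).trans ?_)
  have : δ * (M + sphereRatio hd * N + 1) = ε := div_mul_cancel₀ _ hden.ne'
  nlinarith

/-- A real function on `[-1,1]` is positive definite on `S^d` if the matrices `Q (xᵢ · xⱼ)` are
positive semidefinite. -/
def IsSpherePosDef (d : ℕ) (Q : ℝ → ℝ) : Prop :=
  ∀ s : Finset (UnitSphere d), (Matrix.of fun x y : s =>
    Q (inner ℝ (x.1 : EuclideanSpace ℝ (Fin (d + 1))) y.1)).PosSemidef

theorem posSemidef_iff_sum_nonneg {ι : Type*} [Fintype ι] {M : Matrix ι ι ℝ}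
    (hM : M.IsHermitian) : M.PosSemidef ↔ ∀ c : ι → ℝ, 0 ≤ ∑ i, ∑ j, c i * c j * M i j := by
  rw [Matrix.posSemidef_iff_dotProduct_mulVec, and_iff_right hM]
  refine forall_congr' fun c => ?_
  simp only [dotProduct, Matrix.mulVec, Finset.mul_sum, star_trivial]
  refine iff_of_eq (congrArg _ (Finset.sum_congr rfl fun i _ => Finset.sum_congr rfl fun j _ => ?_))
  ring

/-- The double integral of a kernel composed with a simple function is a finite double sum. -/
theorem integral_prod_simpleFunc {α β : Type*} [MeasurableSpace α] (μ : Measure α)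
    [IsFiniteMeasure μ] (f : SimpleFunc α β) (F : β → β → ℝ) :
    Integrable (fun z : α × α => F (f z.1) (f z.2)) (μ.prod μ) ∧
      ∫ z, F (f z.1) (f z.2) ∂(μ.prod μ) = ∑ a ∈ f.range, ∑ b ∈ f.range,
        μ.real (f ⁻¹' ({a} : Set β)) * μ.real (f ⁻¹' ({b} : Set β)) * F a b := by
  classical
  have hsum : ∀ z : α × α, F (f z.1) (f z.2) = ∑ a ∈ f.range, ∑ b ∈ f.range, F a b *
        ((f ⁻¹' ({a} : Set β)).indicator (fun _ => (1 : ℝ)) z.1 *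
          (f ⁻¹' ({b} : Set β)).indicator (fun _ => (1 : ℝ)) z.2) := by
    intro z
    rw [Finset.sum_eq_single (f z.1), Finset.sum_eq_single (f z.2)]
    · simp
    · intro b _ hb
      simp [Set.indicator, hb.symm]
    · intro h; exact absurd (SimpleFunc.mem_range_self _ _) h
    · intro a _ ha
      simp [Set.indicator, ha.symm]
    · intro h; exact absurd (SimpleFunc.mem_range_self _ _) h
  have hind : ∀ a, Integrable ((f ⁻¹' ({a} : Set β)).indicator (fun _ => (1 : ℝ))) μ := fun a =>
    (integrable_const 1).indicator (f.measurableSet_fiber a)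
  have hterm : ∀ a b : β, Integrable (fun z : α × α => F a b *
        ((f ⁻¹' ({a} : Set β)).indicator (fun _ => (1 : ℝ)) z.1 *
          (f ⁻¹' ({b} : Set β)).indicator (fun _ => (1 : ℝ)) z.2)) (μ.prod μ) := fun a b =>
    ((hind a).mul_prod (hind b)).const_mul _
  simp only [hsum]
  refine ⟨integrable_finsetSum _ fun a _ => integrable_finsetSum _ fun b _ => hterm a b, ?_⟩
  rw [integral_finsetSum _ fun a _ => integrable_finsetSum _ fun b _ => hterm a b]
  refine Finset.sum_congr rfl fun a _ => ?_
  rw [integral_finsetSum _ fun b _ => hterm a b]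
  refine Finset.sum_congr rfl fun b _ => ?_
  rw [integral_const_mul, integral_prod_mul ((f ⁻¹' ({a} : Set β)).indicator (fun _ => (1 : ℝ)))
      ((f ⁻¹' ({b} : Set β)).indicator (fun _ => (1 : ℝ))),
      integral_indicator_const _ (f.measurableSet_fiber _),
      integral_indicator_const _ (f.measurableSet_fiber _)]
  simp only [smul_eq_mul, mul_one]
  ring

/-- A continuous positive definite kernel on a compact space has a nonnegative double integral. -/
theorem double_integral_nonneg_of_posSemidef {α : Type*} [MetricSpace α] [CompactSpace α]
    [MeasurableSpace α] [BorelSpace α] (μ : Measure α) [IsFiniteMeasure μ] {F : α → α → ℝ}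
    (hF : Continuous (Function.uncurry F))
    (hpd : ∀ s : Finset α, (Matrix.of fun x y : s => F x y).PosSemidef) :
    0 ≤ ∫ z, F z.1 z.2 ∂(μ.prod μ) := by
  rcases isEmpty_or_nonempty α with hα | ⟨⟨y₀⟩⟩
  · simp [Measure.eq_zero_of_isEmpty]
  -- Simple functions approximating the identity turn the double integral into a finite quadratic
  -- form whose weights are the masses of the fibres.
  let f : ℕ → SimpleFunc α α := fun n =>
    SimpleFunc.approxOn id measurable_id Set.univ y₀ (Set.mem_univ _) n
  have hf : ∀ x, Filter.Tendsto (fun n => f n x) Filter.atTop (nhds x) := fun x =>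
    SimpleFunc.tendsto_approxOn measurable_id (Set.mem_univ _) (by simp)
  have hnn : ∀ n, 0 ≤ ∫ z : α × α, F (f n z.1) (f n z.2) ∂(μ.prod μ) := by
    intro n
    rw [(integral_prod_simpleFunc μ (f n) F).2, ← Finset.sum_coe_sort]
    have hP := hpd (f n).range
    refine ((posSemidef_iff_sum_nonneg hP.1).1 hP
      fun a => μ.real ((f n) ⁻¹' ({a.1} : Set α))).trans_eq ?_
    refine Finset.sum_congr rfl fun a _ => ?_
    rw [← Finset.sum_coe_sort (f n).range]
    rfl
  obtain ⟨B, hB⟩ := isCompact_univ.exists_bound_of_continuousOn hF.continuousOn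
  have hlim := tendsto_integral_of_dominated_convergence
    (μ := μ.prod μ) (fun _ => B)
    (F := fun n (z : α × α) => F (f n z.1) (f n z.2)) (f := fun z => F z.1 z.2)
    (fun n => (integral_prod_simpleFunc μ (f n) F).1.aestronglyMeasurable)
    (integrable_const _) (fun n => ae_of_all _ fun z => hB (f n z.1, f n z.2) (Set.mem_univ _))
    (ae_of_all _ fun z => (hF.tendsto z).comp ((hf z.1).prodMk_nhds (hf z.2)))
  exact ge_of_tendsto' hlim hnn

/-- In the double integral of `Q(x·y)` over the sphere the inner integral does not depend on the
pole, so the whole is a positive multiple of the weighted integral of `Q`. -/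
theorem IsSpherePosDef.integral_nonneg (hd : 2 ≤ d) {Q : ℝ → ℝ}
    (hQ : ContinuousOn Q (Set.Icc (-1) 1)) (hpd : IsSpherePosDef d Q) :
    0 ≤ ∫ s, Q s ∂(gegenbauerMeasure d) := by
  have h := double_integral_nonneg_of_posSemidef (sphereMeasure d)
    (F := fun x y => Q (inner ℝ (x : EuclideanSpace ℝ (Fin (d + 1))) y))
    (continuous_comp_inner hQ) hpd
  rw [integral_prod _ ((continuous_comp_inner hQ).integrable_of_hasCompactSupport
    (HasCompactSupport.of_compactSpace _))] at h
  simp only [integral_sphereMeasure_comp_inner hd _ hQ, integral_const, smul_eq_mul] at h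
  exact (mul_nonneg_iff_of_pos_left (sphereRatio_pos hd)).1
    ((mul_nonneg_iff_of_pos_left (sphereMeasure_real_univ_pos d)).1 h)

end SphereMeasure

/-! ### Schoenberg's theorem on `S^d` -/

section Schoenberg

variable {d : ℕ}

theorem posSemidef_gegenbauerSphere (𝕜 : Type*) [RCLike 𝕜] (hd : 2 ≤ d) (k : ℕ) {ι : Type*}
    [Fintype ι] (x : ι → UnitSphere d) : (Matrix.of fun i j => ((gegenbauerSphere d k
      (inner ℝ (x i : EuclideanSpace ℝ (Fin (d + 1))) (x j)) : ℝ) : 𝕜)).PosSemidef := by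
  obtain ⟨T, V, hV⟩ := exists_gram_gegenbauerSphere hd k x
  convert Matrix.posSemidef_conjTranspose_mul_self (Matrix.of fun t i => (V t i : 𝕜)) using 1
  ext i j
  simp [hV, Matrix.mul_apply]

theorem isSpherePosDef_gegenbauerSphere (hd : 2 ≤ d) (k : ℕ) :
    IsSpherePosDef d (gegenbauerSphere d k) := fun s => by
  simpa using posSemidef_gegenbauerSphere ℝ hd k (fun x : s => x.1)

theorem IsSpherePosDef.mul {P Q : ℝ → ℝ} (hP : IsSpherePosDef d P) (hQ : IsSpherePosDef d Q) :
    IsSpherePosDef d fun t => P t * Q t := fun s => (hP s).hadamard (hQ s)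

/-- The Gegenbauer coefficient of a real function on `[-1,1]`. -/
noncomputable def sphereCoeff (d k : ℕ) (Q : ℝ → ℝ) : ℝ :=
  gegenbauerNormalization d k * ∫ s, Q s * gegenbauerSphere d k s ∂(gegenbauerMeasure d)

/-- By Schur's product theorem `Q C_k` is again positive definite, so its integral is nonnegative.
-/
theorem sphereCoeff_nonneg (hd : 2 ≤ d) (k : ℕ) {Q : ℝ → ℝ}
    (hQ : ContinuousOn Q (Set.Icc (-1) 1)) (hpd : IsSpherePosDef d Q) : 0 ≤ sphereCoeff d k Q :=
  mul_nonneg (gegenbauerNormalization_pos hd k).le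
    ((hpd.mul (isSpherePosDef_gegenbauerSphere hd k)).integral_nonneg hd
      (hQ.mul (continuous_gegenbauerSphere d k).continuousOn))

theorem functional_sq_mul_sphereCoeff (hd : 2 ≤ d) (k : ℕ) (Q : ℝ → ℝ) :
    gegenbauerFunctional hd (gegenbauerSpherePoly d k * gegenbauerSpherePoly d k) *
      sphereCoeff d k Q = ∫ s, Q s * gegenbauerSphere d k s ∂(gegenbauerMeasure d) := by
  rw [sphereCoeff, gegenbauerNormalization_eq hd, ← mul_assoc,
    mul_inv_cancel₀ (gegenbauerFunctional_sq_pos hd k).ne', one_mul]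

theorem integrable_mul_eval (hd : 2 ≤ d) {Q : ℝ → ℝ} (hQ : ContinuousOn Q (Set.Icc (-1) 1))
    (p : ℝ[X]) : Integrable (fun s => Q s * p.eval s) (gegenbauerMeasure d) :=
  integrable_gegenbauerMeasure hd (hQ.mul p.continuous.continuousOn)

/-- For `p = C_m`, orthogonality leaves only `k = m`, with equality if `m < N`; otherwise the left
side is 0 and the right side nonnegative. The inequality passes to nonnegative combinations. -/
theorem sum_functional_mul_sphereCoeff_le (hd : 2 ≤ d) {Q : ℝ → ℝ}
    (hQ : ContinuousOn Q (Set.Icc (-1) 1)) (hpd : IsSpherePosDef d Q) (N : ℕ) {p : ℝ[X]}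
    (hp : p ∈ gegenbauerCone (((d : ℝ) - 1) / 2)) :
    ∑ k ∈ Finset.range N, gegenbauerFunctional hd (p * gegenbauerSpherePoly d k) *
      sphereCoeff d k Q ≤ ∫ s, Q s * p.eval s ∂(gegenbauerMeasure d) := by
  induction hp using Submodule.span_induction with
  | mem p hp =>
    obtain ⟨m, rfl⟩ := hp
    have hm := functional_sq_mul_sphereCoeff hd m Q
    have hnn : 0 ≤ ∫ s, Q s * gegenbauerSphere d m s ∂(gegenbauerMeasure d) := by
      rw [← hm]
      exact mul_nonneg (gegenbauerFunctional_sq_pos hd m).le (sphereCoeff_nonneg hd m hQ hpd)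
    have hz : ∀ k, k ≠ m → gegenbauerFunctional hd (gegenbauer (((d : ℝ) - 1) / 2) m *
        gegenbauerSpherePoly d k) * sphereCoeff d k Q = 0 := fun k hk => by
      rw [gegenbauerFunctional_orthogonal hd (Ne.symm hk), zero_mul]
    by_cases hmN : m ∈ Finset.range N
    · rw [Finset.sum_eq_single_of_mem m hmN fun k _ hk => hz k hk]
      exact hm.le
    · rw [Finset.sum_eq_zero fun k hk => hz k fun h => hmN (h ▸ hk)]
      exact hnn
  | zero => simp
  | add p q _ _ hp hq =>
    simp only [add_mul, map_add, Finset.sum_add_distrib, eval_add, mul_add]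
    rw [integral_add (integrable_mul_eval hd hQ p) (integrable_mul_eval hd hQ q)]
    exact add_le_add hp hq
  | smul a p _ hp =>
    have : a • p = C (a : ℝ) * p := by ext n; simp [NNReal.smul_def]
    simp only [this, mul_assoc, gegenbauerFunctional_C_mul, eval_mul, eval_C,
      mul_left_comm _ (a : ℝ), integral_const_mul, ← Finset.mul_sum]
    exact mul_le_mul_of_nonneg_left hp a.2

/-- The normalized densities `(1+s)^n` concentrate at 1, the unique maximum of `1+s`. -/
theorem tendsto_peak_gegenbauerMeasure (hd : 2 ≤ d) {Q : ℝ → ℝ}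
    (hQ : ContinuousOn Q (Set.Icc (-1) 1)) :
    Filter.Tendsto (fun n : ℕ => (∫ s, (1 + s) ^ n ∂(gegenbauerMeasure d))⁻¹ *
      ∫ s, Q s * (1 + s) ^ n ∂(gegenbauerMeasure d)) Filter.atTop (nhds (Q 1)) := by
  have := isFiniteMeasure_gegenbauerMeasure hd
  have h1 : (1 : ℝ) ∈ Set.Icc (-1 : ℝ) 1 := by norm_num
  have h := tendsto_setIntegral_pow_smul_of_unique_maximum_of_isCompact_of_measure_nhdsWithin_pos
    (μ := gegenbauerMeasure d) (s := Set.Icc (-1 : ℝ) 1) (x₀ := 1) (c := fun s => 1 + s) (g := Q)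
    isCompact_Icc (fun u hu h1u => gegenbauerMeasure_pos hd hu h1u) (by fun_prop)
    (fun y hy hne => by have := lt_of_le_of_ne hy.2 hne; linarith)
    (fun y hy => by linarith [hy.1]) (by norm_num) h1
    (integrable_gegenbauerMeasure hd hQ).integrableOn (hQ 1 h1)
  simpa only [restrict_gegenbauerMeasure, smul_eq_mul, mul_comm (Q _)] using h

/-- Test the Bessel-type inequality on the cone with `(1+X)^n`, normalize, and let `n` tend to
infinity. -/
theorem sum_sphereCoeff_le (hd : 2 ≤ d) {Q : ℝ → ℝ}
    (hQ : ContinuousOn Q (Set.Icc (-1) 1)) (hpd : IsSpherePosDef d Q) (N : ℕ) :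
    ∑ k ∈ Finset.range N, sphereCoeff d k Q * gegenbauerSphere d k 1 ≤ Q 1 := by
  have h1 : Filter.Tendsto (fun n : ℕ => ∑ k ∈ Finset.range N, sphereCoeff d k Q *
      ((∫ s, (1 + s) ^ n ∂(gegenbauerMeasure d))⁻¹ *
        ∫ s, gegenbauerSphere d k s * (1 + s) ^ n ∂(gegenbauerMeasure d))) Filter.atTop
      (nhds (∑ k ∈ Finset.range N, sphereCoeff d k Q * gegenbauerSphere d k 1)) :=
    tendsto_finsetSum _ fun k _ => (tendsto_peak_gegenbauerMeasure hd
      (continuous_gegenbauerSphere d k).continuousOn).const_mul _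
  refine le_of_tendsto_of_tendsto' h1 (tendsto_peak_gegenbauerMeasure hd hQ) fun n => ?_
  have h := sum_functional_mul_sphereCoeff_le hd hQ hpd N
    (one_add_X_pow_mem_gegenbauerCone (sphere_index_pos hd) n)
  have hnn : 0 ≤ (∫ s, (1 + s) ^ n ∂(gegenbauerMeasure d))⁻¹ :=
    inv_nonneg.2 (integral_nonneg_of_ae ((ae_mem_Icc_gegenbauerMeasure d).mono fun s hs =>
      pow_nonneg (by linarith [hs.1]) n))
  have h' := mul_le_mul_of_nonneg_left h hnn
  simp only [eval_pow, eval_add, eval_one, eval_X, Finset.mul_sum] at h'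
  refine le_trans (le_of_eq (Finset.sum_congr rfl fun k _ => ?_)) h'
  have : gegenbauerFunctional hd ((1 + X) ^ n * gegenbauerSpherePoly d k) =
      ∫ s, gegenbauerSphere d k s * (1 + s) ^ n ∂(gegenbauerMeasure d) := by
    refine integral_congr_ae (ae_of_all _ fun s => ?_)
    simp [gegenbauerSphere, mul_comm]
  rw [this]
  ring

theorem summable_sphereCoeff (hd : 2 ≤ d) {Q : ℝ → ℝ}
    (hQ : ContinuousOn Q (Set.Icc (-1) 1)) (hpd : IsSpherePosDef d Q) :
    Summable fun k => sphereCoeff d k Q * gegenbauerSphere d k 1 :=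
  summable_of_sum_range_le (fun k => mul_nonneg (sphereCoeff_nonneg hd k hQ hpd)
    (gegenbauerSphere_one_pos hd k).le) (sum_sphereCoeff_le hd hQ hpd)

/-- The Gegenbauer polynomials are complete in `C([-1,1])`. -/
theorem eq_zero_of_integral_gegenbauerSphere_eq_zero (hd : 2 ≤ d) {g : ℝ → ℝ}
    (hg : ContinuousOn g (Set.Icc (-1) 1))
    (h : ∀ k, ∫ s, g s * gegenbauerSphere d k s ∂(gegenbauerMeasure d) = 0) {t : ℝ}
    (ht : t ∈ Set.Icc (-1 : ℝ) 1) : g t = 0 := by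
  have hfin := isFiniteMeasure_gegenbauerMeasure hd
  have hcone : ∀ p ∈ gegenbauerCone (((d : ℝ) - 1) / 2),
      ∫ s, g s * p.eval s ∂(gegenbauerMeasure d) = 0 := by
    intro p hp
    induction hp using Submodule.span_induction with
    | mem p hp =>
      obtain ⟨k, rfl⟩ := hp
      exact h k
    | zero => simp
    | add p q _ _ hp hq =>
      simp only [eval_add, mul_add]
      rw [integral_add (integrable_mul_eval hd hg p) (integrable_mul_eval hd hg q), hp, hq,
        add_zero]
    | smul a p _ hp =>
      have : a • p = C (a : ℝ) * p := by ext n; simp [NNReal.smul_def]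
      simp only [this, eval_mul, eval_C, mul_left_comm _ (a : ℝ), integral_const_mul, hp, mul_zero]
  have hpow : ∀ n, (X : ℝ[X]) ^ n ∈ gegenbauerCone (((d : ℝ) - 1) / 2) := by
    intro n
    induction n with
    | zero => exact Submodule.subset_span ⟨0, by simp [gegenbauer]⟩
    | succ n ih => rw [pow_succ']; exact X_mul_mem_gegenbauerCone (sphere_index_pos hd) ih
  have hpoly : ∀ p : ℝ[X], ∫ s, g s * p.eval s ∂(gegenbauerMeasure d) = 0 := by
    intro p
    induction p using Polynomial.induction_on' with
    | add p q hp hq =>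
      simp only [eval_add, mul_add]
      rw [integral_add (integrable_mul_eval hd hg p) (integrable_mul_eval hd hg q), hp, hq,
        add_zero]
    | monomial n a =>
      simp only [← C_mul_X_pow_eq_monomial, eval_mul, eval_C, mul_left_comm _ a,
        integral_const_mul, hcone _ (hpow n), mul_zero]
  -- As `g` is orthogonal to all polynomials, replacing one factor of `g²` by a Weierstrass
  -- approximant shows that the integral is arbitrarily small.
  have hsq : ∫ s, g s * g s ∂(gegenbauerMeasure d) = 0 := by
    obtain ⟨B, hB⟩ := isCompact_Icc.exists_bound_of_continuousOn hg
    have hB0 : 0 ≤ B := (norm_nonneg _).trans (hB t ht)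
    set N := (gegenbauerMeasure d).real Set.univ
    have hN : 0 ≤ N := measureReal_nonneg
    refine eq_of_abs_sub_le_all fun ε hε => ?_
    have hden : 0 < B * N + 1 := by positivity
    obtain ⟨p, hp⟩ := exists_polynomial_near_of_continuousOn (-1) 1 g hg (ε / (B * N + 1))
      (by positivity)
    rw [sub_zero, ← sub_zero (∫ s, g s * g s ∂(gegenbauerMeasure d)), ← hpoly p,
      ← integral_sub (integrable_gegenbauerMeasure (q := fun s => g s * g s) hd (hg.mul hg)) (integrable_mul_eval hd hg p),
      ← Real.norm_eq_abs]
    refine (norm_integral_le_of_norm_le_const (C := B * (ε / (B * N + 1)))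
      ((ae_mem_Icc_gegenbauerMeasure d).mono fun s hs => ?_)).trans ?_
    · rw [← mul_sub, norm_mul, Real.norm_eq_abs (g s - _), abs_sub_comm]
      exact mul_le_mul (hB s hs) (hp s hs).le (abs_nonneg _) hB0
    · change B * (ε / (B * N + 1)) * N ≤ ε
      rw [mul_div_assoc', div_mul_eq_mul_div, div_le_iff₀ hden]
      nlinarith
  exact mul_self_eq_zero.1 (eq_zero_of_integral_gegenbauerMeasure_eq_zero hd (hg.mul hg)
    (fun s _ => mul_self_nonneg _) hsq ht)

/-- **Schoenberg's theorem**: the Gegenbauer expansion of a continuous positive definite function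
on `S^d` converges to the function. -/
theorem hasSum_sphereCoeff (hd : 2 ≤ d) {Q : ℝ → ℝ}
    (hQ : ContinuousOn Q (Set.Icc (-1) 1)) (hpd : IsSpherePosDef d Q) {t : ℝ}
    (ht : t ∈ Set.Icc (-1 : ℝ) 1) :
    HasSum (fun k => sphereCoeff d k Q * gegenbauerSphere d k t) (Q t) := by
  have hfin := isFiniteMeasure_gegenbauerMeasure hd
  have hsum := summable_sphereCoeff hd hQ hpd
  have hbound : ∀ k, ∀ s ∈ Set.Icc (-1 : ℝ) 1, ‖sphereCoeff d k Q * gegenbauerSphere d k s‖ ≤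
      sphereCoeff d k Q * gegenbauerSphere d k 1 := fun k s hs => by
    rw [norm_mul, Real.norm_of_nonneg (sphereCoeff_nonneg hd k hQ hpd)]
    exact mul_le_mul_of_nonneg_left (abs_gegenbauerSphere_le hd k hs)
      (sphereCoeff_nonneg hd k hQ hpd)
  set F : ℝ → ℝ := fun s => ∑' k, sphereCoeff d k Q * gegenbauerSphere d k s with hF
  have hFs : ∀ s ∈ Set.Icc (-1 : ℝ) 1,
      HasSum (fun k => sphereCoeff d k Q * gegenbauerSphere d k s) (F s) := fun s hs =>
    (Summable.of_norm_bounded hsum fun k => hbound k s hs).hasSum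
  have hFc : ContinuousOn F (Set.Icc (-1) 1) := continuousOn_tsum
    (fun k => ((continuous_gegenbauerSphere d k).const_mul _).continuousOn) hsum hbound
  -- The sum `F` of the series is continuous; termwise integration shows that it has the
  -- coefficients of `Q`, so completeness gives `F = Q`.
  have hcoef : ∀ m, ∫ s, F s * gegenbauerSphere d m s ∂(gegenbauerMeasure d) =
      ∫ s, Q s * gegenbauerSphere d m s ∂(gegenbauerMeasure d) := by
    intro m
    have h1 := hasSum_integral_of_dominated_convergence (μ := gegenbauerMeasure d)
      (F := fun k s => sphereCoeff d k Q * gegenbauerSphere d k s * gegenbauerSphere d m s)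
      (f := fun s => F s * gegenbauerSphere d m s)
      (fun k _ => sphereCoeff d k Q * gegenbauerSphere d k 1 * gegenbauerSphere d m 1)
      (fun k => (((continuous_gegenbauerSphere d k).const_mul _).mul
        (continuous_gegenbauerSphere d m)).aestronglyMeasurable)
      (fun k => (ae_mem_Icc_gegenbauerMeasure d).mono fun s hs => by
        rw [norm_mul]
        exact mul_le_mul (hbound k s hs) (abs_gegenbauerSphere_le hd m hs) (norm_nonneg _)
          ((norm_nonneg _).trans (hbound k s hs)))
      (ae_of_all _ fun s => hsum.mul_right _) (integrable_const _)
      ((ae_mem_Icc_gegenbauerMeasure d).mono fun s hs => (hFs s hs).mul_right _)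
    have hk : ∀ k, ∫ s, sphereCoeff d k Q * gegenbauerSphere d k s * gegenbauerSphere d m s
        ∂(gegenbauerMeasure d) = sphereCoeff d k Q *
          gegenbauerFunctional hd (gegenbauerSpherePoly d k * gegenbauerSpherePoly d m) := by
      intro k
      simp only [mul_assoc, integral_const_mul]
      congr 1
      refine integral_congr_ae (ae_of_all _ fun s => ?_)
      simp [gegenbauerSphere]
    simp only [hk] at h1
    have h2 := hasSum_single (f := fun k => sphereCoeff d k Q *
      gegenbauerFunctional hd (gegenbauerSpherePoly d k * gegenbauerSpherePoly d m)) m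
      (fun k hkm => by rw [gegenbauerFunctional_orthogonal hd hkm, mul_zero])
    rw [h1.unique h2, mul_comm, functional_sq_mul_sphereCoeff]
  have hzero := eq_zero_of_integral_gegenbauerSphere_eq_zero hd (g := fun s => F s - Q s)
    (hFc.sub hQ) (fun m => by
      simp only [sub_mul]
      exact (integral_sub (integrable_mul_eval hd hFc (gegenbauerSpherePoly d m))
        (integrable_mul_eval hd hQ (gegenbauerSpherePoly d m))).trans (sub_eq_zero.2 (hcoef m))) ht
  rw [← sub_eq_zero.1 hzero]
  exact hFs t ht

end Schoenberg

/-! ### Complex quadratic forms and positive semidefinite matrices -/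

section ComplexPosSemidef

variable {ι : Type*} [Fintype ι]

/-- The form `∑ cᵢ c̄ⱼ Mᵢⱼ`. -/
noncomputable def kernelForm (M : Matrix ι ι ℂ) (c : ι → ℂ) : ℂ :=
  ∑ i, ∑ j, c i * starRingEnd ℂ (c j) * M i j

theorem kernelForm_eq_dotProduct (M : Matrix ι ι ℂ) (c : ι → ℂ) :
    kernelForm M c = c ⬝ᵥ M.mulVec (star c) := by
  simp only [kernelForm, dotProduct, Matrix.mulVec, Finset.mul_sum]
  refine Finset.sum_congr rfl fun i _ => Finset.sum_congr rfl fun j _ => ?_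
  simp only [Pi.star_apply, starRingEnd_apply]
  ring

theorem Matrix.PosSemidef.kernelForm_nonneg {M : Matrix ι ι ℂ} (hM : M.PosSemidef) (c : ι → ℂ) :
    0 ≤ kernelForm M c := by
  have := hM.dotProduct_mulVec_nonneg (star c)
  rwa [star_star, ← kernelForm_eq_dotProduct] at this

/-- Over `ℂ` a matrix whose quadratic form takes only real values is Hermitian, so symmetry need not
be assumed. -/
theorem posSemidef_of_kernelForm_nonneg {M : Matrix ι ι ℂ} (h : ∀ c, 0 ≤ kernelForm M c) :
    M.PosSemidef := by
  classical
  have h' : ∀ y : ι → ℂ, 0 ≤ star y ⬝ᵥ M.mulVec y := fun y => by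
    have := h (star y)
    rwa [kernelForm_eq_dotProduct, star_star] at this
  refine Matrix.PosSemidef.of_dotProduct_mulVec_nonneg ?_ h'
  rw [← Matrix.isSymmetric_toEuclideanLin_iff, LinearMap.isSymmetric_iff_inner_map_self_real]
  intro v
  have := h' v.ofLp
  have e : inner ℂ (M.toEuclideanLin v) v = star (star v.ofLp ⬝ᵥ M.mulVec v.ofLp) := by
    rw [EuclideanSpace.inner_eq_star_dotProduct, ← Matrix.star_dotProduct, dotProduct_comm]
    rfl
  rw [e]
  have hs : star (star v.ofLp ⬝ᵥ M.mulVec v.ofLp) = star v.ofLp ⬝ᵥ M.mulVec v.ofLp :=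
    (IsSelfAdjoint.of_nonneg this).star_eq
  rw [hs]
  exact hs

theorem posSemidef_ofReal {M : Matrix ι ι ℝ} (hM : M.PosSemidef) :
    (Matrix.of fun i j => (M i j : ℂ)).PosSemidef := by
  refine posSemidef_of_kernelForm_nonneg fun c => ?_
  have hre := (posSemidef_iff_sum_nonneg hM.1).1 hM fun i => (c i).re
  have him := (posSemidef_iff_sum_nonneg hM.1).1 hM fun i => (c i).im
  have hsymm : ∀ i j, M i j = M j i := fun i j => by simpa using (hM.1.apply i j).symm
  have hcross : ∑ i, ∑ j, (c i).im * (c j).re * M i j = ∑ i, ∑ j, (c i).re * (c j).im * M i j := by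
    rw [Finset.sum_comm]
    refine Finset.sum_congr rfl fun i _ => Finset.sum_congr rfl fun j _ => ?_
    rw [hsymm j i]; ring
  have : kernelForm (Matrix.of fun i j => (M i j : ℂ)) c =
      ((∑ i, ∑ j, (c i).re * (c j).re * M i j + ∑ i, ∑ j, (c i).im * (c j).im * M i j : ℝ) : ℂ) := by
    apply Complex.ext
    · simp only [kernelForm, Complex.re_sum, Complex.ofReal_re, ← Finset.sum_add_distrib]
      refine Finset.sum_congr rfl fun i _ => Finset.sum_congr rfl fun j _ => ?_
      simp
      ring
    · rw [Complex.ofReal_im, ← sub_eq_zero.2 hcross]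
      simp only [kernelForm, Complex.im_sum, ← Finset.sum_sub_distrib]
      refine Finset.sum_congr rfl fun i _ => Finset.sum_congr rfl fun j _ => ?_
      simp
      ring
  rw [this]
  exact_mod_cast add_nonneg hre him

/-- The definition tests distinct points only; a family with repetitions gives a submatrix, with
repeated indices, of the matrix of its distinct points. -/
theorem posSemidef_of_isPosDefKernel {X : Type*} {K : X → X → ℂ} (hK : IsPosDefKernel K)
    (x : ι → X) : (Matrix.of fun i j => K (x i) (x j)).PosSemidef := by
  classical
  let s : Finset X := Finset.univ.image x
  let e := s.equivFin
  have hs : (Matrix.of fun a b : Fin s.card => K (e.symm a) (e.symm b)).PosSemidef :=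
    posSemidef_of_kernelForm_nonneg fun c => hK _ (fun a => (e.symm a : X))
      (Subtype.val_injective.comp e.symm.injective) c
  convert hs.submatrix (fun i => e ⟨x i, Finset.mem_image_of_mem x (Finset.mem_univ i)⟩) using 1
  ext i j
  simp

theorem isStrictPosDefKernel_form_pos {X : Type*} {K : X → X → ℂ} (hK : IsStrictPosDefKernel K)
    {x : ι → X} (hx : Function.Injective x) {c : ι → ℂ} (hc : c ≠ 0) :
    0 < kernelForm (Matrix.of fun i j => K (x i) (x j)) c := by
  let e := Fintype.equivFin ι
  have hc' : c ∘ e.symm ≠ 0 := fun h => hc (by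
    ext i
    simpa using congrFun h (e i))
  have := hK _ (x ∘ e.symm) (hx.comp e.symm.injective) _ hc'
  refine this.trans_eq ?_
  rw [kernelForm, ← e.symm.sum_comp]
  refine Finset.sum_congr rfl fun i _ => ?_
  rw [← e.symm.sum_comp]
  rfl

end ComplexPosSemidef

/-! ### Points on a great circle -/

section GreatCircle

variable {d : ℕ}

/-- The point `cos θ e + sin θ e'` of `S^d`, where `e` and `e'` are the first and the last basis
vectors. -/
noncomputable def circlePoint (hd : 2 ≤ d) (θ : ℝ) : UnitSphere d :=
  ⟨Real.cos θ • EuclideanSpace.single 0 1 + Real.sin θ • EuclideanSpace.single (Fin.last d) 1, by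
    have h0 : Fin.last d ≠ 0 := by simp [Fin.ext_iff]; lia
    rw [mem_sphere_zero_iff_norm, ← sq_eq_sq₀ (norm_nonneg _) zero_le_one, one_pow,
      ← real_inner_self_eq_norm_sq]
    simp only [inner_add_left, inner_add_right, real_inner_smul_left, real_inner_smul_right,
      EuclideanSpace.inner_single_left]
    simp [h0, h0.symm]
    nlinarith [Real.sin_sq_add_cos_sq θ]⟩

theorem inner_circlePoint (hd : 2 ≤ d) (θ φ : ℝ) :
    inner ℝ (circlePoint hd θ : EuclideanSpace ℝ (Fin (d + 1))) (circlePoint hd φ) =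
      Real.cos (θ - φ) := by
  have h0 : Fin.last d ≠ 0 := by simp [Fin.ext_iff]; lia
  simp only [circlePoint, inner_add_left, inner_add_right, real_inner_smul_left,
    real_inner_smul_right, EuclideanSpace.inner_single_left]
  simp [Real.cos_sub, h0, h0.symm]
  ring

end GreatCircle

/-! ### Gegenbauer expansion of kernels on `G × S^d` -/

section GroupKernel

theorem isotropicKernel_apply {G : Type*} [Group G] {d : ℕ} (f : G → ℝ → ℂ) (z w : G × UnitSphere d) :
    isotropicKernel d f z w =
      f (z.1⁻¹ * w.1) (inner ℝ (z.2 : EuclideanSpace ℝ (Fin (d + 1))) w.2) := by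
  rw [isotropicKernel, cos_half_sphereDist]

theorem gegenbauerCoeff_eq {G : Type*} {d : ℕ} (hd : 2 ≤ d) (k : ℕ) (f : G → ℝ → ℂ) (u : G) :
    gegenbauerCoeff d k f u = (gegenbauerNormalization d k : ℂ) *
      ∫ s, f u s * (gegenbauerSphere d k s : ℂ) ∂(gegenbauerMeasure d) := by
  rw [gegenbauerCoeff, integral_gegenbauerMeasure hd]
  congr 1
  refine intervalIntegral.integral_congr fun s _ => ?_
  simp only [Complex.real_smul]
  ring

/-- The function `t ↦ ∑ cᵢ c̄ⱼ f (uᵢ⁻¹ uⱼ, t)`. -/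
noncomputable def sliceForm {G : Type*} [Group G] {ι : Type*} [Fintype ι] (f : G → ℝ → ℂ)
    (u : ι → G) (c : ι → ℂ) (t : ℝ) : ℂ :=
  kernelForm (Matrix.of fun i j => f ((u i)⁻¹ * u j) t) c

variable {G : Type*} [Group G] [TopologicalSpace G] {d : ℕ} {f : G → ℝ → ℂ}

theorem IsIsotropicPartPD.posSemidef (hf : IsIsotropicPartPD d f) {ι : Type*} [Fintype ι]
    (u : ι → G) (x : ι → UnitSphere d) : (Matrix.of fun i j => f ((u i)⁻¹ * u j)
      (inner ℝ (x i : EuclideanSpace ℝ (Fin (d + 1))) (x j))).PosSemidef := by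
  simpa only [isotropicKernel_apply] using
    posSemidef_of_isPosDefKernel hf.2 (fun i => (u i, x i))

theorem IsIsotropicPartPD.continuousOn (hf : IsIsotropicPartPD d f) (u : G) :
    ContinuousOn (f u) (Set.Icc (-1) 1) :=
  hf.1.comp (f := fun t : ℝ => (u, t)) (by fun_prop) fun t ht => ⟨Set.mem_univ _, ht⟩

/-- Hermitian symmetry of the matrix at `(u,x)` and `(v,y)`, where `x` and `y` on a great circle are
chosen with `x·y = t`. -/
theorem IsIsotropicPartPD.conj_apply (hd : 2 ≤ d) (hf : IsIsotropicPartPD d f) (u v : G) {t : ℝ}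
    (ht : t ∈ Set.Icc (-1 : ℝ) 1) :
    starRingEnd ℂ (f (u⁻¹ * v) t) = f (v⁻¹ * u) t := by
  have hM := hf.posSemidef ![u, v] ![circlePoint hd (Real.arccos t), circlePoint hd 0]
  have := hM.1.apply 1 0
  simp only [Matrix.of_apply, Matrix.cons_val_zero, Matrix.cons_val_one, inner_circlePoint,
    sub_zero, zero_sub, Real.cos_neg, Real.cos_arccos ht.1 ht.2] at this
  exact this

variable {ι : Type*} [Fintype ι]

theorem IsIsotropicPartPD.sliceForm_eq_ofReal (hd : 2 ≤ d) (hf : IsIsotropicPartPD d f) (u : ι → G)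
    (c : ι → ℂ) {t : ℝ} (ht : t ∈ Set.Icc (-1 : ℝ) 1) :
    sliceForm f u c t = ((sliceForm f u c t).re : ℂ) := by
  refine (Complex.conj_eq_iff_re.1 ?_).symm
  simp only [sliceForm, kernelForm, map_sum, map_mul, Complex.conj_conj, Matrix.of_apply,
    hf.conj_apply hd _ _ ht]
  rw [Finset.sum_comm]
  refine Finset.sum_congr rfl fun i _ => Finset.sum_congr rfl fun j _ => ?_
  ring

theorem IsIsotropicPartPD.continuousOn_sliceForm (hf : IsIsotropicPartPD d f) (u : ι → G)
    (c : ι → ℂ) : ContinuousOn (sliceForm f u c) (Set.Icc (-1) 1) :=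
  continuousOn_finsetSum _ fun _ _ => continuousOn_finsetSum _ fun _ _ =>
    continuousOn_const.mul (hf.continuousOn _)

/-- Test the kernel on all pairs `(u_i, x)` with product weights `b_x c_i`. This reduces the group
variable to scalar functions on the sphere, to which Schoenberg's theorem applies. -/
theorem IsIsotropicPartPD.isSpherePosDef_sliceForm (hf : IsIsotropicPartPD d f) (u : ι → G)
    (c : ι → ℂ) : IsSpherePosDef d fun t => (sliceForm f u c t).re := by
  intro s
  refine (posSemidef_iff_sum_nonneg ?_).2 fun b => ?_
  · ext x y
    simp [real_inner_comm]
  have h := (hf.posSemidef (fun z : s × ι => u z.2) (fun z => z.1.1)).kernelForm_nonneg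
    fun z => (b z.1 : ℂ) * c z.2
  have h' := (Complex.nonneg_iff.1 h).1
  refine h'.trans_eq ?_
  simp only [kernelForm, sliceForm, Fintype.sum_prod_type, Complex.re_sum, Matrix.of_apply,
    Finset.mul_sum]
  refine Finset.sum_congr rfl fun x _ => ?_
  rw [Finset.sum_comm]
  refine Finset.sum_congr rfl fun y _ => Finset.sum_congr rfl fun i _ =>
    Finset.sum_congr rfl fun j _ => ?_
  rw [← Complex.re_ofReal_mul]
  congr 1
  simp only [map_mul, Complex.conj_ofReal]
  push_cast
  ring

theorem IsIsotropicPartPD.kernelForm_gegenbauerCoeff (hd : 2 ≤ d) (hf : IsIsotropicPartPD d f)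
    (k : ℕ) (u : ι → G) (c : ι → ℂ) :
    kernelForm (Matrix.of fun i j => gegenbauerCoeff d k f ((u i)⁻¹ * u j)) c =
      (sphereCoeff d k fun t => (sliceForm f u c t).re : ℂ) := by
  have hint : ∀ i j, Integrable (fun s => c i * starRingEnd ℂ (c j) *
      (f ((u i)⁻¹ * u j) s * (gegenbauerSphere d k s : ℂ))) (gegenbauerMeasure d) := fun i j =>
    (integrable_gegenbauerMeasure hd ((hf.continuousOn _).mul
      (Complex.continuous_ofReal.comp (continuous_gegenbauerSphere d k)).continuousOn)).const_mul _
  rw [sphereCoeff, Complex.ofReal_mul, ← integral_complex_ofReal]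
  have h1 : ∫ s, (((sliceForm f u c s).re * gegenbauerSphere d k s : ℝ) : ℂ)
      ∂(gegenbauerMeasure d) = ∫ s, ∑ i, ∑ j, c i * starRingEnd ℂ (c j) *
        (f ((u i)⁻¹ * u j) s * (gegenbauerSphere d k s : ℂ)) ∂(gegenbauerMeasure d) := by
    refine integral_gegenbauerMeasure_congr fun s hs => ?_
    rw [Complex.ofReal_mul, ← hf.sliceForm_eq_ofReal hd u c hs]
    simp only [sliceForm, kernelForm, Finset.sum_mul, Matrix.of_apply, mul_assoc]
  rw [h1, integral_finsetSum _ fun i _ => integrable_finsetSum _ fun j _ => hint i j]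
  simp only [integral_finsetSum _ fun j _ => hint _ j, integral_const_mul, Finset.mul_sum,
    kernelForm, Matrix.of_apply, gegenbauerCoeff_eq hd]
  refine Finset.sum_congr rfl fun i _ => Finset.sum_congr rfl fun j _ => ?_
  ring

theorem IsIsotropicPartPD.posSemidef_gegenbauerCoeff (hd : 2 ≤ d) (hf : IsIsotropicPartPD d f)
    (k : ℕ) (u : ι → G) :
    (Matrix.of fun i j => gegenbauerCoeff d k f ((u i)⁻¹ * u j)).PosSemidef := by
  refine posSemidef_of_kernelForm_nonneg fun c => ?_
  rw [hf.kernelForm_gegenbauerCoeff hd]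
  have hc : ContinuousOn (fun t => (sliceForm f u c t).re) (Set.Icc (-1) 1) :=
    Complex.continuous_re.comp_continuousOn (hf.continuousOn_sliceForm u c)
  exact_mod_cast sphereCoeff_nonneg hd k hc (hf.isSpherePosDef_sliceForm u c)

theorem IsIsotropicPartPD.hasSum_sliceForm (hd : 2 ≤ d) (hf : IsIsotropicPartPD d f)
    (u : ι → G) (c : ι → ℂ) {t : ℝ} (ht : t ∈ Set.Icc (-1 : ℝ) 1) :
    HasSum (fun k => kernelForm (Matrix.of fun i j => gegenbauerCoeff d k f ((u i)⁻¹ * u j)) c *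
      (gegenbauerSphere d k t : ℂ)) (sliceForm f u c t) := by
  have hc : ContinuousOn (fun t => (sliceForm f u c t).re) (Set.Icc (-1) 1) :=
    Complex.continuous_re.comp_continuousOn (hf.continuousOn_sliceForm u c)
  have h := Complex.hasSum_ofReal.2 (hasSum_sphereCoeff hd hc (hf.isSpherePosDef_sliceForm u c) ht)
  rw [← hf.sliceForm_eq_ofReal hd u c ht] at h
  simpa only [hf.kernelForm_gegenbauerCoeff hd, Complex.ofReal_mul] using h

theorem kernelForm_fin_two (M : Matrix (Fin 2) (Fin 2) ℂ) (a b : ℂ) :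
    kernelForm M ![a, b] = a * starRingEnd ℂ a * M 0 0 + a * starRingEnd ℂ b * M 0 1 +
      (b * starRingEnd ℂ a * M 1 0 + b * starRingEnd ℂ b * M 1 1) := by
  simp [kernelForm, Fin.sum_univ_two]

theorem kernelForm_polarization (M : Matrix (Fin 2) (Fin 2) ℂ) :
    kernelForm M ![1, 1] - kernelForm M ![1, -1] +
      Complex.I * (kernelForm M ![1, Complex.I] - kernelForm M ![1, -Complex.I]) = 4 * M 0 1 := by
  simp only [kernelForm_fin_two, map_one, map_neg, Complex.conj_I]
  linear_combination (-2 * M 0 1 + 2 * M 1 0) * Complex.I_sq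

/-- The Gegenbauer expansion of the isotropic part of a positive definite kernel. -/
theorem IsIsotropicPartPD.hasSum (hd : 2 ≤ d) (hf : IsIsotropicPartPD d f) (u : G) {t : ℝ}
    (ht : t ∈ Set.Icc (-1 : ℝ) 1) :
    HasSum (fun k => gegenbauerCoeff d k f u * (gegenbauerSphere d k t : ℂ)) (f u t) := by
  -- The entry `(0,1)` of the matrix of the family `1, u` is `f(u,t)`; polarization recovers it from
  -- four slice forms.
  have h := fun c => hf.hasSum_sliceForm hd ![1, u] c ht
  have key := (((h ![1, 1]).sub (h ![1, -1])).add
    (((h ![1, Complex.I]).sub (h ![1, -Complex.I])).mul_left Complex.I)).mul_left (4⁻¹ : ℂ)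
  simp only [← sub_mul, ← mul_assoc Complex.I, ← add_mul, sliceForm, kernelForm_polarization]
    at key
  have h4 : ∀ a : ℂ, 4⁻¹ * (4 * a) = a := fun a => by ring
  simpa [mul_assoc, h4] using key

end GroupKernel

/-! ### Double expansion of the product kernel -/

section ProductExpansion

variable {G : Type*} [Group G] [TopologicalSpace G] {d : ℕ} {f g : G → ℝ → ℂ}
  {ι : Type*} [Fintype ι]

/-- The matrix `a_k(f; uᵢ⁻¹ uⱼ) a_l(g; uᵢ⁻¹ uⱼ)`. -/
noncomputable def coeffMatrix {G : Type*} [Group G] {ι : Type*} (d : ℕ) (f g : G → ℝ → ℂ)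
    (k l : ℕ) (u : ι → G) : Matrix ι ι ℂ :=
  Matrix.of fun i j =>
    gegenbauerCoeff d k f ((u i)⁻¹ * u j) * gegenbauerCoeff d l g ((u i)⁻¹ * u j)

/-- The matrix `C_k(xᵢ · xⱼ) C_l(xᵢ · xⱼ)`. -/
noncomputable def zonalMatrix {ι : Type*} {d : ℕ} (k l : ℕ) (x : ι → UnitSphere d) :
    Matrix ι ι ℂ :=
  Matrix.of fun i j =>
    (((gegenbauerSpherePoly d k * gegenbauerSpherePoly d l).eval
      (inner ℝ (x i : EuclideanSpace ℝ (Fin (d + 1))) (x j)) : ℝ) : ℂ)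

theorem posSemidef_coeffMatrix (hd : 2 ≤ d) (hf : IsIsotropicPartPD d f)
    (hg : IsIsotropicPartPD d g) (k l : ℕ) (u : ι → G) : (coeffMatrix d f g k l u).PosSemidef :=
  (hf.posSemidef_gegenbauerCoeff hd k u).hadamard (hg.posSemidef_gegenbauerCoeff hd l u)

theorem posSemidef_zonalMatrix (hd : 2 ≤ d) (k l : ℕ) (x : ι → UnitSphere d) :
    (zonalMatrix k l x).PosSemidef := by
  have h : zonalMatrix k l x = Matrix.hadamard
      (Matrix.of fun i j => ((gegenbauerSphere d k
        (inner ℝ (x i : EuclideanSpace ℝ (Fin (d + 1))) (x j)) : ℝ) : ℂ))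
      (Matrix.of fun i j => ((gegenbauerSphere d l
        (inner ℝ (x i : EuclideanSpace ℝ (Fin (d + 1))) (x j)) : ℝ) : ℂ)) := by
    ext i j
    simp [zonalMatrix, gegenbauerSphere]
  rw [h]
  exact (posSemidef_gegenbauerSphere ℂ hd k x).hadamard (posSemidef_gegenbauerSphere ℂ hd l x)

theorem mem_positiveSumSet {G : Type*} [Group G] {d : ℕ} {f g : G → ℝ → ℂ} {p : ℕ}
    {u : Fin p → G} {c : Fin p → ℂ} {m : ℕ} : m ∈ positiveSumSet d f g u c ↔
      ∃ k l : ℕ, m = k + l ∧ 0 < kernelForm (coeffMatrix d f g k l u) c := by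
  simp only [positiveSumSet, kernelForm_eq_dotProduct, coeffMatrix, Set.mem_ofPred_eq]

theorem hasSum_mul_complex {a b : ℕ → ℂ} {s t : ℂ} (ha : HasSum a s) (hb : HasSum b t) :
    HasSum (fun kl : ℕ × ℕ => a kl.1 * b kl.2) (s * t) :=
  ha.mul hb (summable_mul_of_summable_norm ha.summable.norm hb.summable.norm)

theorem hasSum_product_apply (hd : 2 ≤ d) (hf : IsIsotropicPartPD d f)
    (hg : IsIsotropicPartPD d g) (u : G) {t : ℝ} (ht : t ∈ Set.Icc (-1 : ℝ) 1) :
    HasSum (fun kl : ℕ × ℕ => gegenbauerCoeff d kl.1 f u * gegenbauerCoeff d kl.2 g u *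
      (((gegenbauerSpherePoly d kl.1 * gegenbauerSpherePoly d kl.2).eval t : ℝ) : ℂ))
      (f u t * g u t) := by
  have h1 := hf.hasSum hd u ht
  have h2 := hg.hasSum hd u ht
  have h := hasSum_mul_complex h1 h2
  refine (congrArg (fun F : ℕ × ℕ → ℂ => HasSum F (f u t * g u t)) (funext fun kl => ?_)).mp h
  rw [eval_mul, Complex.ofReal_mul, gegenbauerSphere, gegenbauerSphere]
  ring

/-- The expansion of the quadratic forms of a product kernel. -/
theorem hasSum_product_form (hd : 2 ≤ d) (hf : IsIsotropicPartPD d f)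
    (hg : IsIsotropicPartPD d g) (z : ι → G × UnitSphere d) (c : ι → ℂ) :
    HasSum (fun kl : ℕ × ℕ => kernelForm (Matrix.hadamard
        (coeffMatrix d f g kl.1 kl.2 fun i => (z i).1) (zonalMatrix kl.1 kl.2 fun i => (z i).2)) c)
      (kernelForm (Matrix.of fun i j => isotropicKernel d (fun u t => f u t * g u t) (z i) (z j))
        c) := by
  simp only [kernelForm]
  refine hasSum_sum fun i _ => hasSum_sum fun j _ => HasSum.mul_left _ ?_
  simp only [Matrix.of_apply, isotropicKernel_apply, Matrix.hadamard_apply, coeffMatrix,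
    zonalMatrix]
  exact hasSum_product_apply hd hf hg _ (inner_mem_Icc _ _)

theorem kernelForm_product_nonneg (hd : 2 ≤ d) (hf : IsIsotropicPartPD d f)
    (hg : IsIsotropicPartPD d g) (k l : ℕ) (z : ι → G × UnitSphere d) (c : ι → ℂ) :
    0 ≤ kernelForm (Matrix.hadamard (coeffMatrix d f g k l fun i => (z i).1)
      (zonalMatrix k l fun i => (z i).2)) c :=
  ((posSemidef_coeffMatrix hd hf hg k l _).hadamard
    (posSemidef_zonalMatrix hd k l _)).kernelForm_nonneg c

end ProductExpansion

/-! ### Alternating sums over a regular polygon -/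

section AlternatingPolygon

/-- A geometric sum whose ratio `exp(2πi (r+e)/(2r))` is a `2r`-th root of unity, different from 1
by the hypothesis on `e`. -/
theorem sum_neg_one_pow_mul_exp {r : ℕ} {e : ℤ} (he : ¬ (2 * r : ℤ) ∣ (r + e)) :
    ∑ j ∈ Finset.range (2 * r), (-1 : ℂ) ^ j * Complex.exp (Real.pi * Complex.I * e / r) ^ j = 0 := by
  rcases Nat.eq_zero_or_pos r with rfl | hr
  · simp
  have hr' : (r : ℂ) ≠ 0 := by exact_mod_cast hr.ne'
  have hω : (-1 : ℂ) * Complex.exp (Real.pi * Complex.I * e / r) =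
      Complex.exp (2 * Real.pi * Complex.I * ((r + e : ℤ) / (2 * r))) := by
    rw [← Complex.exp_pi_mul_I, ← Complex.exp_add]
    congr 1
    push_cast
    field_simp
  simp only [← mul_pow, hω]
  have h1 : Complex.exp (2 * Real.pi * Complex.I * ((r + e : ℤ) / (2 * r))) ≠ 1 := by
    intro h
    obtain ⟨n, hn⟩ := Complex.exp_eq_one_iff.1 h
    refine he ⟨n, ?_⟩
    have hpi : (2 * Real.pi * Complex.I : ℂ) ≠ 0 := Complex.two_pi_I_ne_zero
    rw [mul_comm (n : ℂ)] at hn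
    have hn' := mul_left_cancel₀ hpi hn
    rw [div_eq_iff (by simpa using hr')] at hn'
    have : ((r + e : ℤ) : ℂ) = ((n * (2 * r) : ℤ) : ℂ) := by rw [hn']; push_cast; ring
    rw [mul_comm]
    exact_mod_cast this
  rw [geom_sum_eq h1, ← Complex.exp_nat_mul]
  have : ((2 * r : ℕ) : ℂ) * (2 * Real.pi * Complex.I * ((r + e : ℤ) / (2 * r))) =
      ((r + e : ℤ) : ℂ) * (2 * Real.pi * Complex.I) := by
    push_cast
    field_simp
  rw [this, Complex.exp_int_mul_two_pi_mul_I, sub_self, zero_div]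

/-- Alternating sums over the regular `2r`-gon kill the powers of the cosine of low degree, or of
the wrong parity. -/
theorem sum_neg_one_pow_mul_cos_pow {r m : ℕ} (h : m < r ∨ Odd (m + r)) (α : ℝ) :
    ∑ j ∈ Finset.range (2 * r), (-1 : ℝ) ^ j * Real.cos (Real.pi * j / r - α) ^ m = 0 := by
  have hcos : ∀ j : ℕ, ((-1 : ℂ) ^ j * (Real.cos (Real.pi * j / r - α) : ℂ) ^ m) =
      ∑ i ∈ Finset.range (m + 1), (2 ^ m : ℂ)⁻¹ * (m.choose i : ℂ) *
        Complex.exp (-(α * Complex.I * ((2 * i - m : ℤ) : ℂ))) *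
        ((-1 : ℂ) ^ j * Complex.exp (Real.pi * Complex.I * ((2 * i - m : ℤ) : ℂ) / r) ^ j) := by
    intro j
    rw [Complex.ofReal_cos, Complex.cos, div_pow, add_pow, Finset.sum_div, Finset.mul_sum]
    refine Finset.sum_congr rfl fun i hi => ?_
    have him : i ≤ m := Nat.lt_succ_iff.1 (Finset.mem_range.1 hi)
    have e1 : Complex.exp (((Real.pi * j / r - α : ℝ) : ℂ) * Complex.I) ^ i *
        Complex.exp (-((Real.pi * j / r - α : ℝ) : ℂ) * Complex.I) ^ (m - i) =
        Complex.exp (-(α * Complex.I * ((2 * i - m : ℤ) : ℂ))) *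
          Complex.exp (Real.pi * Complex.I * ((2 * i - m : ℤ) : ℂ) / r) ^ j := by
      rw [← Complex.exp_nat_mul, ← Complex.exp_nat_mul, ← Complex.exp_nat_mul, ← Complex.exp_add,
        ← Complex.exp_add]
      congr 1
      push_cast [Nat.cast_sub him]
      ring
    rw [e1]
    field_simp
  have key : ∑ j ∈ Finset.range (2 * r),
      ((-1 : ℂ) ^ j * (Real.cos (Real.pi * j / r - α) : ℂ) ^ m) = 0 := by
    simp only [hcos]
    rw [Finset.sum_comm]
    refine Finset.sum_eq_zero fun i hi => ?_
    have him : i ≤ m := Nat.lt_succ_iff.1 (Finset.mem_range.1 hi)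
    rw [← Finset.mul_sum, sum_neg_one_pow_mul_exp, mul_zero]
    -- The frequencies are `e = 2i - m` with `|e| ≤ m`. If `m < r` then `0 < r+e < 2r`; if `m+r` is
    -- odd then so is `r+e`. Neither allows divisibility by `2r`.
    rintro ⟨n, hn⟩
    rcases h with h | ⟨q, hq⟩
    · have h0 : 0 < (r : ℤ) := by lia
      have h1 : 0 < n := by
        by_contra hcon
        have : (2 * r : ℤ) * n ≤ 0 := mul_nonpos_of_nonneg_of_nonpos (by lia) (by lia)
        lia
      have h2 : n < 1 := by
        by_contra hcon
        have : (2 * r : ℤ) * 1 ≤ (2 * r : ℤ) * n := mul_le_mul_of_nonneg_left (by lia) (by lia)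
        lia
      lia
    · have : (2 * r : ℤ) * n = 2 * (r * n) := by ring
      lia
  exact_mod_cast key

theorem sum_neg_one_pow_mul_eval_cos {r : ℕ} {p : ℝ[X]}
    (hp : ∀ m, p.coeff m ≠ 0 → m < r ∨ Odd (m + r)) (α : ℝ) :
    ∑ j ∈ Finset.range (2 * r), (-1 : ℝ) ^ j * p.eval (Real.cos (Real.pi * j / r - α)) = 0 := by
  simp only [eval_eq_sum, Polynomial.sum, Finset.mul_sum]
  rw [Finset.sum_comm]
  refine Finset.sum_eq_zero fun m hm => ?_
  simp only [mul_left_comm _ (p.coeff m)]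
  rw [← Finset.mul_sum, sum_neg_one_pow_mul_cos_pow (hp m (mem_support_iff.1 hm)), mul_zero]

theorem gegenbauerSpherePoly_mul_coeff {d k l r : ℕ} (h : k + l < r ∨ Odd (k + l + r)) (m : ℕ)
    (hm : (gegenbauerSpherePoly d k * gegenbauerSpherePoly d l).coeff m ≠ 0) :
    m < r ∨ Odd (m + r) := by
  rw [coeff_mul] at hm
  obtain ⟨⟨a, b⟩, hab, hne⟩ := Finset.exists_ne_zero_of_sum_ne_zero hm
  rw [Finset.HasAntidiagonal.mem_antidiagonal] at hab
  have ha := mt (gegenbauer_coeff_eq_zero (((d : ℝ) - 1) / 2) k a) (left_ne_zero_of_mul hne)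
  have hb := mt (gegenbauer_coeff_eq_zero (((d : ℝ) - 1) / 2) l b) (right_ne_zero_of_mul hne)
  simp only at hab
  grind

end AlternatingPolygon

/-! ### Strict positivity gives infinitely many even and odd sums -/

section Necessity

variable {G : Type*} [Group G] [TopologicalSpace G] {d : ℕ} {f g : G → ℝ → ℂ}

theorem circlePoint_injective (hd : 2 ≤ d) {r : ℕ} :
    Function.Injective fun j : Fin (2 * r) => circlePoint hd (Real.pi * (j : ℕ) / r) := by
  intro i j hij
  have h : inner ℝ (circlePoint hd (Real.pi * (i : ℕ) / r) : EuclideanSpace ℝ (Fin (d + 1)))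
      (circlePoint hd (Real.pi * (j : ℕ) / r)) = 1 := by
    simp only at hij
    rw [hij, inner_circlePoint, sub_self, Real.cos_zero]
  rw [inner_circlePoint, Real.cos_eq_one_iff] at h
  obtain ⟨n, hn⟩ := h
  have hr : 0 < r := by have := i.2; lia
  have hr' : (r : ℝ) ≠ 0 := by exact_mod_cast hr.ne'
  have h2 : (2 * r : ℤ) * n = (i : ℕ) - (j : ℕ) := by
    field_simp at hn
    have h3 : ((2 * r * n : ℤ) : ℝ) = (((i : ℕ) - (j : ℕ) : ℤ) : ℝ) := by
      push_cast
      linarith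
    exact_mod_cast h3
  have hi := i.2
  have hj := j.2
  have hn0 : n = 0 := by
    by_contra hn0
    rcases lt_or_gt_of_ne hn0 with h | h
    · have : (2 * r : ℤ) * n ≤ (2 * r : ℤ) * (-1) := mul_le_mul_of_nonneg_left (by lia) (by lia)
      rw [h2] at this
      omega
    · have : (2 * r : ℤ) * 1 ≤ (2 * r : ℤ) * n := mul_le_mul_of_nonneg_left (by lia) (by lia)
      rw [h2] at this
      omega
  rw [hn0, mul_zero] at h2
  exact Fin.ext (by lia)

/-- Alternating weights on a `2r`-gon annihilate every term with `k+l < r` or with `k+l` of the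
wrong parity, while the total is positive; some other term must survive. -/
theorem exists_mem_positiveSumSet (hd : 2 ≤ d) (hf : IsIsotropicPartPD d f)
    (hg : IsIsotropicPartPD d g) (hfg : IsIsotropicPartSPD d fun u t => f u t * g u t) {p : ℕ}
    {u : Fin p → G} (hu : Function.Injective u) {c : Fin p → ℂ} (hc : c ≠ 0) {r : ℕ} (hr : 0 < r) :
    ∃ m ∈ positiveSumSet d f g u c, r ≤ m ∧ Even (m + r) := by
  let z : Fin p × Fin (2 * r) → G × UnitSphere d := fun a =>
    (u a.1, circlePoint hd (Real.pi * (a.2 : ℕ) / r))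
  let b : Fin p × Fin (2 * r) → ℂ := fun a => c a.1 * (-1) ^ (a.2 : ℕ)
  have hz : Function.Injective z := by
    rintro ⟨μ, i⟩ ⟨ν, j⟩ h
    simp only [z, Prod.mk.injEq] at h
    exact Prod.ext (hu h.1) (circlePoint_injective hd h.2)
  have hb : b ≠ 0 := by
    obtain ⟨μ, hμ⟩ := Function.ne_iff.1 hc
    refine Function.ne_iff.2 ⟨(μ, ⟨0, by lia⟩), ?_⟩
    simpa [b] using hμ
  have hpos := isStrictPosDefKernel_form_pos hfg.2 hz hb
  have hsum := hasSum_product_form hd hf hg z b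
  obtain ⟨⟨k, l⟩, hkl⟩ : ∃ kl : ℕ × ℕ, kernelForm (Matrix.hadamard
      (coeffMatrix d f g kl.1 kl.2 fun i => (z i).1)
      (zonalMatrix kl.1 kl.2 fun i => (z i).2)) b ≠ 0 := by
    by_contra! hcon
    simp only [hcon] at hsum
    exact hpos.ne' (hsum.unique hasSum_zero)
  -- Points and weights are products, so the form of the Hadamard product splits into a group factor
  -- and this polygon factor.
  set Φ : ℝ := ∑ i : Fin (2 * r), ∑ j : Fin (2 * r), (-1) ^ (i : ℕ) * (-1) ^ (j : ℕ) *
    (gegenbauerSpherePoly d k * gegenbauerSpherePoly d l).eval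
      (Real.cos (Real.pi * (i : ℕ) / r - Real.pi * (j : ℕ) / r)) with hΦ
  have hfactor : kernelForm (Matrix.hadamard (coeffMatrix d f g k l fun i => (z i).1)
      (zonalMatrix k l fun i => (z i).2)) b = kernelForm (coeffMatrix d f g k l u) c * Φ := by
    simp only [kernelForm, Fintype.sum_prod_type, hΦ, Complex.ofReal_sum, Finset.sum_mul,
      Finset.mul_sum]
    rw [Finset.sum_comm]
    refine Finset.sum_congr rfl fun i _ => ?_
    symm
    rw [Finset.sum_comm]
    refine Finset.sum_congr rfl fun μ _ => ?_
    rw [Finset.sum_comm]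
    refine Finset.sum_congr rfl fun ν _ => Finset.sum_congr rfl fun j _ => ?_
    simp only [b, z, Matrix.hadamard_apply, coeffMatrix, zonalMatrix, Matrix.of_apply, map_mul,
      map_pow, map_neg, map_one, inner_circlePoint]
    push_cast
    ring
  simp only [hfactor] at hkl
  have hΦ0 : Φ ≠ 0 := fun h => hkl (by rw [h, Complex.ofReal_zero, mul_zero])
  refine ⟨k + l, mem_positiveSumSet.2 ⟨k, l, rfl, lt_of_le_of_ne
    ((posSemidef_coeffMatrix hd hf hg k l u).kernelForm_nonneg c)
    (Ne.symm (left_ne_zero_of_mul hkl))⟩, ?_⟩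
  by_contra hcon
  have hpar : k + l < r ∨ Odd (k + l + r) := by
    rcases lt_or_ge (k + l) r with h | h
    · exact Or.inl h
    · exact Or.inr (Nat.not_even_iff_odd.1 fun h' => hcon ⟨h, h'⟩)
  refine hΦ0 ?_
  rw [hΦ]
  rw [Finset.sum_comm]
  refine Finset.sum_eq_zero fun j _ => ?_
  have := sum_neg_one_pow_mul_eval_cos (gegenbauerSpherePoly_mul_coeff (d := d) hpar)
    (Real.pi * (j : ℕ) / r)
  rw [← Fin.sum_univ_eq_sum_range (fun i => (-1 : ℝ) ^ i *
    (gegenbauerSpherePoly d k * gegenbauerSpherePoly d l).eval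
      (Real.cos (Real.pi * i / r - Real.pi * (j : ℕ) / r)))] at this
  simp only [mul_right_comm _ ((-1 : ℝ) ^ (j : ℕ))]
  rw [← Finset.sum_mul, this, zero_mul]

theorem infinite_positiveSumSet_of_strict (hd : 2 ≤ d) (hf : IsIsotropicPartPD d f)
    (hg : IsIsotropicPartPD d g) (hfg : IsIsotropicPartSPD d fun u t => f u t * g u t) {p : ℕ}
    {u : Fin p → G} (hu : Function.Injective u) {c : Fin p → ℂ} (hc : c ≠ 0) :
    {m ∈ positiveSumSet d f g u c | Even m}.Infinite ∧
      {m ∈ positiveSumSet d f g u c | Odd m}.Infinite := by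
  constructor
  · refine Set.infinite_of_forall_exists_gt fun n => ?_
    obtain ⟨m, hm, hle, hev⟩ := exists_mem_positiveSumSet hd hf hg hfg hu hc
      -- An even `r > n`, positive also for `n = 0`; the odd case takes `2n+1`.
      (show 0 < 2 * n + 2 by lia)
    exact ⟨m, ⟨hm, by grind⟩, by lia⟩
  · refine Set.infinite_of_forall_exists_gt fun n => ?_
    obtain ⟨m, hm, hle, hev⟩ := exists_mem_positiveSumSet hd hf hg hfg hu hc
      (show 0 < 2 * n + 1 by lia)
    exact ⟨m, ⟨hm, by grind⟩, by lia⟩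

end Necessity

/-! ### Diagonal dominance of zonal matrices of large degree -/

section Dominance

variable {ι : Type*} [Fintype ι]

theorem posSemidef_of_diagonal_dominant [DecidableEq ι] {M : Matrix ι ι ℝ} (hM : M.IsHermitian)
    {s δ : ℝ} (hδ : 0 ≤ δ) (hdiag : ∀ i, s ≤ M i i) (hoff : ∀ i j, i ≠ j → |M i j| ≤ δ)
    (hs : Fintype.card ι * δ ≤ s) : M.PosSemidef := by
  refine (posSemidef_iff_sum_nonneg hM).2 fun c => ?_
  -- The loss `δ` is charged on the diagonal too, which makes the total exactly `(s - card·δ) ∑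
  -- cᵢ²`.
  have hterm : ∀ i j, (if i = j then s * c i ^ 2 else 0) - δ / 2 * (c i ^ 2 + c j ^ 2) ≤
      c i * c j * M i j := by
    intro i j
    split_ifs with hij
    · subst hij
      nlinarith [mul_le_mul_of_nonneg_left (hdiag i) (sq_nonneg (c i)),
        mul_nonneg hδ (sq_nonneg (c i))]
    · have h1 : |c i * c j * M i j| ≤ δ * |c i * c j| := by
        rw [abs_mul, mul_comm]
        exact mul_le_mul_of_nonneg_right (hoff i j hij) (abs_nonneg _)
      have h2 : |c i * c j| ≤ (c i ^ 2 + c j ^ 2) / 2 := by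
        rw [abs_le]
        constructor <;> nlinarith [sq_nonneg (c i + c j), sq_nonneg (c i - c j)]
      have := (abs_le.1 (h1.trans (mul_le_mul_of_nonneg_left h2 hδ))).1
      linarith
  refine le_trans ?_ (Finset.sum_le_sum fun i _ => Finset.sum_le_sum fun j _ => hterm i j)
  simp only [Finset.sum_sub_distrib, Finset.sum_ite_eq, Finset.mem_univ, if_true,
    ← Finset.mul_sum, Finset.sum_add_distrib, Finset.sum_const, Finset.card_univ, nsmul_eq_mul]
  have h0 : 0 ≤ ∑ i, c i ^ 2 := Finset.sum_nonneg fun i _ => sq_nonneg _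
  nlinarith [mul_le_mul_of_nonneg_right hs h0]

variable {d : ℕ}

theorem exists_abs_gegenbauerSphere_le (hd : 2 ≤ d) {T : Set ℝ} (hT : T.Finite)
    (hT1 : T ⊆ Set.Ioo (-1) 1) {δ : ℝ} (hδ : 0 < δ) :
    ∃ M, ∀ k ≥ M, ∀ t ∈ T, |gegenbauerSphere d k t| ≤ δ * gegenbauerSphere d k 1 := by
  have h : ∀ t ∈ T, ∀ᶠ k in Filter.atTop,
      |gegenbauerSphere d k t| ≤ δ * gegenbauerSphere d k 1 := fun t ht => by
    filter_upwards [(tendsto_gegenbauerSphere_ratio hd (hT1 ht)).eventually_lt_const hδ] with k hk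
    exact ((div_lt_iff₀ (gegenbauerSphere_one_pos hd k)).1 hk).le
  exact Filter.eventually_atTop.1 ((Filter.eventually_all_finite hT).2 h)

/-- For large `k + l`, one half of the normalized indicator of a point can be subtracted from
`C_k(yᵢ · yⱼ) C_l(yᵢ · yⱼ)`, as long as no two of the points are antipodal. -/
theorem exists_posSemidef_sub_indicator [DecidableEq (UnitSphere d)] (hd : 2 ≤ d)
    (s : Finset (UnitSphere d)) (hs : ∀ x ∈ s, ∀ y ∈ s, x ≠ y →
      inner ℝ (x : EuclideanSpace ℝ (Fin (d + 1))) y ∈ Set.Ioo (-1 : ℝ) 1) (x₀ : UnitSphere d) :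
    ∃ M, ∀ k l, M ≤ k + l → (Matrix.of fun x y : s =>
      (gegenbauerSpherePoly d k * gegenbauerSpherePoly d l).eval
        (inner ℝ (x.1 : EuclideanSpace ℝ (Fin (d + 1))) y.1) -
      gegenbauerSphere d k 1 * gegenbauerSphere d l 1 / 2 *
        ((if x.1 = x₀ then 1 else 0) * (if y.1 = x₀ then 1 else 0))).PosSemidef := by
  let T : Set ℝ := (fun p : UnitSphere d × UnitSphere d =>
    (inner ℝ (p.1 : EuclideanSpace ℝ (Fin (d + 1))) p.2 : ℝ)) ''
      ((s ×ˢ s : Finset (UnitSphere d × UnitSphere d)) ∩ {p | p.1 ≠ p.2})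
  have hT : T.Finite := ((Finset.finite_toSet _).inter_of_left _).image _
  have hT1 : T ⊆ Set.Ioo (-1) 1 := by
    rintro _ ⟨p, ⟨hp, hne⟩, rfl⟩
    rw [Finset.mem_coe, Finset.mem_product] at hp
    exact hs _ hp.1 _ hp.2 hne
  obtain ⟨M, hM⟩ := exists_abs_gegenbauerSphere_le (d := d) hd hT hT1
    (show (0 : ℝ) < 1 / (2 * (Fintype.card s + 1)) by positivity)
  -- If `k+l ≥ 2M`, one of `k`, `l` is at least `M`; its factor is small off the diagonal and the
  -- other is bounded by its value at 1. After the subtraction the diagonal is still at least half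
  -- of `C_k(1) C_l(1)`.
  refine ⟨2 * M, fun k l hkl => ?_⟩
  have hk := gegenbauerSphere_one_pos hd k
  have hl := gegenbauerSphere_one_pos hd l
  refine posSemidef_of_diagonal_dominant (s := gegenbauerSphere d k 1 * gegenbauerSphere d l 1 / 2)
    (δ := 1 / (2 * (Fintype.card s + 1)) * (gegenbauerSphere d k 1 * gegenbauerSphere d l 1))
    ?_ (by positivity) ?_ ?_ ?_
  · ext x y
    simp only [Matrix.conjTranspose_apply, Matrix.of_apply, star_trivial]
    rw [real_inner_comm, mul_comm (ite (y.1 = x₀) _ _)]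
  · intro x
    have h1 : inner ℝ (x.1 : EuclideanSpace ℝ (Fin (d + 1))) x.1 = 1 := by
      rw [real_inner_self_eq_norm_sq]; simp
    simp only [Matrix.of_apply, h1, eval_mul]
    have := mul_pos hk hl
    change _ ≤ gegenbauerSphere d k 1 * gegenbauerSphere d l 1 - _
    split_ifs <;> linarith
  · intro x y hxy
    have hxy' : x.1 ≠ y.1 := fun h => hxy (Subtype.ext h)
    have h0 : ((if x.1 = x₀ then 1 else 0) * (if y.1 = x₀ then 1 else 0) : ℝ) = 0 := by
      split_ifs with h1 h2
      · exact absurd (h1.trans h2.symm) hxy'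
      all_goals simp
    simp only [Matrix.of_apply, h0, mul_zero, sub_zero, eval_mul, abs_mul]
    set t := (inner ℝ (x.1 : EuclideanSpace ℝ (Fin (d + 1))) y.1 : ℝ)
    have ht : t ∈ T := ⟨(x.1, y.1), ⟨by simp, hxy'⟩, rfl⟩
    have htI := Set.Ioo_subset_Icc_self (hT1 ht)
    change |gegenbauerSphere d k t| * |gegenbauerSphere d l t| ≤ _
    rcases le_or_gt M k with h | h
    · calc _ ≤ (1 / (2 * (Fintype.card s + 1)) * gegenbauerSphere d k 1) *
            gegenbauerSphere d l 1 :=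
          mul_le_mul (hM k h t ht) (abs_gegenbauerSphere_le hd l htI) (abs_nonneg _) (by positivity)
        _ = _ := by ring
    · calc _ ≤ gegenbauerSphere d k 1 *
            (1 / (2 * (Fintype.card s + 1)) * gegenbauerSphere d l 1) :=
          mul_le_mul (abs_gegenbauerSphere_le hd k htI) (hM l (by lia) t ht) (abs_nonneg _) hk.le
        _ = _ := by ring
  · have hP := mul_pos hk hl
    have h2 : (Fintype.card s : ℝ) * (1 / (2 * (Fintype.card s + 1))) ≤ 1 / 2 := by
      rw [mul_one_div, div_le_div_iff₀ (by positivity) (by positivity)]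
      linarith
    calc _ = (Fintype.card s : ℝ) * (1 / (2 * (Fintype.card s + 1))) *
          (gegenbauerSphere d k 1 * gegenbauerSphere d l 1) := by ring
      _ ≤ 1 / 2 * (gegenbauerSphere d k 1 * gegenbauerSphere d l 1) :=
          mul_le_mul_of_nonneg_right h2 hP.le
      _ = _ := by ring

end Dominance

/-! ### Antipodal representatives -/

section Antipodal

variable {d : ℕ}

/-- A choice of a point in each antipodal pair, with the corresponding signs. -/
theorem exists_antipodal_representative (d : ℕ) : ∃ (ρ : UnitSphere d → UnitSphere d)
    (ε : UnitSphere d → ℝ), (∀ x, ε x = 1 ∨ ε x = -1) ∧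
      (∀ x : UnitSphere d, (x : EuclideanSpace ℝ (Fin (d + 1))) = ε x • (ρ x : EuclideanSpace ℝ (Fin (d + 1)))) ∧
      ∀ x y, ρ x ≠ ρ y →
        inner ℝ (ρ x : EuclideanSpace ℝ (Fin (d + 1))) (ρ y) ∈ Set.Ioo (-1 : ℝ) 1 := by
  let S : Setoid (UnitSphere d) := ⟨fun x y => x = y ∨ x = -y, fun x => Or.inl rfl, by
    rintro x y (h | h)
    · exact Or.inl h.symm
    · exact Or.inr (by rw [h, neg_neg]), by
    rintro x y z (rfl | rfl) (rfl | rfl)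
    · exact Or.inl rfl
    · exact Or.inr rfl
    · exact Or.inr rfl
    · exact Or.inl (neg_neg _)⟩
  let ρ : UnitSphere d → UnitSphere d := fun x => (Quotient.mk S x).out
  have hρ : ∀ x, x = ρ x ∨ x = -ρ x := fun x => S.symm (Quotient.mk_out (s := S) x)
  have hρρ : ∀ x y, S.r (ρ x) (ρ y) → ρ x = ρ y := fun x y h => by
    have h1 : Quotient.mk S (ρ x) = Quotient.mk S (ρ y) := Quotient.sound h
    simp only [ρ, Quotient.out_eq] at h1
    simp only [ρ, h1]
  have hsign : ∀ x : UnitSphere d, ∃ e : ℝ, (e = 1 ∨ e = -1) ∧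
      (x : EuclideanSpace ℝ (Fin (d + 1))) = e • (ρ x : EuclideanSpace ℝ (Fin (d + 1))) := by
    intro x
    rcases hρ x with h | h
    · exact ⟨1, Or.inl rfl, by rw [one_smul, ← h]⟩
    · exact ⟨-1, Or.inr rfl, by rw [neg_one_smul]; exact congrArg Subtype.val h⟩
  choose ε hε hx using hsign
  refine ⟨ρ, ε, hε, hx, fun x y hne => ?_⟩
  have hn : ∀ z : UnitSphere d, ‖(z : EuclideanSpace ℝ (Fin (d + 1)))‖ = 1 := fun z => by simp
  have hI := inner_mem_Icc (ρ x) (ρ y)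
  refine ⟨lt_of_le_of_ne hI.1 fun h => hne (hρρ x y (Or.inr (Subtype.ext ?_))),
    lt_of_le_of_ne hI.2 fun h => hne (Subtype.ext ?_)⟩
  · have := (inner_eq_one_iff_of_norm_eq_one (𝕜 := ℝ) (hn (ρ x))
      (y := -(ρ y : EuclideanSpace ℝ (Fin (d + 1)))) (by rw [norm_neg]; exact hn _)).1
      (by rw [inner_neg_right, ← h, neg_neg])
    simpa using this
  · exact (inner_eq_one_iff_of_norm_eq_one (𝕜 := ℝ) (hn (ρ x)) (hn (ρ y))).1 h

end Antipodal

/-! ### Infinitely many even and odd sums give strict positivity -/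

section Sufficiency

variable {G : Type*} [Group G] {d : ℕ} {f g : G → ℝ → ℂ}
  {ι κ : Type*} [Fintype ι] [Fintype κ]

theorem kernelForm_submatrix [DecidableEq κ] (M : Matrix κ κ ℂ) (σ : ι → κ) (b : ι → ℂ) :
    kernelForm (M.submatrix σ σ) b = kernelForm M fun μ => ∑ i with σ i = μ, b i := by
  simp only [kernelForm, Matrix.submatrix_apply]
  rw [← Finset.sum_fiberwise Finset.univ σ]
  refine Finset.sum_congr rfl fun μ _ => ?_
  simp only [Finset.sum_mul]
  simp only [map_sum, Finset.sum_mul, Finset.mul_sum]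
  rw [Finset.sum_comm (s := Finset.univ (α := κ))]
  refine Finset.sum_congr rfl fun i hi => ?_
  rw [← Finset.sum_fiberwise Finset.univ σ]
  refine Finset.sum_congr rfl fun ν _ => Finset.sum_congr rfl fun j hj => ?_
  rw [(Finset.mem_filter.1 hi).2, (Finset.mem_filter.1 hj).2]

/-- `C_k C_l` has the parity of `k+l`, so a sign change of a point comes out as the power `k+l` of
the sign. -/
theorem zonalMatrix_smul {ι : Type*} {x y : ι → UnitSphere d} {ε : ι → ℝ} (hε : ∀ i, ε i = 1 ∨ ε i = -1)
    (hx : ∀ i, (x i : EuclideanSpace ℝ (Fin (d + 1))) =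
      ε i • (y i : EuclideanSpace ℝ (Fin (d + 1)))) (k l : ℕ) (i j : ι) :
    zonalMatrix k l x i j = (ε i : ℂ) ^ (k + l) * (ε j : ℂ) ^ (k + l) * zonalMatrix k l y i j := by
  have h : ∀ (k : ℕ) (t : ℝ), gegenbauerSphere d k (ε j * (ε i * t)) =
      ε i ^ k * ε j ^ k * gegenbauerSphere d k t := by
    intro k t
    rcases hε i with h1 | h1 <;> rcases hε j with h2 | h2 <;>
      simp [h1, h2, gegenbauerSphere_neg, ← mul_pow]
  simp only [zonalMatrix, Matrix.of_apply, hx, real_inner_smul_left, real_inner_smul_right,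
    eval_mul]
  change ((gegenbauerSphere d k _ * gegenbauerSphere d l _ : ℝ) : ℂ) =
    _ * ((gegenbauerSphere d k _ * gegenbauerSphere d l _ : ℝ) : ℂ)
  rw [h, h]
  push_cast
  ring

theorem kernelForm_hadamard_zonalMatrix_smul (A : Matrix ι ι ℂ) {x y : ι → UnitSphere d}
    {ε : ι → ℝ} (hε : ∀ i, ε i = 1 ∨ ε i = -1)
    (hx : ∀ i, (x i : EuclideanSpace ℝ (Fin (d + 1))) =
      ε i • (y i : EuclideanSpace ℝ (Fin (d + 1)))) (k l : ℕ) (c : ι → ℂ) :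
    kernelForm (Matrix.hadamard A (zonalMatrix k l x)) c =
      kernelForm (Matrix.hadamard A (zonalMatrix k l y)) fun i => c i * (ε i : ℂ) ^ (k + l) := by
  refine Finset.sum_congr rfl fun i _ => Finset.sum_congr rfl fun j _ => ?_
  simp only [Matrix.hadamard_apply, zonalMatrix_smul hε hx, map_mul, map_pow, Complex.conj_ofReal]
  ring

/-- If a Hadamard product with a zonal matrix of large degree has an isotropic vector, then so has
the matrix itself, namely the restriction of the vector to a fibre. -/
theorem exists_kernelForm_restrict_eq_zero [DecidableEq (UnitSphere d)] (hd : 2 ≤ d)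
    {y : ι → UnitSphere d} (hy : ∀ i j, y i ≠ y j →
      inner ℝ (y i : EuclideanSpace ℝ (Fin (d + 1))) (y j) ∈ Set.Ioo (-1 : ℝ) 1)
    (x₀ : UnitSphere d) : ∃ M, ∀ k l, M ≤ k + l → ∀ (A : Matrix ι ι ℂ), A.PosSemidef →
      ∀ c : ι → ℂ, kernelForm (Matrix.hadamard A (zonalMatrix k l y)) c = 0 →
        kernelForm A (fun i => if y i = x₀ then c i else 0) = 0 := by
  obtain ⟨M, hM⟩ := exists_posSemidef_sub_indicator hd (Finset.univ.image y) (by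
    intro a ha b hb hab
    obtain ⟨i, -, rfl⟩ := Finset.mem_image.1 ha
    obtain ⟨j, -, rfl⟩ := Finset.mem_image.1 hb
    exact hy i j hab) x₀
  refine ⟨M, fun k l hkl A hA c h0 => ?_⟩
  have hD := (posSemidef_ofReal (hM k l hkl)).submatrix
    fun i => (⟨y i, Finset.mem_image_of_mem y (Finset.mem_univ i)⟩ : Finset.univ.image y)
  have hP : 0 < gegenbauerSphere d k 1 * gegenbauerSphere d l 1 / 2 := by
    have := gegenbauerSphere_one_pos hd k
    have := gegenbauerSphere_one_pos hd l
    positivity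
  set P := gegenbauerSphere d k 1 * gegenbauerSphere d l 1 / 2
  have h1 := (hA.hadamard hD).kernelForm_nonneg c
  have h2 := hA.kernelForm_nonneg (fun i => if y i = x₀ then c i else 0)
  -- The form is that of a Hadamard product of positive semidefinite matrices plus `P` times the
  -- restricted form; both are nonnegative, so a zero sum kills each.
  have hsplit : kernelForm (Matrix.hadamard A (zonalMatrix k l y)) c = kernelForm (Matrix.hadamard A
      ((Matrix.of fun a b : Finset.univ.image y => (((Matrix.of fun x y : Finset.univ.image y =>
      (gegenbauerSpherePoly d k * gegenbauerSpherePoly d l).eval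
        (inner ℝ (x.1 : EuclideanSpace ℝ (Fin (d + 1))) y.1) -
      P * ((if x.1 = x₀ then 1 else 0) * (if y.1 = x₀ then 1 else 0))) a b : ℝ) : ℂ)).submatrix
      (fun i => ⟨y i, Finset.mem_image_of_mem y (Finset.mem_univ i)⟩)
      (fun i => ⟨y i, Finset.mem_image_of_mem y (Finset.mem_univ i)⟩))) c +
      P * kernelForm A (fun i => if y i = x₀ then c i else 0) := by
    simp only [kernelForm, Finset.mul_sum, ← Finset.sum_add_distrib]
    refine Finset.sum_congr rfl fun i _ => Finset.sum_congr rfl fun j _ => ?_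
    simp only [Matrix.hadamard_apply, zonalMatrix, Matrix.of_apply, Matrix.submatrix_apply]
    split_ifs
    all_goals simp
    ring
  rw [h0] at hsplit
  have h3 : (0 : ℂ) ≤ (P : ℂ) * kernelForm A (fun i => if y i = x₀ then c i else 0) :=
    mul_nonneg (by exact_mod_cast hP.le) h2
  have h4 := ((add_eq_zero_iff_of_nonneg h1 h3).1 hsplit.symm).2
  exact (mul_eq_zero.1 h4).resolve_left (by exact_mod_cast hP.ne')

theorem exists_factor_through_fin {H : Type*} [DecidableEq H] (u : ι → H) (i₀ : ι) :
    ∃ (p : ℕ) (_ : 1 ≤ p) (U : Fin p → H) (σ : ι → Fin p), Function.Injective U ∧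
      (∀ i, U (σ i) = u i) := by
  let e := (Finset.univ.image u).equivFin
  refine ⟨_, Finset.card_pos.2 ⟨u i₀, Finset.mem_image_of_mem u (Finset.mem_univ _)⟩,
    fun a => (e.symm a : H), fun i => e ⟨u i, Finset.mem_image_of_mem u (Finset.mem_univ i)⟩,
    Subtype.val_injective.comp e.symm.injective, fun i => ?_⟩
  simp

variable [TopologicalSpace G]

theorem isStrictPosDefKernel_of_infinite (hd : 2 ≤ d) (hf : IsIsotropicPartPD d f)
    (hg : IsIsotropicPartPD d g)
    (h : ∀ p : ℕ, 1 ≤ p → ∀ u : Fin p → G, Function.Injective u → ∀ c : Fin p → ℂ, c ≠ 0 →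
        {m ∈ positiveSumSet d f g u c | Even m}.Infinite ∧
          {m ∈ positiveSumSet d f g u c | Odd m}.Infinite) :
    IsStrictPosDefKernel (isotropicKernel d fun u t => f u t * g u t) := by
  classical
  intro n z hz c hc
  have hsum := hasSum_product_form hd hf hg z c
  have hterm := fun kl : ℕ × ℕ => kernelForm_product_nonneg hd hf hg kl.1 kl.2 z c
  change 0 < kernelForm (Matrix.of fun i j => isotropicKernel d (fun u t => f u t * g u t)
    (z i) (z j)) c
  refine lt_of_le_of_ne (hsum.nonneg hterm) fun h0 => ?_
  rw [← h0] at hsum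
  have hzero : ∀ k l : ℕ, kernelForm (Matrix.hadamard (coeffMatrix d f g k l fun i => (z i).1)
      (zonalMatrix k l fun i => (z i).2)) c = 0 := fun k l =>
    congrFun ((hasSum_zero_iff_of_nonneg hterm).1 hsum) (k, l)
  obtain ⟨i₀, hi₀⟩ := Function.ne_iff.1 hc
  obtain ⟨ρ, ε, hε, hρ, hinner⟩ := exists_antipodal_representative d
  obtain ⟨M, hM⟩ := exists_kernelForm_restrict_eq_zero (y := fun i => ρ (z i).2) hd
    (fun i j => hinner _ _) (ρ (z i₀).2)
  obtain ⟨p, hp, U, σ, hU, hσ⟩ := exists_factor_through_fin (fun i => (z i).1) i₀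
  -- The coefficients over the antipodal pair of the point `i₀`, twisted by `ε^q` and added up over
  -- equal group elements.
  let v : ℕ → Fin p → ℂ := fun q μ => ∑ i with σ i = μ,
    if ρ (z i).2 = ρ (z i₀).2 then c i * (ε (z i).2 : ℂ) ^ q else 0
  have hform : ∀ k l, M ≤ k + l → kernelForm (coeffMatrix d f g k l U) (v (k + l)) = 0 := by
    intro k l hkl
    have h1 := hzero k l
    rw [kernelForm_hadamard_zonalMatrix_smul _ (fun i => hε (z i).2) (fun i => hρ (z i).2)] at h1
    have h2 := hM k l hkl _ (posSemidef_coeffMatrix hd hf hg k l _) _ h1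
    have h3 : (coeffMatrix d f g k l fun i => (z i).1) =
        (coeffMatrix d f g k l U).submatrix σ σ := by
      ext i j
      simp only [coeffMatrix, Matrix.of_apply, Matrix.submatrix_apply, hσ]
    rwa [h3, kernelForm_submatrix] at h2
  -- Signs have square 1, so only `v 0` and `v 1` matter; the even and the odd part of the
  -- hypothesis are applied to them respectively.
  have hv : ∀ q m, Even (m + q) → v m = v q := by
    intro q m hmq
    have : ∀ i, (ε (z i).2 : ℂ) ^ m = (ε (z i).2 : ℂ) ^ q := by
      intro i
      rcases hε (z i).2 with h1 | h1 <;> rw [h1]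
      · simp
      · rcases Nat.even_or_odd m with hm | hm
        · have hq : Even q := by grind
          simp [hm.neg_one_pow, hq.neg_one_pow]
        · have hq : Odd q := by grind
          simp [hm.neg_one_pow, hq.neg_one_pow]
    simp only [v, this]
  have hcontra : ∀ q m, M < m → Even (m + q) → m ∈ positiveSumSet d f g U (v q) → False := by
    intro q m hMm hmq hm
    obtain ⟨k, l, rfl, hpos⟩ := mem_positiveSumSet.1 hm
    rw [← hv q _ hmq, hform k l hMm.le] at hpos
    exact lt_irrefl _ hpos
  have hv0 : v 0 = 0 := by
    by_contra hne
    obtain ⟨m, ⟨hm, hev⟩, hMm⟩ := (h p hp U hU _ hne).1.exists_gt M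
    exact hcontra 0 m hMm (by simpa using hev) hm
  have hv1 : v 1 = 0 := by
    by_contra hne
    obtain ⟨m, ⟨hm, hodd⟩, hMm⟩ := (h p hp U hU _ hne).2.exists_gt M
    exact hcontra 1 m hMm hodd.add_one hm
  -- The only other point that can lie over the same group element and the same antipodal pair has
  -- the opposite sign, and `1 + ε ε'` then vanishes.
  have hkey : v 0 (σ i₀) + ε (z i₀).2 * v 1 (σ i₀) = 2 * c i₀ := by
    simp only [v, Finset.mul_sum, ← Finset.sum_add_distrib]
    rw [Finset.sum_eq_single_of_mem i₀ (by simp)]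
    · rcases hε (z i₀).2 with h1 | h1 <;> simp [h1] <;> ring
    · intro i hi hne
      split_ifs with hρi
      · have hεi : ε (z i).2 ≠ ε (z i₀).2 := fun hεi => hne (hz (Prod.ext ?_ (Subtype.ext ?_)))
        · rcases hε (z i).2 with h1 | h1 <;> rcases hε (z i₀).2 with h2 | h2 <;>
            simp [h1, h2] at hεi ⊢
        · rw [← hσ i, ← hσ i₀, (Finset.mem_filter.1 hi).2]
        · rw [hρ (z i).2, hρ (z i₀).2, hεi, hρi]
      · simp
  rw [hv0, hv1] at hkey
  refine hi₀ ?_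
  simpa using hkey.symm

end Sufficiency

theorem theorem4p2 {G : Type*} [Group G] [TopologicalSpace G] [IsTopologicalGroup G]
    [LocallyCompactSpace G] (d : ℕ) (hd : 2 ≤ d) (f g : G → ℝ → ℂ)
    (hf : IsIsotropicPartPD d f) (hg : IsIsotropicPartPD d g) :
    IsIsotropicPartSPD d (fun u t => f u t * g u t) ↔
      ∀ p : ℕ, 1 ≤ p → ∀ u : Fin p → G, Function.Injective u → ∀ c : Fin p → ℂ, c ≠ 0 →
        {m ∈ positiveSumSet d f g u c | Even m}.Infinite ∧
          {m ∈ positiveSumSet d f g u c | Odd m}.Infinite :=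
  ⟨fun h _ _ _ hu _ hc => infinite_positiveSumSet_of_strict hd hf hg h hu hc,
    fun h => ⟨hf.1.mul hg.1, isStrictPosDefKernel_of_infinite hd hf hg h⟩⟩
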